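/- Let $n\in\{2,3\}$ and $\mu>0$. **Domains.** Fix an orthonormal frame $(e_0,\dots,e_{n-1})$ of $\mathbb R^n$, a curve $\gamma\in C^2((-L,L);\mathbb R^n)$ with $\langle\gamma',e_0\rangle\ge\kappa$, $|\gamma'|\le K$ and $L\ge L_0$, and an open set $S\subset\mathbb R^{n-1}$. Put $N=\{\gamma(a)+\sum_{k=1}^{n-1}y_ke_k: |a|<L,\ y\in S\}$, with lateral boundary $\hat\Gamma_N=\{\gamma(a)+\sum_k y_ke_k: |a|<L,\ y\in\partial S\}$. $N$ is a *nozzle* if $S$ is a bounded simply connected Lipschitz domain with $\operatorname{diam}S\le\varepsilon$; for $n=3$ it is a *slab* if $S$ is an open convex quadrilateral of extent at most $\varepsilon$ in one of the two coordinates of the section (the thin one) and at least $\Lambda$ in the other. Let $\Omega$ be a finite union of pairwise disjoint nozzles and slabs, each with its own frame, curve, length and section but with common constants $\kappa,K,L_0,\Lambda>0$ that do not depend on $\varepsilon$. **Equation and data.** For $j=1,2$ let $u^j$ be a (complex-valued) distributional solution of $$\partial_t u^j+\nabla\cdot(\boldsymbol c^ju^j)=\mu\Delta u^j+R^j(u^j,\nabla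 u^j)\quad\text{in }\Omega\times(0,T).$$ Let $\alpha_2,\alpha_3,\alpha_4\in(0,1)$ and let $C_2,C_3,C_4>0$ be independent of $\varepsilon$. Assume that $R^j$ is bounded by $C_2$ in $C^{0,\alpha_2}$ in each of its two arguments, uniformly in the other one; that on $\overline N\times[0,T]$, for every piece $N$ of $\Omega$, the components of $\boldsymbol c^j$ are bounded by $C_3$ in $C^{0,\alpha_3}$ in $\mathbf x$ and in $C^{0,\alpha_3/2}$ in $t$; and that $u^j$ is bounded by $C_4$ in $C^{1,\alpha_4}(\overline N\times[0,T])$, i.e. $|u^j|,|Du^j|\le C_4$, $Du^j$ is $\alpha_4$-Hölder with constant $C_4$, and the first order Taylor remainder of $u^j$ between any two points $p,q$ is at most $C_4|p-q|^{1+\alpha_4}$. Let $0\le T_1<T_2\le T$ and suppose that the two passive boundary measurements $$\Big(u^j,\ \partial_\nu u^j-\tfrac1\mu\,\nu\cdot(\boldsymbol c^ju^j)\Big),\qquad j=1,2,$$ coincide on $\hat\Gamma_N\times(T_1,T_2)$ for every piece $N$ of $\Omega$ ($\nu$ is the outward unit normal of $N$; the second components are compared wherever it exists). **(a)** Let $0<l<1+\alpha_3\alpha_4$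 and suppose that for every piece each parameter interval of length $\varepsilon^l$ contained in $(-L,L)$ contains some $b$ with $\gamma'(b)$ parallel to $e_0$. For a transverse frame vector $e_k$ write $\widetilde c^{\,j}=e_k\cdot\boldsymbol c^j$, where $k\in\{1,\dots,n-1\}$ is arbitrary if the piece is a nozzle and $e_k$ is the thickness direction if it is a slab. Then there are a constant $C>0$, depending only on $n,\mu,l,\alpha_2,\alpha_3,\alpha_4,C_2,C_4$, and an $\varepsilon_0>0$, depending on these and on $C_3,\kappa,K,L_0,\Lambda$, such that for all $0<\varepsilon<\varepsilon_0$, every piece $N$ and all $t\in[T_1,T_2]$ $$\|\widetilde c^{\,1}u^1-\widetilde c^{\,2}u^2\|_{L^\infty(N)}\le C\varepsilon^{\tau},\qquad \tau=\begin{cases}\alpha_3\alpha_4l,&0<l\le\frac1{1+\alpha_3\alpha_4},\\ \frac12[1-l(1-\alpha_3\alpha_4)],&\frac1{1+\alpha_3\alpha_4}<l<1,\\ \frac12(1-l+\alpha_3\alpha_4),&1\le l<1+\alpha_3\alpha_4.\end{cases}$$ **(b)** If instead $\boldsymbol c^1u^1=\boldsymbol c^2u^2$ in $\Omega\times[T_1,T_2]$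 (with no condition on the directions of $\gamma'$), then there are $\widetilde C>0$, depending only on $n,\mu,\alpha_2,\alpha_3,\alpha_4,C_2,C_4$, and $\varepsilon_0>0$, depending on these and on $C_3,\kappa,K,L_0,\Lambda$, such that for all $0<\varepsilon<\varepsilon_0$ and all $t\in[T_1,T_2]$ $$\|R^1(u^1,\nabla u^1)-R^2(u^2,\nabla u^2)\|_{L^\infty(\Omega)}\le\widetilde C\,\varepsilon^{\tau_1},\qquad \tau_1=\frac{\alpha_2\alpha_4^2}{1+\alpha_2\alpha_4}.$$ -/

import Mathlib

open Set MeasureTheory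
open scoped ContDiff

noncomputable section

namespace ThinRDC

/-- Euclidean space `ℝⁿ`. -/
abbrev E (n : ℕ) : Type := EuclideanSpace ℝ (Fin n)

/-! ### Hölder classes -/

/-- `‖f‖_{C^{0,α}(s)} ≤ M`, where the norm is the sup norm plus the Hölder seminorm. -/
def HolderNormLE {X Y : Type*} [PseudoMetricSpace X] [SeminormedAddCommGroup Y]
    (α M : ℝ) (s : Set X) (f : X → Y) : Prop :=
  ∃ A B : ℝ, 0 ≤ A ∧ 0 ≤ B ∧ A + B ≤ M ∧ (∀ x ∈ s, ‖f x‖ ≤ A) ∧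
    ∀ x ∈ s, ∀ y ∈ s, ‖f x - f y‖ ≤ B * dist x y ^ α

/-- `u` is of class `C^{1,α}` on the closed set `s`, with derivative `Du` and norm at most `M`:
bounds for `u` and `Du`, the Hölder bound for `Du`, and the first order Taylor formula with
remainder `M |q - p|^{1+α}` between any two points of `s`. At interior points of `s` this makes
`Du` the Fréchet derivative of `u`; on the boundary `Du` is its continuous extension. -/
structure C1HolderLE {V : Type*} [NormedAddCommGroup V] [NormedSpace ℝ V]
    (α M : ℝ) (s : Set V) (u : V → ℂ) (Du : V → V →L[ℝ] ℂ) : Prop where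
  bound : ∀ p ∈ s, ‖u p‖ ≤ M
  bound_deriv : ∀ p ∈ s, ‖Du p‖ ≤ M
  holder_deriv : ∀ p ∈ s, ∀ q ∈ s, ‖Du p - Du q‖ ≤ M * dist p q ^ α
  taylor : ∀ p ∈ s, ∀ q ∈ s, ‖u q - u p - Du p (q - p)‖ ≤ M * dist p q ^ (1 + α)

/-! ### Geometry -/

/-- Near each of its boundary points, `S` is the part of space below the graph, in the direction
of a unit vector `v`, of a Lipschitz function of the projection onto the hyperplane `v^⊥`. -/
def IsLipschitzDomain {m : ℕ} (S : Set (E m)) : Prop :=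
  ∀ y₀ ∈ frontier S, ∃ (v : E m) (r : ℝ) (k : NNReal) (g : E m → ℝ),
    ‖v‖ = 1 ∧ 0 < r ∧ LipschitzWith k g ∧
    ∀ y ∈ Metric.ball y₀ r, (y ∈ S ↔ inner ℝ v y < g (y - inner ℝ v y • v))

/-- `ν` is the outward unit normal of `U` at `x`: up to angles that become arbitrarily small near
`x`, the set `U` is the half space `⟨z - x, ν⟩ < 0`. -/
def IsOutwardNormal {n : ℕ} (U : Set (E n)) (x ν : E n) : Prop :=
  ‖ν‖ = 1 ∧ ∀ η : ℝ, 0 < η → ∃ r : ℝ, 0 < r ∧ ∀ z ∈ Metric.ball x r,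
    (inner ℝ (z - x) ν < -η * ‖z - x‖ → z ∈ U) ∧ (η * ‖z - x‖ < inner ℝ (z - x) ν → z ∉ U)

/-- The two kinds of product-type domains. For a slab we record the index of the long and of the
thin transverse coordinate. -/
inductive PieceKind (m : ℕ) : Type
  | nozzle : PieceKind m
  | slab (long thin : Fin m) : PieceKind m

/-- Data of a nozzle or slab in `ℝ^{m+1}`: a curve over `(-L, L)`, a cross-section in `ℝ^m`, and an
orthonormal frame. The vector `frame 0` is the normal of the cross-sectional hyperplane, and the
coordinate `k` of the cross-section is laid along `frame k.succ`. -/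
structure Piece (m : ℕ) where
  kind : PieceKind m
  frame : OrthonormalBasis (Fin (m + 1)) ℝ (E (m + 1))
  L : ℝ
  curve : ℝ → E (m + 1)
  cross : Set (E m)

namespace Piece

variable {m : ℕ}

/-- The point `y` of the cross-section, translated to the point `γ(a)` of the curve. -/
def place (P : Piece m) (a : ℝ) (y : E m) : E (m + 1) :=
  P.curve a + ∑ k : Fin m, y k • P.frame k.succ

/-- The domain swept out by translating the cross-section along the curve. -/
def carrier (P : Piece m) : Set (E (m + 1)) :=
  {x | ∃ a ∈ Ioo (-P.L) P.L, ∃ y ∈ P.cross, x = P.place a y}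

/-- The lateral boundary, swept out by the boundary of the cross-section. -/
def lateral (P : Piece m) : Set (E (m + 1)) :=
  {x | ∃ a ∈ Ioo (-P.L) P.L, ∃ y ∈ frontier P.cross, x = P.place a y}

/-- The transverse coordinates in which the flux is estimated: all of them for a nozzle, the
thickness direction for a slab. -/
def resolved (P : Piece m) : Set (Fin m) :=
  match P.kind with
  | .nozzle => univ
  | .slab _ thin => {thin}

/-- Every parameter window of length `ε^l` contains a point at which the tangent of the curve is
parallel to the fixed direction `frame 0`. -/
def TangentsRecur (P : Piece m) (ε l : ℝ) : Prop :=
  ∀ a : ℝ, Ioo a (a + ε ^ l) ⊆ Ioo (-P.L) P.L →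
    ∃ b ∈ Ioo a (a + ε ^ l), ∃ r : ℝ, deriv P.curve b = r • P.frame 0

end Piece

/-- Cross-section of a nozzle: a bounded simply connected Lipschitz domain of diameter `≤ ε`. -/
structure IsNozzleSection {m : ℕ} (ε : ℝ) (S : Set (E m)) : Prop where
  isOpen : IsOpen S
  bounded : Bornology.IsBounded S
  simplyConnected : SimplyConnectedSpace S
  lipschitz : IsLipschitzDomain S
  diam_le : Metric.diam S ≤ ε

/-- Cross-section of a slab: an open (convex) planar quadrilateral of width at most `ε` in the thin
coordinate and of length at least `Λ` in the long coordinate. -/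
structure IsSlabSection {m : ℕ} (ε Λ : ℝ) (long thin : Fin m) (S : Set (E m)) : Prop where
  planar : m = 2
  long_ne_thin : long ≠ thin
  quadrilateral : ∃ p : Fin 4 → E m, S = interior (convexHull ℝ (range p))
  width_le : ∀ y ∈ S, ∀ z ∈ S, |y thin - z thin| ≤ ε
  le_length : ∃ y ∈ S, ∃ z ∈ S, Λ ≤ |y long - z long|

/-- `P` is a nozzle or slab domain with geometric parameter `ε`. The numbers `κ, K, L₀, Λ` are
bounds, independent of `ε`, for the regularly parametrized `C²` curve (which crosses the
cross-sections transversally), for its length, and for the length of the slab sections. -/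
structure Piece.IsThin {m : ℕ} (P : Piece m) (κ K L₀ Λ ε : ℝ) : Prop where
  le_L : L₀ ≤ P.L
  curve_contDiff : ContDiffOn ℝ 2 P.curve (Ioo (-P.L) P.L)
  curve_bound : ∀ a ∈ Ioo (-P.L) P.L, ‖deriv P.curve a‖ ≤ K
  curve_transversal : ∀ a ∈ Ioo (-P.L) P.L, κ ≤ inner ℝ (deriv P.curve a) (P.frame 0)
  section_spec :
    match P.kind with
    | .nozzle => IsNozzleSection ε P.cross
    | .slab long thin => IsSlabSection ε Λ long thin P.cross

/-! ### The reaction-diffusion-convection equation -/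

/-- Velocity field `c`, reaction `R`, state `u` and its space-time derivative `Du`. -/
structure Params (n : ℕ) where
  c : E n × ℝ → EuclideanSpace ℂ (Fin n)
  R : ℂ → EuclideanSpace ℂ (Fin n) → ℂ
  u : E n × ℝ → ℂ
  Du : E n × ℝ → E n × ℝ →L[ℝ] ℂ

namespace Params

variable {n : ℕ}

/-- The spatial gradient of the state. -/
def grad (A : Params n) (p : E n × ℝ) : EuclideanSpace ℂ (Fin n) :=
  WithLp.toLp 2 fun i => A.Du p (EuclideanSpace.single i 1, 0)

/-- The realization `R(u, ∇u)` of the reaction. -/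
def reaction (A : Params n) (p : E n × ℝ) : ℂ := A.R (A.u p) (A.grad p)

/-- The realization `c u` of the flux. -/
def flux (A : Params n) (p : E n × ℝ) : EuclideanSpace ℂ (Fin n) := A.u p • A.c p

/-- `∂_t u + ∇·(c u) = μ Δu + R(u, ∇u)` in `Ω × (0, T)`, in the sense of distributions. -/
def IsSolution (A : Params n) (μ : ℝ) (Ω : Set (E n)) (T : ℝ) : Prop :=
  ∀ φ : E n × ℝ → ℝ, ContDiff ℝ ∞ φ → HasCompactSupport φ → tsupport φ ⊆ Ω ×ˢ Ioo 0 T →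
    ∫ p : E n × ℝ,
      (A.u p * (fderiv ℝ φ p (0, 1) : ℂ)
        + ∑ i, A.flux p i * (fderiv ℝ φ p (EuclideanSpace.single i 1, 0) : ℂ)
        - (μ : ℂ) * ∑ i, A.grad p i * (fderiv ℝ φ p (EuclideanSpace.single i 1, 0) : ℂ)
        + A.reaction p * (φ p : ℂ)) = 0

/-- The a priori bounds on `closure N × [0, T]`: the reaction is `C^{0,α₂}` in each of its two
arguments, the components of the velocity are `C^{0,α₃}` in space and `C^{0,α₃/2}` in time, and the
state is `C^{1,α₄}`. -/
structure Bounds (A : Params n) (α₂ α₃ α₄ C₂ C₃ C₄ : ℝ) (N : Set (E n)) (T : ℝ) : Prop where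
  reaction_state : ∀ q, HolderNormLE α₂ C₂ univ fun z => A.R z q
  reaction_grad : ∀ z, HolderNormLE α₂ C₂ univ fun q => A.R z q
  velocity_space : ∀ i, ∀ t ∈ Icc 0 T, HolderNormLE α₃ C₃ (closure N) fun x => A.c (x, t) i
  velocity_time : ∀ i, ∀ x ∈ closure N, HolderNormLE (α₃ / 2) C₃ (Icc 0 T) fun t => A.c (x, t) i
  state : C1HolderLE α₄ C₄ (closure N ×ˢ Icc 0 T) A.u A.Du

/-- The normal derivative `∂_ν u`. -/
def normalDeriv (A : Params n) (p : E n × ℝ) (ν : E n) : ℂ := A.Du p (ν, 0)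

/-- The boundary coupling term: the flux through the boundary that is due to convection,
`- ν·(c u) / μ`. With it, `-μ (∂_ν u + coupling)` is the total normal flux `ν·(c u - μ ∇u)`. -/
def coupling (A : Params n) (μ : ℝ) (p : E n × ℝ) (ν : E n) : ℂ :=
  -(∑ i, (ν i : ℂ) * A.flux p i) / (μ : ℂ)

end Params

/-- The passive boundary measurements `(u, ∂_ν u + coupling)` of `A₁` and `A₂` agree on
`Γ × (T₁, T₂)`, where `Γ` is a part of the boundary of `N`; the second components are compared
wherever the boundary has an outward normal. -/
def SameMeasurement {n : ℕ} (A₁ A₂ : Params n) (μ : ℝ) (N Γ : Set (E n)) (T₁ T₂ : ℝ) : Prop :=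
  ∀ x ∈ Γ, ∀ t ∈ Ioo T₁ T₂, A₁.u (x, t) = A₂.u (x, t) ∧
    ∀ ν, IsOutwardNormal N x ν →
      A₁.normalDeriv (x, t) ν + A₁.coupling μ (x, t) ν =
        A₂.normalDeriv (x, t) ν + A₂.coupling μ (x, t) ν

/-- The component of a vector along the transverse frame vector number `k`, i.e. a component of the
vector in the rotated coordinates of the piece `P`. -/
def rotated {m : ℕ} (P : Piece m) (k : Fin m) (F : EuclideanSpace ℂ (Fin (m + 1))) : ℂ :=
  ∑ i, (P.frame k.succ i : ℂ) * F i

/-- A domain made of finitely many pieces, a time horizon and observation window, and two sets of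
parameters. -/
structure Setting (m : ℕ) where
  count : ℕ
  piece : Fin count → Piece m
  T : ℝ
  T₁ : ℝ
  T₂ : ℝ
  A₁ : Params (m + 1)
  A₂ : Params (m + 1)

/-- The standing hypotheses: `Ω` is a disjoint union of nozzles and slabs, both parameter sets obey
the a priori bounds and solve the equation in `Ω × (0, T)`, and their passive measurements on the
lateral boundary during `(T₁, T₂)` coincide. -/
structure Setting.IsAdmissible {m : ℕ} (X : Setting m)
    (μ α₂ α₃ α₄ C₂ C₃ C₄ κ K L₀ Λ ε : ℝ) : Prop where
  thin : ∀ j, (X.piece j).IsThin κ K L₀ Λ ε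
  disjoint : Pairwise fun i j => Disjoint (X.piece i).carrier (X.piece j).carrier
  zero_le_T₁ : 0 ≤ X.T₁
  T₁_lt_T₂ : X.T₁ < X.T₂
  T₂_le_T : X.T₂ ≤ X.T
  bounds₁ : ∀ j, X.A₁.Bounds α₂ α₃ α₄ C₂ C₃ C₄ (X.piece j).carrier X.T
  bounds₂ : ∀ j, X.A₂.Bounds α₂ α₃ α₄ C₂ C₃ C₄ (X.piece j).carrier X.T
  solution₁ : X.A₁.IsSolution μ (⋃ j, (X.piece j).carrier) X.T
  solution₂ : X.A₂.IsSolution μ (⋃ j, (X.piece j).carrier) X.T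
  measurement : ∀ j, SameMeasurement X.A₁ X.A₂ μ (X.piece j).carrier (X.piece j).lateral X.T₁ X.T₂

/-- The exponent of the flux estimate, with `a` the product of the Hölder exponents of the velocity
and of the state. -/
def tau (a l : ℝ) : ℝ :=
  if l ≤ 1 / (1 + a) then a * l
  else if l < 1 then (1 - l * (1 - a)) / 2
  else (1 - l + a) / 2

/-- The exponent of the reaction estimate. -/
def tau₁ (α₂ α₄ : ℝ) : ℝ := α₂ * α₄ ^ 2 / (1 + α₂ * α₄)

end ThinRDC

end

noncomputable section

namespace ThinRDC

/-! ### Cross-sections -/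

/-! Let U be the difference of the two states (`stateGap`), with space-time derivative `derivGap`,
and let `fluxGap` be the difference of the convective fluxes, read as a linear form on directions.
On the lateral boundary the measurements say that U = 0 and that `fluxGap` and μ·∇U agree on outward
normals (`normal_identity`). Both parts exploit that every point of a thin piece is close to this
boundary.

Part (a). Where γ' is parallel to the frame vector 0, the normals of the piece are the lifted
normals of the section. A continuous field of covectors that kills all normals of a Lipschitz domain
also kills each direction in which the domain is locally extreme, whether or not a normal exists
there (`IsLipschitzDomain.apply_eq_zero_of_extreme`). At an extreme point of the section the flux
difference in the transverse direction is therefore μ times a derivative of U. That derivative is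
O(ε^α₄), because a boundary chord of length at most ε in this direction has U = 0 at both ends. In a
slab the extreme direction is tilted by a slope of at most ε/w, where w is the width of the stretch
in which the extreme point is sought (`exists_extreme_between`, `exists_small_flux`). Hölder
continuity of the flux carries the bound to every point (`norm_fluxGap_le`).

Part (b). With equal fluxes the normal derivative of U vanishes on the lateral boundary. So do the
tangential and time derivatives, since U = 0 there. Hence U = O(ε^(1+α₄)) and DU = O(ε^α₄)
throughout the piece (`derivGap_eq_zero`, `gap_le`). The difference of the weak equations is tested
with a bump of size ℓ = ε^s, and both space derivatives are moved off U, which leaves ε^(1+α₄)/ℓ². A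
cutoff at distance δ from the lateral boundary makes the test function admissible. Its gradient is
of order 1/δ on a set of volume O(δ) where U and DU are O(δ^α₄), so its contribution vanishes as δ →
0 (`norm_integral_grad_mul_le`, `norm_reactionGap_le_of_window`). The reaction difference is Hölder
with exponent α₂α₄, so its averages control its values.

Constants. In both parts the terms that carry C₃, κ or K have exponents strictly larger than the
claimed one. They are absorbed by the choice of ε₀, which is why the final constants do not depend
on these numbers. -/

theorem inter_frontier_nonempty_of_isPreconnected {X : Type*} [TopologicalSpace X] {S T : Set X}
    (hS : IsOpen S) (hT : IsPreconnected T) (h1 : (T ∩ S).Nonempty) (h2 : (T ∩ Sᶜ).Nonempty) :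
    (T ∩ frontier S).Nonempty := by
  by_contra hcon
  have hsub : T ⊆ S ∪ (closure S)ᶜ := by
    intro x hx
    by_contra hx'
    rw [mem_union, not_or, Set.notMem_compl_iff] at hx'
    exact hcon ⟨x, hx, by rw [hS.frontier_eq]; exact ⟨hx'.2, hx'.1⟩⟩
  obtain ⟨y, hy, hy'⟩ := h2
  have hy2 : y ∈ (closure S)ᶜ := (hsub hy).resolve_left hy'
  obtain ⟨z, _, hz1, hz2⟩ := hT _ _ hS isClosed_closure.isOpen_compl hsub h1 ⟨y, hy, hy2⟩
  exact hz2 (subset_closure hz1)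

theorem exists_exit {m : ℕ} {S : Set (E m)} (hS : IsOpen S) (hb : Bornology.IsBounded S)
    {r d : E m} (hr : r ∈ S) (hd : d ≠ 0) : ∃ c : ℝ, 0 < c ∧ r + c • d ∈ frontier S := by
  obtain ⟨B, hB⟩ := hb.exists_norm_le
  have hdpos : 0 < ‖d‖ := norm_pos_iff.2 hd
  set c₁ : ℝ := (B + ‖r‖ + 1) / ‖d‖ with hc₁
  have hB0 : 0 ≤ B := (norm_nonneg _).trans (hB r hr)
  have hc₁pos : 0 < c₁ := by positivity
  have hout : r + c₁ • d ∉ S := by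
    intro h
    have h1 := hB _ h
    have h2 : ‖c₁ • d‖ = B + ‖r‖ + 1 := by
      rw [norm_smul, Real.norm_of_nonneg hc₁pos.le, hc₁]; field_simp
    have h3 : ‖c₁ • d‖ ≤ ‖r + c₁ • d‖ + ‖r‖ := by
      have := norm_sub_le (r + c₁ • d) r
      simpa using this
    linarith
  have hcon : IsPreconnected ((fun c : ℝ => r + c • d) '' Icc 0 c₁) :=
    isPreconnected_Icc.image _ (by fun_prop)
  obtain ⟨z, ⟨c, hc, rfl⟩, hz⟩ :=
    inter_frontier_nonempty_of_isPreconnected hS hcon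
      ⟨r, ⟨0, ⟨le_rfl, hc₁pos.le⟩, by simp⟩, hr⟩
      ⟨r + c₁ • d, ⟨c₁, ⟨hc₁pos.le, le_rfl⟩, rfl⟩, hout⟩
  refine ⟨c, lt_of_le_of_ne hc.1 ?_, hz⟩
  rintro rfl
  rw [hS.frontier_eq] at hz
  exact hz.2 (by simpa using hr)

/-- On the line the second vector is taken to be 0. This lets sections in dimension one and two
share one description as graphs over a real parameter. -/
theorem exists_complementary_vector {m : ℕ} (hm : m = 1 ∨ m = 2) {v : E m} (hv : ‖v‖ = 1) :
    ∃ e : E m, inner ℝ v e = 0 ∧ (∀ z, z = inner ℝ v z • v + inner ℝ e z • e) ∧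
      (‖e‖ = 1 ∧ m = 2 ∨ e = 0) := by
  rcases hm with rfl | rfl
  · refine ⟨0, by simp, fun z => ?_, Or.inr rfl⟩
    have h1 : v 0 ^ 2 = 1 := by
      have := EuclideanSpace.real_norm_sq_eq v
      rw [hv] at this; simpa using this.symm
    ext i
    have : i = 0 := Subsingleton.elim _ _
    subst this
    simp [PiLp.inner_apply]
    linear_combination (-(z 0)) * h1
  · have h1 : v 0 ^ 2 + v 1 ^ 2 = 1 := by
      have := EuclideanSpace.real_norm_sq_eq v
      rw [hv] at this; simpa [Fin.sum_univ_two] using this.symm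
    refine ⟨!₂[-v 1, v 0], ?_, fun z => ?_, Or.inl ⟨?_, rfl⟩⟩
    · simp [PiLp.inner_apply, Fin.sum_univ_two]; ring
    · ext i
      fin_cases i <;> simp [PiLp.inner_apply, Fin.sum_univ_two]
      · linear_combination (-(z 0)) * h1
      · linear_combination (-(z 1)) * h1
    · have : ‖(!₂[-v 1, v 0] : E 2)‖ ^ 2 = 1 := by
        rw [EuclideanSpace.real_norm_sq_eq]; simp [Fin.sum_univ_two]; linarith
      nlinarith [norm_nonneg (!₂[-v 1, v 0] : E 2)]

/-- In the ball of radius `r` about `y₀`, the set `S` is the part of the plane (or line) below the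
graph of the Lipschitz function `f`, in the coordinates given by `v` and `e`. -/
structure IsLocalGraph {m : ℕ} (S : Set (E m)) (y₀ v e : E m) (f : ℝ → ℝ) (k : NNReal) (r : ℝ) :
    Prop where
  norm_v : ‖v‖ = 1
  orth : inner ℝ v e = 0
  decomp : ∀ z : E m, z = inner ℝ v z • v + inner ℝ e z • e
  e_spec : ‖e‖ = 1 ∧ m = 2 ∨ e = 0 ∧ ∀ s, f s = f 0
  pos : 0 < r
  lip : LipschitzWith k f
  mem_iff : ∀ y ∈ Metric.ball y₀ r, (y ∈ S ↔ inner ℝ v y < f (inner ℝ e y))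

theorem IsLipschitzDomain.exists_isLocalGraph {m : ℕ} (hm : m = 1 ∨ m = 2) {S : Set (E m)}
    (hL : IsLipschitzDomain S) {y₀ : E m} (hy : y₀ ∈ frontier S) :
    ∃ v e f k r, IsLocalGraph S y₀ v e f k r := by
  obtain ⟨v, r, k, g, hv, hr, hg, h⟩ := hL y₀ hy
  obtain ⟨e, h1, h2, h3⟩ := exists_complementary_vector hm hv
  have he : ‖e‖ ≤ 1 := by rcases h3 with h3 | h3 <;> simp [h3]
  refine ⟨v, e, fun s => g (s • e), k, r, hv, h1, h2, ?_, hr, ?_, ?_⟩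
  · rcases h3 with h3 | h3
    · exact Or.inl h3
    · exact Or.inr ⟨h3, by simp [h3]⟩
  · refine LipschitzWith.of_dist_le_mul fun s t => (hg.dist_le_mul _ _).trans ?_
    gcongr
    rw [dist_eq_norm, ← sub_smul, norm_smul, Real.dist_eq, Real.norm_eq_abs]
    exact mul_le_of_le_one_right (abs_nonneg _) he
  · intro y hy
    rw [h y hy]
    have : y - inner ℝ v y • v = inner ℝ e y • e := by
      rw [sub_eq_iff_eq_add', ← h2 y]
    rw [this]

/-! ### Frontier points and normals of a local graph. -/

namespace IsLocalGraph

variable {m : ℕ} {S : Set (E m)} {y₀ v e : E m} {f : ℝ → ℝ} {k : NNReal} {r : ℝ}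

theorem norm_e_le (h : IsLocalGraph S y₀ v e f k r) : ‖e‖ ≤ 1 := by
  rcases h.e_spec with h3 | h3 <;> simp [h3]

theorem inner_v_v (h : IsLocalGraph S y₀ v e f k r) : inner ℝ v v = 1 := by
  rw [real_inner_self_eq_norm_sq, h.norm_v]; norm_num

theorem inner_e_v (h : IsLocalGraph S y₀ v e f k r) : inner ℝ e v = 0 := by
  rw [real_inner_comm]; exact h.orth

theorem continuous_gap (h : IsLocalGraph S y₀ v e f k r) :
    Continuous fun y : E m => inner ℝ v y - f (inner ℝ e y) := by
  have := h.lip.continuous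
  fun_prop

theorem mem_frontier_iff (h : IsLocalGraph S y₀ v e f k r) (hS : IsOpen S) {y : E m}
    (hy : y ∈ Metric.ball y₀ r) : y ∈ frontier S ↔ inner ℝ v y = f (inner ℝ e y) := by
  rw [hS.frontier_eq, mem_sdiff]
  constructor
  · rintro ⟨h1, h2⟩
    rw [h.mem_iff y hy, not_lt] at h2
    refine le_antisymm ?_ h2
    by_contra! hlt
    have ho : IsOpen (Metric.ball y₀ r ∩ {y | 0 < inner ℝ v y - f (inner ℝ e y)}) :=
      Metric.isOpen_ball.inter (isOpen_lt continuous_const h.continuous_gap)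
    obtain ⟨z, ⟨hz1, hz2⟩, hz3⟩ := mem_closure_iff.1 h1 _ ho ⟨hy, by simpa using hlt⟩
    have := (h.mem_iff z hz1).1 hz3
    simp only [mem_ofPred_eq] at hz2
    linarith
  · intro heq
    refine ⟨?_, by rw [h.mem_iff y hy, heq]; exact lt_irrefl _⟩
    rw [Metric.mem_closure_iff]
    intro η hη
    rw [Metric.mem_ball] at hy
    set t := min (η / 2) ((r - dist y y₀) / 2)
    have ht : 0 < t := lt_min (by positivity) (by linarith)
    have hd : dist y (y - t • v) = t := by
      rw [dist_eq_norm]; simp [norm_smul, h.norm_v, abs_of_pos ht]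
    refine ⟨y - t • v, ?_, ?_⟩
    · rw [h.mem_iff]
      · simp only [inner_sub_right, inner_smul_right, h.inner_v_v, h.inner_e_v, heq]
        simpa using ht
      · rw [Metric.mem_ball]
        have h1 : dist (y - t • v) y₀ ≤ dist y (y - t • v) + dist y y₀ := by
          rw [dist_comm y]; exact dist_triangle _ _ _
        have : t ≤ (r - dist y y₀) / 2 := min_le_right _ _
        linarith
    · rw [hd]
      exact (min_le_left _ _).trans_lt (by linarith)

/-- The point of the graph over `s`. -/
def point (_ : IsLocalGraph S y₀ v e f k r) (s : ℝ) : E m :=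
  y₀ + (s - inner ℝ e y₀) • e + (f s - f (inner ℝ e y₀)) • v

theorem point_self (h : IsLocalGraph S y₀ v e f k r) : h.point (inner ℝ e y₀) = y₀ := by
  simp [point]

theorem continuous_point (h : IsLocalGraph S y₀ v e f k r) : Continuous h.point := by
  have := h.lip.continuous
  unfold point
  fun_prop

theorem f_inner_point (h : IsLocalGraph S y₀ v e f k r) (s : ℝ) :
    f (inner ℝ e (h.point s)) = f s := by
  rcases h.e_spec with ⟨h1, _⟩ | ⟨_, h1⟩
  · congr 1
    simp [point, inner_add_right, inner_smul_right, h.inner_e_v, h1]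
  · rw [h1, h1 s]

theorem inner_v_point (h : IsLocalGraph S y₀ v e f k r)
    (h0 : inner ℝ v y₀ = f (inner ℝ e y₀)) (s : ℝ) : inner ℝ v (h.point s) = f s := by
  simp [point, inner_add_right, inner_smul_right, h.orth, h.norm_v, h0]

theorem inner_e_point_hasDerivAt (h : IsLocalGraph S y₀ v e f k r) {s q : ℝ}
    (hq : HasDerivAt f q s) : HasDerivAt f q (inner ℝ e (h.point s)) := by
  rcases h.e_spec with ⟨h1, _⟩ | ⟨_, h1⟩
  · have : inner ℝ e (h.point s) = s := by
      simp [point, inner_add_right, inner_smul_right, h.inner_e_v, h1]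
    rwa [this]
  · have hf : f = fun _ => f 0 := funext h1
    have h2 : q = 0 := hq.unique (by rw [hf]; exact hasDerivAt_const _ _)
    rw [h2]
    exact (hasDerivAt_const _ (f 0)).congr_of_eventuallyEq (Filter.Eventually.of_forall h1)

/-- The inner product of z - y with v - q·e is the signed gap between z and the graph plus the first
order remainder of f. The vector has norm at least 1, so normalizing it still leaves room for a
remainder of η/2 times the distance. -/
theorem isOutwardNormal (h : IsLocalGraph S y₀ v e f k r) {y : E m}
    (hy : y ∈ Metric.ball y₀ r) (heq : inner ℝ v y = f (inner ℝ e y)) {q : ℝ}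
    (hq : HasDerivAt f q (inner ℝ e y)) :
    ∃ c : ℝ, 0 < c ∧ IsOutwardNormal S y (c • (v - q • e)) := by
  set w := v - q • e with hw
  have hvw : inner ℝ v w = 1 := by
    simp [hw, inner_sub_right, inner_smul_right, h.orth, h.norm_v]
  have hw1 : 1 ≤ ‖w‖ := by
    have := real_inner_le_norm v w
    rwa [hvw, h.norm_v, one_mul] at this
  have hwpos : 0 < ‖w‖ := by linarith
  refine ⟨‖w‖⁻¹, by positivity, by rw [norm_smul, norm_inv, norm_norm, inv_mul_cancel₀ hwpos.ne'], ?_⟩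
  intro η hη
  have hd := (hasDerivAt_iff_isLittleO.1 hq).def (c := η / 2) (by positivity)
  obtain ⟨ρ, hρ, hball⟩ := Metric.eventually_nhds_iff.1 hd
  rw [Metric.mem_ball] at hy
  refine ⟨min ρ (r - dist y y₀), lt_min hρ (by linarith), fun z hz => ?_⟩
  rw [Metric.mem_ball, lt_min_iff] at hz
  have hzr : z ∈ Metric.ball y₀ r := by
    rw [Metric.mem_ball]; linarith [dist_triangle z y y₀]
  have hez : |inner ℝ e z - inner ℝ e y| ≤ ‖z - y‖ := by
    rw [← inner_sub_right]
    exact (abs_real_inner_le_norm _ _).trans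
      (mul_le_of_le_one_left (norm_nonneg _) h.norm_e_le)
  have hest := hball (y := inner ℝ e z) (by
    rw [Real.dist_eq]; exact hez.trans_lt (by rw [← dist_eq_norm]; exact hz.1))
  rw [Real.norm_eq_abs, Real.norm_eq_abs, smul_eq_mul] at hest
  have hest2 : |f (inner ℝ e z) - f (inner ℝ e y) - (inner ℝ e z - inner ℝ e y) * q|
      ≤ η / 2 * ‖z - y‖ := hest.trans (by gcongr)
  have hid : inner ℝ (z - y) w = (inner ℝ v z - f (inner ℝ e z)) +
      (f (inner ℝ e z) - f (inner ℝ e y) - (inner ℝ e z - inner ℝ e y) * q) := by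
    rw [hw, inner_sub_right, inner_smul_right, real_inner_comm, real_inner_comm e, inner_sub_right,
      inner_sub_right, ← heq]
    ring
  rw [abs_le] at hest2
  have hn := norm_nonneg (z - y)
  have hηw : η * ‖z - y‖ ≤ η * ‖z - y‖ * ‖w‖ := le_mul_of_one_le_right (by positivity) hw1
  rw [h.mem_iff z hzr, inner_smul_right, hid]
  constructor
  · intro h1
    rw [inv_mul_lt_iff₀ hwpos] at h1
    nlinarith
  · intro h1
    rw [lt_inv_mul_iff₀ hwpos] at h1
    rw [not_lt]
    nlinarith

end IsLocalGraph

/-! ### Slopes of Lipschitz functions, and directions annihilated by a field of covectors. -/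

theorem exists_hasDerivAt_of_lipschitzWith {f : ℝ → ℝ} {k : NNReal} (hf : LipschitzWith k f)
    {a b : ℝ} (hab : a < b) : ∃ s ∈ Ioo a b, ∃ q, HasDerivAt f q s := by
  have h : ∀ᵐ s : ℝ, DifferentiableAt ℝ f s := hf.ae_differentiableAt
  obtain ⟨s, hs, h1⟩ := (Measure.dense_of_ae h).exists_mem_open isOpen_Ioo (nonempty_Ioo.2 hab)
  exact ⟨s, h1, _, hs.hasDerivAt⟩

/-- A mean value inequality at a point of differentiability. If every existing derivative exceeded
c, integrating over the interval would contradict the mean slope, since a Lipschitz function is the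
integral of its almost everywhere derivative. -/
theorem exists_hasDerivAt_le_of_lipschitzWith {f : ℝ → ℝ} {k : NNReal} (hf : LipschitzWith k f)
    {a b c : ℝ} (hab : a < b) (h : f b - f a < c * (b - a)) :
    ∃ s ∈ Ioo a b, ∃ q, HasDerivAt f q s ∧ q ≤ c := by
  by_contra! hcon
  have hac := (hf.lipschitzOnWith (s := uIcc a b)).absolutelyContinuousOnInterval
  have hd : ∀ᵐ s : ℝ, DifferentiableAt ℝ f s := hf.ae_differentiableAt
  have h1 := hac.integral_deriv_eq_sub
  have h2 : ∫ _ in a..b, c ≤ ∫ x in a..b, deriv f x := by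
    refine intervalIntegral.integral_mono_ae_restrict hab.le (by simp) hac.intervalIntegrable_deriv ?_
    rw [Filter.EventuallyLE, ae_restrict_iff' measurableSet_Icc]
    have hne : ∀ᵐ s : ℝ, s ≠ a ∧ s ≠ b := by
      have h3 : ∀ p : ℝ, ∀ᵐ s : ℝ, s ≠ p := fun p => by simp [ae_iff]
      filter_upwards [h3 a, h3 b] with s h4 h5 using ⟨h4, h5⟩
    filter_upwards [hd, hne] with s hs hne hs2
    exact (hcon s ⟨lt_of_le_of_ne hs2.1 hne.1.symm, lt_of_le_of_ne hs2.2 hne.2⟩ _ hs.hasDerivAt).le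
  rw [h1, intervalIntegral.integral_const, smul_eq_mul] at h2
  linarith

theorem IsLocalGraph.eventually_point_mem_ball {m : ℕ} {S : Set (E m)} {y₀ v e : E m} {f : ℝ → ℝ}
    {k : NNReal} {r : ℝ} (h : IsLocalGraph S y₀ v e f k r) {ρ : ℝ} (hρ : 0 < ρ) :
    ∃ δ > 0, ∀ s, |s - inner ℝ e y₀| < δ → h.point s ∈ Metric.ball y₀ ρ := by
  have := h.continuous_point.continuousAt (x := inner ℝ e y₀)
  obtain ⟨δ, hδ, h1⟩ := Metric.continuousAt_iff.1 this ρ hρ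
  refine ⟨δ, hδ, fun s hs => ?_⟩
  have := h1 (x := s) (by rwa [Real.dist_eq])
  rwa [h.point_self] at this

/-- Points with an outward normal are dense in the boundary of a Lipschitz domain. -/
theorem IsLipschitzDomain.exists_isOutwardNormal_near {m : ℕ} (hm : m = 1 ∨ m = 2) {S : Set (E m)}
    (hS : IsOpen S) (hL : IsLipschitzDomain S) {y₀ : E m} (hy : y₀ ∈ frontier S) {ρ : ℝ}
    (hρ : 0 < ρ) : ∃ y ∈ frontier S, dist y y₀ < ρ ∧ ∃ ν, IsOutwardNormal S y ν := by
  obtain ⟨v, e, f, k, r, h⟩ := hL.exists_isLocalGraph hm hy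
  have h0 := (h.mem_frontier_iff hS (Metric.mem_ball_self h.pos)).1 hy
  obtain ⟨δ, hδ, h1⟩ := h.eventually_point_mem_ball (lt_min hρ h.pos)
  obtain ⟨s, hs, q, hq⟩ := exists_hasDerivAt_of_lipschitzWith h.lip
    (show inner ℝ e y₀ < inner ℝ e y₀ + δ by linarith)
  have h2 := h1 s (by rw [abs_lt]; constructor <;> linarith [hs.1, hs.2])
  rw [Metric.mem_ball, lt_min_iff] at h2
  have heq : inner ℝ v (h.point s) = f (inner ℝ e (h.point s)) := by
    rw [h.f_inner_point, h.inner_v_point h0]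
  obtain ⟨c, _, hc⟩ := h.isOutwardNormal h2.2 heq (h.inner_e_point_hasDerivAt hq)
  exact ⟨h.point s, (h.mem_frontier_iff hS h2.2).2 heq, h2.1, _, hc⟩

/-- A field of covectors that annihilates the outward normals of a Lipschitz domain annihilates
every direction in which the domain is locally extreme. -/
theorem IsLipschitzDomain.apply_eq_zero_of_extreme {m : ℕ} (hm : m = 1 ∨ m = 2) {S : Set (E m)}
    (hS : IsOpen S) (hL : IsLipschitzDomain S) {y₀ : E m} (hy : y₀ ∈ frontier S)
    {G : E m → E m →L[ℝ] ℂ} (hG : ContinuousWithinAt G (frontier S) y₀)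
    (hν : ∀ y ∈ frontier S, ∀ ν, IsOutwardNormal S y ν → G y ν = 0) {d : E m} {ρ : ℝ} (hρ : 0 < ρ)
    (hd : ∀ y ∈ closure S, dist y y₀ < ρ → inner ℝ d y ≤ inner ℝ d y₀) : G y₀ d = 0 := by
  by_cases hd0 : d = 0
  · simp [hd0]
  obtain ⟨v, e, f, k, r, h⟩ := hL.exists_isLocalGraph hm hy
  have h0 := (h.mem_frontier_iff hS (Metric.mem_ball_self h.pos)).1 hy
  set s₀ := inner ℝ e y₀ with hs₀
  set dv := inner ℝ d v with hdv
  set de := inner ℝ d e with hde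
  have hfr : ∀ s, h.point s ∈ Metric.ball y₀ r → h.point s ∈ frontier S := fun s hs =>
    (h.mem_frontier_iff hS hs).2 (by rw [h.f_inner_point, h.inner_v_point h0])
  obtain ⟨δ₁, hδ₁, hp⟩ := h.eventually_point_mem_ball (lt_min hρ h.pos)
  have hext : ∀ s, |s - s₀| < δ₁ → (s - s₀) * de + (f s - f s₀) * dv ≤ 0 := by
    intro s hs
    have h2 := hp s hs
    rw [Metric.mem_ball, lt_min_iff] at h2
    have h3 := hd _ (frontier_subset_closure (hfr s h2.2)) h2.1
    simp only [IsLocalGraph.point, inner_add_right, inner_smul_right] at h3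
    linarith
  have hdecomp : d = dv • v + de • e := by
    have := h.decomp d
    rw [real_inner_comm, real_inner_comm d e] at this
    exact this
  -- The points y₀ - t·v lie below the graph, hence in S, so extremality at y₀ forces d to have a
  -- nonnegative component along v.
  have hdv0 : 0 ≤ dv := by
    set t := min (ρ / 2) (r / 2)
    have ht : 0 < t := lt_min (by linarith) (by linarith [h.pos])
    have hdist : dist (y₀ - t • v) y₀ = t := by
      rw [dist_eq_norm]; simp [norm_smul, h.norm_v, abs_of_pos ht]
    have hmem : y₀ - t • v ∈ S := by
      rw [h.mem_iff]
      · simp only [inner_sub_right, inner_smul_right, h.inner_v_v, h.inner_e_v, h0, ← hs₀, mul_zero,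
          mul_one, sub_zero]
        linarith
      · rw [Metric.mem_ball, hdist]
        exact (min_le_right _ _).trans_lt (by linarith [h.pos])
    have h3 := hd _ (subset_closure hmem) (by
      rw [hdist]; exact (min_le_left _ _).trans_lt (by linarith))
    simp only [inner_sub_right, inner_smul_right] at h3
    by_contra! hneg
    nlinarith
  -- If this component were 0, extremality at graph points on both sides of s₀ would also kill the
  -- component along e, and d would be 0.
  have hdvpos : 0 < dv := by
    refine lt_of_le_of_ne hdv0 fun hz => hd0 ?_
    have h1 := hext (s₀ + δ₁ / 2) (by rw [add_sub_cancel_left, abs_of_pos] <;> linarith)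
    have h2 := hext (s₀ - δ₁ / 2) (by rw [abs_lt]; constructor <;> linarith)
    rw [← hz] at h1 h2
    have : de = 0 := by nlinarith
    rw [hdecomp, ← hz, this]; simp
  set κ := de / dv with hκ
  have hext' : ∀ s, |s - s₀| < δ₁ → f s - f s₀ ≤ -κ * (s - s₀) := by
    intro s hs
    have := hext s hs
    have h5 : de = κ * dv := by rw [hκ]; field_simp
    rw [h5] at this
    by_contra! hc
    nlinarith
  suffices hmain : G y₀ (v + κ • e) = 0 by
    have : d = dv • (v + κ • e) := by
      rw [smul_add, smul_smul, hκ, mul_div_cancel₀ _ hdvpos.ne']; exact hdecomp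
    rw [this, map_smul, hmain, smul_zero]
  rw [← norm_le_zero_iff]
  refine le_of_forall_pos_le_add fun η hη => ?_
  rw [zero_add]
  set A := ‖G y₀‖ + k + 1 with hA
  have hApos : 0 < A := by positivity
  set σ := η / (2 * A) with hσ
  have hσpos : 0 < σ := by positivity
  -- near `s₀`, the slopes of the graph nearly annihilate `G y₀`
  obtain ⟨ρ₂, hρ₂, hG₂⟩ := Metric.continuousWithinAt_iff.1 hG σ hσpos
  obtain ⟨δ₂, hδ₂, hp₂⟩ := h.eventually_point_mem_ball (lt_min hρ₂ h.pos)
  have hslope : ∀ s q, |s - s₀| < δ₂ → HasDerivAt f q s → ‖G y₀ (v - q • e)‖ ≤ η / 2 := by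
    intro s q hs hq
    have h2 := hp₂ s hs
    rw [Metric.mem_ball, lt_min_iff] at h2
    have heq : inner ℝ v (h.point s) = f (inner ℝ e (h.point s)) := by
      rw [h.f_inner_point, h.inner_v_point h0]
    obtain ⟨c, hc, hn⟩ := h.isOutwardNormal h2.2 heq (h.inner_e_point_hasDerivAt hq)
    have h4 := hν _ (hfr s h2.2) _ hn
    rw [map_smul, smul_eq_zero] at h4
    have h5 : G (h.point s) (v - q • e) = 0 := h4.resolve_left hc.ne'
    have h6 : ‖G (h.point s) - G y₀‖ < σ := by
      rw [← dist_eq_norm]; exact hG₂ (hfr s h2.2) h2.1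
    have hq' : |q| ≤ k := by
      have := norm_deriv_le_of_lipschitz h.lip (x₀ := s)
      rwa [hq.deriv, Real.norm_eq_abs] at this
    have h7 : ‖v - q • e‖ ≤ 1 + k := by
      refine (norm_sub_le _ _).trans ?_
      rw [h.norm_v, norm_smul, Real.norm_eq_abs]
      gcongr
      exact (mul_le_of_le_one_right (abs_nonneg _) h.norm_e_le).trans hq'
    have h8 : G y₀ (v - q • e) = -((G (h.point s) - G y₀) (v - q • e)) := by
      simp [h5]
    rw [h8, norm_neg]
    calc ‖(G (h.point s) - G y₀) (v - q • e)‖ ≤ σ * (1 + k) :=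
          (ContinuousLinearMap.le_opNorm _ _).trans (by gcongr)
      _ ≤ σ * A := by gcongr; rw [hA]; linarith [norm_nonneg (G y₀)]
      _ = η / 2 := by rw [hσ]; field_simp
  set t := min δ₁ δ₂ / 2 with ht
  have htpos : 0 < t := by have := lt_min hδ₁ hδ₂; positivity
  have ht1 : t < δ₁ := by
    have := min_le_left δ₁ δ₂; have := lt_min hδ₁ hδ₂; linarith
  have ht2 : t < δ₂ := by
    have := min_le_right δ₁ δ₂; have := lt_min hδ₁ hδ₂; linarith
  -- Extremality puts the graph below the line of slope -κ through s₀. The mean slope is thus at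
  -- most -κ to the right of s₀ and at least -κ to the left, which yields a slope q₁ ≤ -κ + σ and a
  -- slope q₃ ≥ -κ - σ. Either one of them is within σ of -κ, or -κ lies strictly between them.
  obtain ⟨s₁, hs₁, q₁, hq₁, hle₁⟩ := exists_hasDerivAt_le_of_lipschitzWith h.lip
    (a := s₀) (b := s₀ + t) (c := -κ + σ) (by linarith) (by
      have := hext' (s₀ + t) (by rwa [add_sub_cancel_left, abs_of_pos htpos])
      rw [add_sub_cancel_left] at this ⊢
      nlinarith)
  obtain ⟨s₂, hs₂, q₂, hq₂, hle₂⟩ := exists_hasDerivAt_le_of_lipschitzWith h.lip.neg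
    (a := s₀ - t) (b := s₀) (c := κ + σ) (by linarith) (by
      have := hext' (s₀ - t) (by rw [abs_lt]; constructor <;> linarith)
      simp only [Pi.neg_apply]
      nlinarith)
  have hn₁ := hslope s₁ q₁ (by rw [abs_lt]; constructor <;> linarith [hs₁.1, hs₁.2]) hq₁
  have hn₂ := hslope s₂ (-q₂) (by rw [abs_lt]; constructor <;> linarith [hs₂.1, hs₂.2])
    (by simpa using hq₂.neg)
  set q₃ := -q₂ with hq₃
  have hge₂ : -κ - σ ≤ q₃ := by linarith
  have hclose : ∀ q, ‖G y₀ (v - q • e)‖ ≤ η / 2 → |q + κ| ≤ σ → ‖G y₀ (v + κ • e)‖ ≤ η := by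
    intro q h1 h2
    have h3 : v + κ • e = (v - q • e) + (q + κ) • e := by module
    rw [h3, map_add]
    have h4 : ‖G y₀ ((q + κ) • e)‖ ≤ σ * A := by
      rw [map_smul, norm_smul, Real.norm_eq_abs]
      gcongr
      refine (ContinuousLinearMap.le_opNorm _ _).trans ?_
      calc ‖G y₀‖ * ‖e‖ ≤ ‖G y₀‖ := mul_le_of_le_one_right (norm_nonneg _) h.norm_e_le
        _ ≤ A := by rw [hA]; linarith [k.coe_nonneg]
    have h5 : σ * A = η / 2 := by rw [hσ]; field_simp
    linarith [norm_add_le (G y₀ (v - q • e)) (G y₀ ((q + κ) • e))]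
  by_cases hc1 : -κ ≤ q₁
  · exact hclose q₁ hn₁ (by rw [abs_le]; constructor <;> linarith)
  by_cases hc2 : q₃ ≤ -κ
  · exact hclose q₃ hn₂ (by rw [abs_le]; constructor <;> linarith)
  push Not at hc1 hc2
  -- In the remaining case v + κ·e is a convex combination of the two approximate normal directions,
  -- and the bound η/2 is preserved because balls are convex.
  have hconv := (convex_closedBall (0 : ℂ) (η / 2)) (x := G y₀ (v - q₁ • e)) (by simpa using hn₁)
    (y := G y₀ (v - q₃ • e)) (by simpa using hn₂) (a := (q₃ + κ) / (q₃ - q₁))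
    (b := (-κ - q₁) / (q₃ - q₁)) (div_nonneg (by linarith) (by linarith))
    (div_nonneg (by linarith) (by linarith)) (by
      rw [← add_div]; exact (div_eq_one_iff_eq (by linarith)).2 (by ring))
  rw [← map_smul, ← map_smul, ← map_add, mem_closedBall_zero_iff] at hconv
  have h3 : ((q₃ + κ) / (q₃ - q₁)) • (v - q₁ • e) + ((-κ - q₁) / (q₃ - q₁)) • (v - q₃ • e)
      = v + κ • e := by
    have hne : q₃ - q₁ ≠ 0 := by linarith
    have e1 : (q₃ + κ) / (q₃ - q₁) + (-κ - q₁) / (q₃ - q₁) = 1 := by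
      rw [← add_div]; exact (div_eq_one_iff_eq hne).2 (by ring)
    have e2 : (q₃ + κ) / (q₃ - q₁) * q₁ + (-κ - q₁) / (q₃ - q₁) * q₃ = -κ := by
      field_simp; ring
    calc _ = ((q₃ + κ) / (q₃ - q₁) + (-κ - q₁) / (q₃ - q₁)) • v
          - ((q₃ + κ) / (q₃ - q₁) * q₁ + (-κ - q₁) / (q₃ - q₁) * q₃) • e := by module
      _ = v + κ • e := by rw [e1, e2]; module
  rw [h3] at hconv
  linarith

/-! ### Coverings of the boundary by small balls. -/

theorem exists_finset_cover_of_dist_le {X : Type*} [PseudoMetricSpace X] {A : Set X} {σ : X → ℝ}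
    {R M δ : ℝ} (hR : 0 ≤ R) (hM : 0 < M) (hδ : 0 < δ) (hσ : ∀ x ∈ A, |σ x| ≤ R)
    (hd : ∀ x ∈ A, ∀ y ∈ A, dist x y ≤ M * |σ x - σ y|) :
    ∃ Z : Finset X, (Z : Set X) ⊆ A ∧ (Z.card : ℝ) ≤ 2 * (R * M / δ) + 3 ∧
      ∀ x ∈ A, ∃ z ∈ Z, dist x z < δ := by
  classical
  rcases A.eq_empty_or_nonempty with rfl | ⟨x₀, _⟩
  · exact ⟨∅, by simp, by simp; positivity, by simp⟩
  have : Nonempty X := ⟨x₀⟩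
  -- The values of σ are sorted into bins of length δ/M, and one representative is kept for each
  -- occupied bin. Points in a common bin are closer than δ.
  set B : ℤ := ⌈R * M / δ⌉ with hB
  have hq : 0 ≤ R * M / δ := by positivity
  have hB0 : 0 ≤ B := Int.ceil_nonneg hq
  let bin : X → ℤ := fun x => ⌊σ x * M / δ⌋
  let J : Finset ℤ := (Finset.Icc (-B) B).filter fun j => ∃ x ∈ A, bin x = j
  have hJ : ∀ j ∈ J, ∃ x ∈ A, bin x = j := fun j hj => (Finset.mem_filter.1 hj).2
  choose! rep hrep1 hrep2 using hJ
  refine ⟨J.image rep, ?_, ?_, ?_⟩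
  · intro z hz
    rw [Finset.coe_image] at hz
    obtain ⟨j, hj, rfl⟩ := hz
    exact hrep1 j hj
  · have h1 : (J.image rep).card ≤ (Finset.Icc (-B) B).card :=
      Finset.card_image_le.trans (Finset.card_filter_le _ _)
    rw [Int.card_Icc] at h1
    have h2 : ((J.image rep).card : ℤ) ≤ 2 * B + 1 := by omega
    have h3 : ((J.image rep).card : ℝ) ≤ 2 * B + 1 := by exact_mod_cast h2
    have h4 : (B : ℝ) < R * M / δ + 1 := Int.ceil_lt_add_one _
    linarith
  · intro x hx
    have hbin : bin x ∈ J := by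
      refine Finset.mem_filter.2 ⟨Finset.mem_Icc.2 ?_, x, hx, rfl⟩
      have h1 := abs_le.1 (hσ x hx)
      have h2 : σ x * M / δ ≤ R * M / δ := by gcongr; exact h1.2
      have h3 : -(R * M / δ) ≤ σ x * M / δ := by
        rw [← neg_div, ← neg_mul]; gcongr; exact h1.1
      constructor
      · rw [Int.le_floor]; push_cast
        exact (neg_le_neg (Int.le_ceil _)).trans h3
      · exact (Int.floor_le_floor h2).trans (Int.floor_le_ceil _)
    refine ⟨rep (bin x), Finset.mem_image_of_mem _ hbin, ?_⟩
    have h1 := hd x hx _ (hrep1 _ hbin)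
    have h2 : |σ x * M / δ - σ (rep (bin x)) * M / δ| < 1 :=
      Int.abs_sub_lt_one_of_floor_eq_floor (hrep2 _ hbin).symm
    have h3 : σ x * M / δ - σ (rep (bin x)) * M / δ = M * (σ x - σ (rep (bin x))) / δ := by ring
    rw [h3, abs_div, abs_of_pos hδ, div_lt_one hδ, abs_mul, abs_of_pos hM] at h2
    linarith

/-- The boundary of a bounded Lipschitz domain is covered by about `δ^{-(m-1)}` balls of
radius `δ`. -/
theorem IsLipschitzDomain.exists_finset_cover {m : ℕ} (hm : m = 1 ∨ m = 2) {S : Set (E m)}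
    (hS : IsOpen S) (hb : Bornology.IsBounded S) (hL : IsLipschitzDomain S) :
    ∃ C : ℝ, 0 ≤ C ∧ ∀ δ : ℝ, 0 < δ → δ ≤ 1 → ∃ Z : Finset (E m), (Z : Set (E m)) ⊆ frontier S ∧
      (Z.card : ℝ) ≤ C * (1 / δ) ^ (m - 1) ∧ ∀ x ∈ frontier S, ∃ z ∈ Z, dist x z < δ := by
  classical
  have hcomp : IsCompact (frontier S) :=
    hb.isCompact_closure.of_isClosed_subset isClosed_frontier frontier_subset_closure
  suffices h : ∃ C : ℝ, 0 ≤ C ∧ ∀ δ : ℝ, 0 < δ → δ ≤ 1 → ∃ Z : Finset (E m),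
      (Z : Set (E m)) ⊆ frontier S ∧ (Z.card : ℝ) ≤ C * (1 / δ) ^ (m - 1) ∧
      ∀ x ∈ frontier S ∩ frontier S, ∃ z ∈ Z, dist x z < δ by
    simpa using h
  -- The counting bound passes to subsets and to finite unions with added constants, so by
  -- compactness it suffices to prove it in a neighbourhood where the boundary is a graph.
  refine hcomp.induction_on (p := fun A => ∃ C : ℝ, 0 ≤ C ∧ ∀ δ : ℝ, 0 < δ → δ ≤ 1 →
    ∃ Z : Finset (E m), (Z : Set (E m)) ⊆ frontier S ∧ (Z.card : ℝ) ≤ C * (1 / δ) ^ (m - 1) ∧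
      ∀ x ∈ frontier S ∩ A, ∃ z ∈ Z, dist x z < δ) ?_ ?_ ?_ ?_
  · exact ⟨0, le_rfl, fun δ _ _ => ⟨∅, by simp, by simp, by simp⟩⟩
  · rintro A B hAB ⟨C, hC, h⟩
    refine ⟨C, hC, fun δ h1 h2 => ?_⟩
    obtain ⟨Z, h3, h4, h5⟩ := h δ h1 h2
    exact ⟨Z, h3, h4, fun x hx => h5 x ⟨hx.1, hAB hx.2⟩⟩
  · rintro A B ⟨C, hC, h⟩ ⟨C', hC', h'⟩
    refine ⟨C + C', by positivity, fun δ h1 h2 => ?_⟩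
    obtain ⟨Z, h3, h4, h5⟩ := h δ h1 h2
    obtain ⟨Z', h3', h4', h5'⟩ := h' δ h1 h2
    refine ⟨Z ∪ Z', by simp [h3, h3'], ?_, ?_⟩
    · have : ((Z ∪ Z').card : ℝ) ≤ Z.card + Z'.card := by exact_mod_cast Finset.card_union_le _ _
      rw [add_mul]; linarith
    · rintro x ⟨hx, hx' | hx'⟩
      · obtain ⟨z, hz, hd⟩ := h5 x ⟨hx, hx'⟩
        exact ⟨z, Finset.mem_union_left _ hz, hd⟩
      · obtain ⟨z, hz, hd⟩ := h5' x ⟨hx, hx'⟩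
        exact ⟨z, Finset.mem_union_right _ hz, hd⟩
  · intro y₀ hy₀
    obtain ⟨v, e, f, k, r, h⟩ := hL.exists_isLocalGraph hm hy₀
    refine ⟨Metric.ball y₀ r, mem_nhdsWithin_of_mem_nhds (Metric.ball_mem_nhds _ h.pos), ?_⟩
    set R := ‖e‖ * (‖y₀‖ + r) with hRdef
    have hR : 0 ≤ R := by have := h.pos; positivity
    have hM : (0 : ℝ) < 1 + k := by positivity
    refine ⟨2 * (R * (1 + k)) + 3, by positivity, fun δ h1 h2 => ?_⟩
    obtain ⟨Z, h3, h4, h5⟩ := exists_finset_cover_of_dist_le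
      (A := frontier S ∩ Metric.ball y₀ r) (σ := fun y => inner ℝ e y) (δ := δ) hR hM h1
      (by
        rintro x ⟨_, hx⟩
        refine (abs_real_inner_le_norm _ _).trans ?_
        rw [hRdef]
        gcongr
        rw [Metric.mem_ball, dist_eq_norm] at hx
        have := norm_add_le (x - y₀) y₀
        rw [sub_add_cancel] at this
        linarith)
      (by
        rintro x ⟨hx, hx'⟩ y ⟨hy, hy'⟩
        rw [h.mem_frontier_iff hS hx'] at hx
        rw [h.mem_frontier_iff hS hy'] at hy
        have h6 := h.decomp (x - y)
        rw [inner_sub_right, inner_sub_right, hx, hy] at h6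
        rw [dist_eq_norm, h6]
        refine (norm_add_le _ _).trans ?_
        rw [norm_smul, norm_smul, h.norm_v, Real.norm_eq_abs, Real.norm_eq_abs, mul_one]
        have h7 := h.lip.dist_le_mul (inner ℝ e x) (inner ℝ e y)
        rw [Real.dist_eq, Real.dist_eq] at h7
        have h8 := mul_le_of_le_one_right (abs_nonneg (inner ℝ e x - inner ℝ e y)) h.norm_e_le
        linarith)
    refine ⟨Z, h3.trans inter_subset_left, h4.trans ?_, h5⟩
    have hone : 1 ≤ 1 / δ := by rwa [le_div_iff₀ h1, one_mul]
    rcases h.e_spec with ⟨_, rfl⟩ | ⟨he, _⟩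
    · rw [show (2 - 1 : ℕ) = 1 from rfl, pow_one, add_mul]
      have : 2 * (R * (1 + ↑k) / δ) = 2 * (R * (1 + ↑k)) * (1 / δ) := by ring
      rw [this]; linarith
    -- With e = 0 there is nothing to parametrize, and the additive constant 3 alone bounds the
    -- number of balls.
    · have hR0 : R = 0 := by rw [hRdef, he]; simp
      rw [hR0]
      have := one_le_pow₀ hone (n := m - 1)
      simp; simp at this; linarith

/-- Let a ball about p lie in S, and let v point from p to the boundary point y₀. By convexity S
contains, near y₀, a downward cone of fixed opening below each of its points. So S is locally a
union of such cones, which is the region below the supremum of a family of functions with a common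
Lipschitz constant. -/
theorem isLipschitzDomain_of_convex {m : ℕ} {S : Set (E m)} (hc : Convex ℝ S) (hS : IsOpen S)
    (hne : S.Nonempty) : IsLipschitzDomain S := by
  intro y₀ hy₀
  obtain ⟨p, hp⟩ := hne
  obtain ⟨ρ, hρ, hball⟩ := Metric.isOpen_iff.1 hS p hp
  have hy₀S : y₀ ∉ S := by rw [hS.frontier_eq] at hy₀; exact hy₀.2
  set D := ‖y₀ - p‖ with hD
  have hρD : ρ ≤ D := by
    by_contra! h
    exact hy₀S (hball (by rwa [Metric.mem_ball, dist_eq_norm]))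
  have hDpos : 0 < D := hρ.trans_le hρD
  set v := D⁻¹ • (y₀ - p) with hv
  have hnv : ‖v‖ = 1 := by
    rw [hv, norm_smul, norm_inv, Real.norm_of_nonneg hDpos.le, ← hD, inv_mul_cancel₀ hDpos.ne']
  have hvv : inner ℝ v v = 1 := by rw [real_inner_self_eq_norm_sq, hnv]; norm_num
  have hpv : y₀ = p + D • v := by rw [hv, smul_smul, mul_inv_cancel₀ hDpos.ne']; simp
  set r := ρ / 2 with hr
  have hrpos : 0 < r := by positivity
  set k : NNReal := ⟨4 * D / ρ, by positivity⟩ with hk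
  have hkpos : (0 : ℝ) < k := by show 0 < 4 * D / ρ; positivity
  set π : E m → E m := fun y => y - inner ℝ v y • v with hπ
  have hπlip : ∀ y z, ‖π y - π z‖ ≤ ‖y - z‖ := by
    intro y z
    have h1 : π y - π z = (y - z) - inner ℝ v (y - z) • v := by
      simp only [hπ, inner_sub_right]; module
    rw [h1]
    refine le_of_sq_le_sq ?_ (norm_nonneg _)
    rw [@norm_sub_sq_real, norm_smul, hnv, inner_smul_right, real_inner_comm]
    simp only [Real.norm_eq_abs, mul_one, sq_abs]
    nlinarith [sq_nonneg (inner ℝ v (y - z))]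
  -- the cone condition
  have hcone : ∀ q ∈ S, q ∈ Metric.ball y₀ r → ∀ y ∈ Metric.ball y₀ r,
      inner ℝ v y < inner ℝ v q - k * ‖π y - π q‖ → y ∈ S := by
    intro q hq hqb y hyb hlt
    set a := inner ℝ v q - inner ℝ v y with ha
    have hapos : 0 < a := by
      have : 0 ≤ k * ‖π y - π q‖ := by positivity
      linarith
    have ha2 : a ≤ D := by
      have h1 : a = inner ℝ v (q - y) := by rw [inner_sub_right]
      have h2 := real_inner_le_norm v (q - y)
      rw [hnv, one_mul, ← h1, ← dist_eq_norm] at h2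
      rw [Metric.mem_ball] at hqb hyb
      have := dist_triangle_right q y y₀
      linarith
    set b := π y - π q with hb
    have hyq : y = q - a • v + b := by simp only [hb, hπ, ha]; module
    -- The point z is where the line from q through y arrives after descending by D, the distance
    -- from y₀ to p. It lies within ρ/2 + ρ/4 of p because k = 4D/ρ, and y divides the segment from
    -- q to z at the parameter a/D.
    set z := p + ((q - y₀) + (D / a) • b) with hz
    have hzS : z ∈ S := by
      apply hball
      rw [Metric.mem_ball, dist_eq_norm, hz, add_sub_cancel_left]
      refine (norm_add_le _ _).trans_lt ?_
      rw [Metric.mem_ball, dist_eq_norm] at hqb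
      have h3 : ‖(D / a) • b‖ ≤ ρ / 4 := by
        rw [norm_smul, Real.norm_of_nonneg (by positivity)]
        have h4 : (4 * D / ρ) * ‖b‖ ≤ a := by
          have : (k : ℝ) * ‖b‖ ≤ a := by linarith
          exact this
        rw [div_mul_eq_mul_div, div_le_iff₀ hapos]
        rw [div_mul_eq_mul_div, div_le_iff₀ hρ] at h4
        linarith
      linarith
    have hcomb : y = (1 - a / D) • q + (a / D) • z := by
      rw [hz, hpv, hyq]
      have e1 : a / D * (D / a) = 1 := by field_simp
      have e2 : a / D * D = a := by field_simp
      calc q - a • v + b = q - a • v + (1 : ℝ) • b := by rw [one_smul]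
        _ = q - (a / D * D) • v + (a / D * (D / a)) • b := by rw [e1, e2]
        _ = _ := by module
    rw [hcomb]
    exact hc hq hzS (by rw [sub_nonneg, div_le_one hDpos]; exact ha2) (by positivity) (by ring)
  set T : Set (E m) := S ∩ Metric.ball y₀ r with hT
  have hTne : T.Nonempty := by
    obtain ⟨z, hz, hzd⟩ := Metric.mem_closure_iff.1 (frontier_subset_closure hy₀) r hrpos
    exact ⟨z, hz, by rwa [Metric.mem_ball, dist_comm]⟩
  have : Nonempty T := hTne.to_subtype
  set g : E m → ℝ := fun w => ⨆ q : T, (inner ℝ v (q : E m) - k * ‖w - π q‖) with hg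
  have hbdd : ∀ w, BddAbove (range fun q : T => inner ℝ v (q : E m) - k * ‖w - π q‖) := by
    intro w
    refine ⟨‖y₀‖ + r, ?_⟩
    rintro _ ⟨q, rfl⟩
    have h1 := real_inner_le_norm v (q : E m)
    rw [hnv, one_mul] at h1
    have h2 := q.2.2
    rw [Metric.mem_ball, dist_eq_norm] at h2
    have h3 := norm_add_le ((q : E m) - y₀) y₀
    rw [sub_add_cancel] at h3
    have : 0 ≤ k * ‖w - π q‖ := by positivity
    simp only
    linarith
  refine ⟨v, r, k, g, hnv, hrpos, ?_, ?_⟩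
  · refine LipschitzWith.of_le_add_mul k fun w w' => ?_
    refine ciSup_le fun q => ?_
    have h1 := le_ciSup (hbdd w') q
    have h2 : ‖w' - π q‖ ≤ ‖w - π q‖ + dist w w' := by
      rw [dist_comm, dist_eq_norm, add_comm]
      have := norm_add_le (w' - w) (w - π q)
      rwa [sub_add_sub_cancel] at this
    have h3 := mul_le_mul_of_nonneg_left h2 hkpos.le
    rw [mul_add] at h3
    simp only [hg] at h1 ⊢
    linarith
  · intro y hy
    constructor
    · intro hyS
      obtain ⟨t, ht, htb⟩ := Metric.isOpen_iff.1 (hS.inter Metric.isOpen_ball) y ⟨hyS, hy⟩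
      have hmem : y + (t / 2) • v ∈ T := htb (by
        rw [Metric.mem_ball, dist_eq_norm, add_sub_cancel_left, norm_smul, hnv,
          Real.norm_of_nonneg (by positivity)]
        linarith)
      have h1 := le_ciSup (hbdd (π y)) ⟨_, hmem⟩
      have h2 : π (y + (t / 2) • v) = π y := by
        simp only [hπ, inner_add_right, inner_smul_right, hvv]; module
      simp only [h2, sub_self, norm_zero, mul_zero, sub_zero, inner_add_right, inner_smul_right,
        hvv] at h1
      simp only [hg]
      linarith
    · intro hlt
      obtain ⟨q, hq⟩ := exists_lt_of_lt_ciSup hlt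
      exact hcone q q.2.1 q.2.2 y hy hq

/-! ### Planar convex sections, and what nozzle and slab sections share. -/

theorem abs_apply_le_norm {m : ℕ} (y : E m) (i : Fin m) : |y i| ≤ ‖y‖ := by
  rw [← Real.norm_eq_abs]; exact PiLp.norm_apply_le y i

theorem closure_width_le {m : ℕ} {S : Set (E m)} {j : Fin m} {ε : ℝ}
    (h : ∀ y ∈ S, ∀ z ∈ S, |y j - z j| ≤ ε) :
    ∀ y ∈ closure S, ∀ z ∈ closure S, |y j - z j| ≤ ε := by
  intro y hy z hz
  have hcl : IsClosed {p : E m × E m | |p.1 j - p.2 j| ≤ ε} :=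
    isClosed_le (by fun_prop) continuous_const
  have : closure (S ×ˢ S) ⊆ {p : E m × E m | |p.1 j - p.2 j| ≤ ε} :=
    closure_minimal (fun p hp => h _ hp.1 _ hp.2) hcl
  rw [closure_prod_eq] at this
  exact this (mk_mem_prod hy hz)

/-- A planar convex set has a boundary point between the vertical lines through two of its points
at which it is locally extreme in a direction of prescribed mean slope. -/
theorem exists_extreme_between {m : ℕ} {S : Set (E m)} (hc : Convex ℝ S) (hS : IsOpen S)
    (hb : Bornology.IsBounded S) {i j : Fin m} (hij : i ≠ j) (hall : ∀ k, k = i ∨ k = j) {ε w : ℝ}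
    (hwidth : ∀ y ∈ S, ∀ z ∈ S, |y j - z j| ≤ ε) {y q : E m} (hy : y ∈ S) (hq : q ∈ S)
    (hw : 0 < w) (hyq : |q i - y i| = w) :
    ∃ z ∈ frontier S, |z i - y i| ≤ w ∧
      (∃ σ ρ : ℝ, |σ| ≤ ε / w ∧ 0 < ρ ∧ ∀ x ∈ closure S, dist x z < ρ →
        inner ℝ (EuclideanSpace.single j 1 - σ • EuclideanSpace.single i 1) x ≤
          inner ℝ (EuclideanSpace.single j 1 - σ • EuclideanSpace.single i 1) z) ∧
      ∃ c : ℝ, c ≠ 0 ∧ |c| ≤ ε ∧ z + c • EuclideanSpace.single j 1 ∈ frontier S := by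
  have hwc := closure_width_le hwidth
  have hcomp := hb.isCompact_closure
  have hne : q i - y i ≠ 0 := by rw [← abs_pos, hyq]; exact hw
  have htop : ∀ p ∈ S, ∃ P ∈ closure S, P i = p i ∧ ∀ x ∈ closure S, x i = p i → x j ≤ P j := by
    intro p hp
    have hK : IsCompact (closure S ∩ {x | x i = p i}) :=
      hcomp.inter_right (isClosed_eq (by fun_prop) continuous_const)
    obtain ⟨P, hP, hmax⟩ := hK.exists_isMaxOn ⟨p, subset_closure hp, rfl⟩
      (f := fun x : E m => x j) (by fun_prop)
    exact ⟨P, hP.1, hP.2, fun x hx hxi => hmax ⟨hx, hxi⟩⟩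
  obtain ⟨Y, hY, hYi, hYmax⟩ := htop y hy
  obtain ⟨Q, hQ, hQi, hQmax⟩ := htop q hq
  set σ := (Q j - Y j) / (q i - y i) with hσ
  have hσle : |σ| ≤ ε / w := by
    rw [hσ, abs_div, hyq]; gcongr; exact hwc _ hQ _ hY
  set d : E m := EuclideanSpace.single j 1 - σ • EuclideanSpace.single i 1 with hd
  have hinner : ∀ x : E m, inner ℝ d x = x j - σ * x i := by
    intro x; simp [hd, inner_sub_left, inner_smul_left, EuclideanSpace.inner_single_left]
  have hQY : Q j - σ * Q i = Y j - σ * Y i := by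
    rw [hQi, hYi, hσ]; field_simp; ring
  set t : E m → ℝ := fun x => (x i - y i) / (q i - y i) with ht
  have htc : Continuous t := by simp only [ht]; fun_prop
  set K : Set (E m) := closure S ∩ t ⁻¹' Icc 0 1 with hK
  have hYK : Y ∈ K := ⟨hY, by simp [ht, hYi]⟩
  -- The direction d is orthogonal to the chord YQ that joins the top points over y and q, so it
  -- takes equal values at Y and Q. These are its largest values on the two bounding lines. A
  -- maximum above this value is attained strictly between the lines; otherwise the midpoint of the
  -- chord is already a maximizer.
  obtain ⟨z, ⟨hzS, hzt⟩, hzmax⟩ : ∃ z ∈ closure S ∩ t ⁻¹' Ioo 0 1,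
      ∀ x ∈ K, inner ℝ d x ≤ inner ℝ d z := by
    obtain ⟨z, hzK, hmax⟩ := (hcomp.inter_right (isClosed_Icc.preimage htc)).exists_isMaxOn
      ⟨Y, hYK⟩ (f := fun x : E m => inner ℝ d x) (by fun_prop)
    have hmax' : ∀ x ∈ K, inner ℝ d x ≤ inner ℝ d z := fun x hx => hmax hx
    by_cases hcase : inner ℝ d z ≤ inner ℝ d Y
    · refine ⟨(1 / 2 : ℝ) • Y + (1 / 2 : ℝ) • Q, ⟨hc.closure hY hQ (by norm_num) (by norm_num)
        (by norm_num), ?_⟩, fun x hx => (hmax' x hx).trans (hcase.trans ?_)⟩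
      · simp only [ht, mem_preimage, PiLp.add_apply, PiLp.smul_apply, smul_eq_mul, hYi, hQi]
        rw [show (1 / 2 * y i + 1 / 2 * q i - y i) / (q i - y i) = 1 / 2 by field_simp; ring]
        norm_num
      · rw [hinner, hinner]
        simp only [PiLp.add_apply, PiLp.smul_apply, smul_eq_mul]
        linarith
    · push Not at hcase
      refine ⟨z, ⟨hzK.1, lt_of_le_of_ne hzK.2.1 ?_, lt_of_le_of_ne hzK.2.2 ?_⟩, hmax'⟩
      · intro h0
        have h1 : z i = y i := by
          have : (z i - y i) / (q i - y i) = 0 := h0.symm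
          rw [div_eq_zero_iff] at this
          linarith [this.resolve_right hne]
        have h2 := hYmax z hzK.1 h1
        rw [hinner, hinner, hYi, h1] at hcase
        linarith
      · intro h0
        have h1 : z i = q i := by
          have : (z i - y i) / (q i - y i) = 1 := h0
          rw [div_eq_one_iff_eq hne] at this
          linarith
        have h2 := hQmax z hzK.1 h1
        rw [hinner, hinner, ← hQY, hQi, h1] at hcase
        linarith
  have hzfr : z ∈ frontier S := by
    rw [hS.frontier_eq]
    refine ⟨hzS, fun hmem => ?_⟩
    obtain ⟨r, hr, hball⟩ := Metric.isOpen_iff.1 hS z hmem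
    have h1 : z + (r / 2) • EuclideanSpace.single j (1 : ℝ) ∈ S := hball (by
      rw [Metric.mem_ball, dist_eq_norm, add_sub_cancel_left, norm_smul,
        Real.norm_of_nonneg (by positivity)]
      simp; linarith)
    have h2 : (z + (r / 2) • EuclideanSpace.single j (1 : ℝ)) i = z i := by simp [hij]
    have h3 := hzmax _ ⟨subset_closure h1, by
      simp only [ht, mem_preimage, h2]; exact Ioo_subset_Icc_self hzt⟩
    rw [hinner, hinner, h2] at h3
    simp at h3
    linarith
  have hzi : |z i - y i| ≤ w := by
    have h1 : z i - y i = t z * (q i - y i) := by simp only [ht]; field_simp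
    rw [h1, abs_mul, hyq, abs_of_pos hzt.1]
    exact mul_le_of_le_one_left hw.le hzt.2.le
  refine ⟨z, hzfr, hzi, ⟨σ, ?_⟩, ?_⟩
  · obtain ⟨ρ, hρ, hball⟩ := Metric.isOpen_iff.1 (isOpen_Ioo.preimage htc) z hzt
    exact ⟨ρ, hσle, hρ, fun x hx hxd =>
      hzmax x ⟨hx, Ioo_subset_Icc_self (hball (Metric.mem_ball.2 hxd))⟩⟩
  -- The segment from y to q supplies a point x of S on the line through z in the thin direction.
  -- Continuing from z through x, this line leaves S at a second boundary point.
  · set x := (1 - t z) • y + t z • q with hx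
    have hxS : x ∈ S := hc hy hq (by linarith [hzt.2]) hzt.1.le (by ring)
    have hxi : x i = z i := by
      simp only [hx, PiLp.add_apply, PiLp.smul_apply, smul_eq_mul]
      have h1 : z i - y i = t z * (q i - y i) := by simp only [ht]; field_simp
      linarith
    have hxz : x = z + (x j - z j) • EuclideanSpace.single j 1 := by
      ext k
      rcases hall k with rfl | rfl
      · simp [hij, hxi]
      · simp
    have hne' : x j - z j ≠ 0 := by
      intro h0
      rw [h0, zero_smul, add_zero] at hxz
      rw [hS.frontier_eq] at hzfr
      exact hzfr.2 (hxz ▸ hxS)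
    obtain ⟨c, hcpos, hcfr⟩ := exists_exit hS hb hxS
      (d := (x j - z j) • EuclideanSpace.single j (1 : ℝ)) (by simp [hne'])
    have heq : x + c • (x j - z j) • EuclideanSpace.single j (1 : ℝ)
        = z + ((1 + c) * (x j - z j)) • EuclideanSpace.single j 1 := by
      nth_rewrite 1 [hxz]; module
    rw [heq] at hcfr
    refine ⟨(1 + c) * (x j - z j), mul_ne_zero (by positivity) hne', ?_, hcfr⟩
    have := hwc _ (frontier_subset_closure hcfr) _ hzS
    simpa using this

/-- The homothety of ratio 1/4 about c maps the wide part into the narrow one by convexity, and it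
multiplies volumes by 4^(-m). -/
theorem volume_inter_strip_le_of_convex {m : ℕ} {S : Set (E m)} (hc : Convex ℝ S) (i : Fin m)
    {c : E m} (hcS : c ∈ S) (ℓ : ℝ) :
    volume (S ∩ {y | |y i - c i| < ℓ}) ≤ 4 ^ m * volume (S ∩ {y | |y i - c i| < ℓ / 4}) := by
  have himage : AffineMap.homothety c (1 / 4 : ℝ) '' (S ∩ {y | |y i - c i| < ℓ}) ⊆
      S ∩ {y | |y i - c i| < ℓ / 4} := by
    rintro _ ⟨y, ⟨hy, hyi⟩, rfl⟩
    have h1 : AffineMap.homothety c (1 / 4 : ℝ) y = (3 / 4 : ℝ) • c + (1 / 4 : ℝ) • y := by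
      rw [AffineMap.homothety_apply]; simp only [vsub_eq_sub, vadd_eq_add]; module
    rw [h1]
    refine ⟨hc hcS hy (by norm_num) (by norm_num) (by norm_num), ?_⟩
    have h2 : ((3 / 4 : ℝ) • c + (1 / 4 : ℝ) • y) i - c i = (y i - c i) / 4 := by
      simp; ring
    rw [mem_ofPred_eq, h2, abs_div, abs_of_pos (by norm_num : (0 : ℝ) < 4)]
    have : |y i - c i| < ℓ := hyi
    linarith
  have h1 := measure_mono (μ := volume) himage
  rw [Measure.addHaar_image_homothety, finrank_euclideanSpace_fin] at h1
  calc volume (S ∩ {y | |y i - c i| < ℓ})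
      = 4 ^ m * (ENNReal.ofReal |(1 / 4 : ℝ) ^ m| * volume (S ∩ {y | |y i - c i| < ℓ})) := by
        rw [← mul_assoc, abs_of_pos (by positivity), ENNReal.ofReal_pow (by norm_num), ← mul_pow,
          show (4 : ENNReal) = ENNReal.ofReal 4 by simp, ← ENNReal.ofReal_mul (by norm_num)]
        norm_num
    _ ≤ _ := by gcongr

/-- What nozzle and slab sections have in common; `i` is the coordinate in which the section need
not be thin. -/
structure IsThinSection {m : ℕ} (ε : ℝ) (i : Fin m) (S : Set (E m)) : Prop where
  isOpen : IsOpen S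
  bounded : Bornology.IsBounded S
  lipschitz : IsLipschitzDomain S
  dist_le : ∀ y ∈ S, ∀ z ∈ S, dist y z ≤ |y i - z i| + ε
  exists_frontier : ∀ y ∈ S, ∃ z ∈ frontier S, dist y z ≤ ε
  doubling : ∀ c ∈ S, ∀ ℓ, 4 * ε < ℓ →
    volume (S ∩ {y | |y i - c i| < ℓ}) ≤ 4 ^ m * volume (S ∩ {y | |y i - c i| < ℓ / 4})

theorem closure_dist_le {X : Type*} [PseudoMetricSpace X] {S : Set X} {ε : ℝ}
    (h : ∀ y ∈ S, ∀ z ∈ S, dist y z ≤ ε) : ∀ y ∈ closure S, ∀ z ∈ closure S, dist y z ≤ ε := by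
  intro y hy z hz
  have hcl : IsClosed {p : X × X | dist p.1 p.2 ≤ ε} := isClosed_le (by fun_prop) continuous_const
  have : closure (S ×ˢ S) ⊆ {p : X × X | dist p.1 p.2 ≤ ε} :=
    closure_minimal (fun p hp => h _ hp.1 _ hp.2) hcl
  rw [closure_prod_eq] at this
  exact this (mk_mem_prod hy hz)

theorem IsNozzleSection.dist_le {m : ℕ} {ε : ℝ} {S : Set (E m)} (h : IsNozzleSection ε S) :
    ∀ y ∈ S, ∀ z ∈ S, dist y z ≤ ε :=
  fun _ hy _ hz => (Metric.dist_le_diam_of_mem h.bounded hy hz).trans h.diam_le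

theorem IsNozzleSection.isThinSection {m : ℕ} {ε : ℝ} {S : Set (E m)}
    (h : IsNozzleSection ε S) (i : Fin m) : IsThinSection ε i S where
  isOpen := h.isOpen
  bounded := h.bounded
  lipschitz := h.lipschitz
  dist_le y hy z hz := (h.dist_le y hy z hz).trans (by linarith [abs_nonneg (y i - z i)])
  exists_frontier y hy := by
    obtain ⟨c, _, hc⟩ := exists_exit h.isOpen h.bounded hy
      (d := EuclideanSpace.single i (1 : ℝ)) (by simp)
    exact ⟨_, hc, closure_dist_le h.dist_le _ (subset_closure hy) _ (frontier_subset_closure hc)⟩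
  doubling c hc ℓ hℓ := by
    -- Since ℓ/4 exceeds ε, which bounds the diameter, the narrow part is already the whole nozzle
    -- section.
    have h1 : S ∩ {y | |y i - c i| < ℓ} ⊆ S ∩ {y | |y i - c i| < ℓ / 4} := by
      rintro y ⟨hy, _⟩
      refine ⟨hy, ?_⟩
      have h2 := abs_apply_le_norm (y - c) i
      rw [← dist_eq_norm] at h2
      have := h.dist_le y hy c hc
      have h3 : |y i - c i| < ℓ / 4 := by
        rw [← PiLp.sub_apply]; linarith
      exact h3
    refine (measure_mono h1).trans ?_
    refine le_mul_of_one_le_left (zero_le) ?_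
    exact one_le_pow₀ (by norm_num)

namespace IsSlabSection

variable {m : ℕ} {ε Λ : ℝ} {i j : Fin m} {S : Set (E m)}

theorem isOpen (h : IsSlabSection ε Λ i j S) : IsOpen S := by
  obtain ⟨p, rfl⟩ := h.quadrilateral
  exact isOpen_interior

theorem convex (h : IsSlabSection ε Λ i j S) : Convex ℝ S := by
  obtain ⟨p, rfl⟩ := h.quadrilateral
  exact (convex_convexHull ℝ _).interior

theorem bounded (h : IsSlabSection ε Λ i j S) : Bornology.IsBounded S := by
  obtain ⟨p, rfl⟩ := h.quadrilateral
  exact (isBounded_convexHull.2 (finite_range p).isBounded).subset interior_subset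

theorem lipschitz (h : IsSlabSection ε Λ i j S) : IsLipschitzDomain S := by
  obtain ⟨y, hy, _⟩ := h.le_length
  exact isLipschitzDomain_of_convex h.convex h.isOpen ⟨y, hy⟩

theorem eq_or_eq (h : IsSlabSection ε Λ i j S) (k : Fin m) : k = i ∨ k = j := by
  have h1 := h.planar
  have h2 := h.long_ne_thin
  omega

theorem norm_le_add (h : IsSlabSection ε Λ i j S) (x : E m) : ‖x‖ ≤ |x i| + |x j| := by
  have h1 : x = x i • EuclideanSpace.single i (1 : ℝ) + x j • EuclideanSpace.single j (1 : ℝ) := by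
    ext k
    rcases h.eq_or_eq k with rfl | rfl
    · simp [h.long_ne_thin]
    · simp [h.long_ne_thin.symm]
  calc ‖x‖ = ‖x i • EuclideanSpace.single i (1 : ℝ) + x j • EuclideanSpace.single j (1 : ℝ)‖ := by
        rw [← h1]
    _ ≤ _ := (norm_add_le _ _).trans (by simp [norm_smul])

theorem dist_le (h : IsSlabSection ε Λ i j S) : ∀ y ∈ closure S, ∀ z ∈ closure S,
    dist y z ≤ |y i - z i| + ε := by
  intro y hy z hz
  rw [dist_eq_norm]
  refine (h.norm_le_add _).trans ?_
  have := closure_width_le h.width_le y hy z hz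
  simp only [PiLp.sub_apply]
  linarith

theorem isThinSection (h : IsSlabSection ε Λ i j S) : IsThinSection ε i S where
  isOpen := h.isOpen
  bounded := h.bounded
  lipschitz := h.lipschitz
  dist_le y hy z hz := h.dist_le y (subset_closure hy) z (subset_closure hz)
  exists_frontier y hy := by
    obtain ⟨c, _, hc⟩ := exists_exit h.isOpen h.bounded hy
      (d := EuclideanSpace.single j (1 : ℝ)) (by simp)
    refine ⟨_, hc, (h.dist_le _ (subset_closure hy) _ (frontier_subset_closure hc)).trans ?_⟩
    simp [h.long_ne_thin]
  doubling c hc ℓ _ := volume_inter_strip_le_of_convex h.convex i hc ℓ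

end IsSlabSection

theorem Piece.IsThin.exists_isThinSection {m : ℕ} (hm : m = 1 ∨ m = 2) {P : Piece m}
    {κ K L₀ Λ ε : ℝ} (h : P.IsThin κ K L₀ Λ ε) : ∃ i, IsThinSection ε i P.cross := by
  have h1 := h.section_spec
  split at h1
  · exact ⟨⟨0, by omega⟩, h1.isThinSection _⟩
  · exact ⟨_, h1.isThinSection⟩

/-! ### Geometry of a piece -/

namespace Piece

variable {m : ℕ}

/-- The isometric embedding of the hyperplane of the cross-section. -/
def lift (P : Piece m) : E m →ₗᵢ[ℝ] E (m + 1) where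
  toFun y := ∑ k : Fin m, y k • P.frame k.succ
  map_add' y z := by simp [add_smul, Finset.sum_add_distrib]
  map_smul' c y := by simp [mul_smul, Finset.smul_sum]
  norm_map' y := by
    have ho : Orthonormal ℝ fun k : Fin m => P.frame k.succ :=
      P.frame.orthonormal.comp _ (Fin.succ_injective m)
    have h1 : ‖∑ k : Fin m, y k • P.frame k.succ‖ ^ 2 = ‖y‖ ^ 2 := by
      rw [← real_inner_self_eq_norm_sq, ho.inner_sum, EuclideanSpace.real_norm_sq_eq]
      simp [sq]
    exact (sq_eq_sq₀ (norm_nonneg _) (norm_nonneg _)).1 h1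

theorem lift_apply (P : Piece m) (y : E m) : P.lift y = ∑ k : Fin m, y k • P.frame k.succ := rfl

theorem place_eq (P : Piece m) (a : ℝ) (y : E m) : P.place a y = P.curve a + P.lift y := rfl

theorem lift_single (P : Piece m) (k : Fin m) :
    P.lift (EuclideanSpace.single k 1) = P.frame k.succ := by
  rw [lift_apply, Finset.sum_eq_single k]
  · simp
  · intro b _ hb; simp [hb]
  · simp

theorem norm_frame (P : Piece m) (i : Fin (m + 1)) : ‖P.frame i‖ = 1 :=
  P.frame.orthonormal.norm_eq_one i

theorem inner_lift_frame_zero (P : Piece m) (y : E m) : inner ℝ (P.lift y) (P.frame 0) = 0 := by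
  rw [lift_apply, sum_inner]
  refine Finset.sum_eq_zero fun k _ => ?_
  rw [inner_smul_left, P.frame.orthonormal.inner_eq_zero (Fin.succ_ne_zero k), mul_zero]

theorem inner_lift_frame_succ (P : Piece m) (y : E m) (k : Fin m) :
    inner ℝ (P.lift y) (P.frame k.succ) = y k := by
  rw [← P.lift_single k, P.lift.inner_map_map]
  simp [EuclideanSpace.inner_single_right]

/-- The transverse coordinates of a vector. -/
def trans (P : Piece m) (x : E (m + 1)) : E m := WithLp.toLp 2 fun k => inner ℝ x (P.frame k.succ)

theorem trans_apply (P : Piece m) (x : E (m + 1)) (k : Fin m) :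
    P.trans x k = inner ℝ x (P.frame k.succ) := rfl

theorem decomp (P : Piece m) (x : E (m + 1)) :
    x = inner ℝ x (P.frame 0) • P.frame 0 + P.lift (P.trans x) := by
  have := P.frame.sum_repr' x
  rw [Fin.sum_univ_succ] at this
  rw [lift_apply]
  have hcomm : ∀ i, inner ℝ x (P.frame i) = inner ℝ (P.frame i) x :=
    fun i => real_inner_comm _ _
  simp only [trans_apply, hcomm]
  exact this.symm

/-- The height of the curve over the cross-sectional hyperplane. -/
def height (P : Piece m) (a : ℝ) : ℝ := inner ℝ (P.curve a) (P.frame 0)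

theorem inner_place_frame_zero (P : Piece m) (a : ℝ) (y : E m) :
    inner ℝ (P.place a y) (P.frame 0) = P.height a := by
  rw [place_eq, inner_add_left, inner_lift_frame_zero, add_zero, height]

theorem eq_place_of_height (P : Piece m) {z : E (m + 1)} {a : ℝ}
    (h : inner ℝ z (P.frame 0) = P.height a) : z = P.place a (P.trans (z - P.curve a)) := by
  have h1 := P.decomp (z - P.curve a)
  rw [inner_sub_left, h, height, sub_self, zero_smul, zero_add] at h1
  rw [place_eq, ← h1]; simp

namespace IsThin

variable {P : Piece m} {κ K L₀ Λ ε : ℝ}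

theorem hasDerivAt (h : P.IsThin κ K L₀ Λ ε) {a : ℝ} (ha : a ∈ Ioo (-P.L) P.L) :
    HasDerivAt P.curve (deriv P.curve a) a :=
  ((h.curve_contDiff.contDiffAt (isOpen_Ioo.mem_nhds ha)).differentiableAt (by norm_num)).hasDerivAt

theorem norm_curve_sub_le (h : P.IsThin κ K L₀ Λ ε) {a b : ℝ} (ha : a ∈ Ioo (-P.L) P.L)
    (hb : b ∈ Ioo (-P.L) P.L) : ‖P.curve b - P.curve a‖ ≤ K * |b - a| :=
  (convex_Ioo _ _).norm_image_sub_le_of_norm_deriv_le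
    (fun _ hx => (h.hasDerivAt hx).differentiableAt) h.curve_bound ha hb

theorem hasDerivAt_height (h : P.IsThin κ K L₀ Λ ε) {a : ℝ} (ha : a ∈ Ioo (-P.L) P.L) :
    HasDerivAt P.height (inner ℝ (deriv P.curve a) (P.frame 0)) a := by
  have h1 := (innerSL ℝ (P.frame 0)).hasFDerivAt.comp_hasDerivAt a (h.hasDerivAt ha)
  rw [innerSL_apply_apply, real_inner_comm] at h1
  refine h1.congr_of_eventuallyEq (Filter.Eventually.of_forall fun b => ?_)
  exact real_inner_comm _ _

/-- Transversality in integrated form. It makes the height an admissible parameter of the curve, so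
that a point of the piece determines its parameter and its section coordinates. -/
theorem le_height_sub (h : P.IsThin κ K L₀ Λ ε) {a b : ℝ} (ha : a ∈ Ioo (-P.L) P.L)
    (hb : b ∈ Ioo (-P.L) P.L) (hab : a ≤ b) : κ * (b - a) ≤ P.height b - P.height a := by
  refine (convex_Ioo (-P.L) P.L).mul_sub_le_image_sub_of_le_deriv
    (fun x hx => (h.hasDerivAt_height hx).continuousAt.continuousWithinAt) ?_ ?_ a ha b hb hab
  · rw [interior_Ioo]
    exact fun x hx => (h.hasDerivAt_height hx).differentiableAt.differentiableWithinAt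
  · rw [interior_Ioo]
    intro x hx
    rw [(h.hasDerivAt_height hx).deriv]
    exact h.curve_transversal x hx

theorem le_abs_height_sub (h : P.IsThin κ K L₀ Λ ε) {a b : ℝ} (ha : a ∈ Ioo (-P.L) P.L)
    (hb : b ∈ Ioo (-P.L) P.L) : κ * |b - a| ≤ |P.height b - P.height a| := by
  rcases le_total a b with hab | hab
  · rw [abs_of_nonneg (sub_nonneg.2 hab)]
    exact (h.le_height_sub ha hb hab).trans (le_abs_self _)
  · rw [abs_sub_comm, abs_of_nonneg (sub_nonneg.2 hab), abs_sub_comm]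
    exact (h.le_height_sub hb ha hab).trans (le_abs_self _)

theorem height_injOn (h : P.IsThin κ K L₀ Λ ε) (hκ : 0 < κ) {a b : ℝ} (ha : a ∈ Ioo (-P.L) P.L)
    (hb : b ∈ Ioo (-P.L) P.L) (hab : P.height a = P.height b) : a = b := by
  have := h.le_abs_height_sub ha hb
  rw [hab, sub_self, abs_zero] at this
  have h1 : |b - a| ≤ 0 := by by_contra! hc; nlinarith
  exact (sub_eq_zero.1 (abs_nonpos_iff.1 h1)).symm

theorem place_inj (h : P.IsThin κ K L₀ Λ ε) (hκ : 0 < κ) {a b : ℝ} {y z : E m}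
    (ha : a ∈ Ioo (-P.L) P.L) (hb : b ∈ Ioo (-P.L) P.L) (hab : P.place a y = P.place b z) :
    a = b ∧ y = z := by
  have h1 : a = b := h.height_injOn hκ ha hb (by
    rw [← P.inner_place_frame_zero a y, hab, inner_place_frame_zero])
  subst h1
  rw [place_eq, place_eq, add_right_inj] at hab
  exact ⟨rfl, P.lift.injective hab⟩

theorem exists_height_eq (h : P.IsThin κ K L₀ Λ ε) {a₁ ρ s : ℝ} (hρ : 0 ≤ ρ)
    (hsub : Icc (a₁ - ρ) (a₁ + ρ) ⊆ Ioo (-P.L) P.L) (hs : |s - P.height a₁| ≤ κ * ρ) :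
    ∃ a ∈ Icc (a₁ - ρ) (a₁ + ρ), P.height a = s := by
  have h1 := h.le_height_sub (a := a₁) (b := a₁ + ρ) (hsub ⟨by linarith, by linarith⟩)
    (hsub ⟨by linarith, by linarith⟩) (by linarith)
  have h2 := h.le_height_sub (a := a₁ - ρ) (b := a₁) (hsub ⟨by linarith, by linarith⟩)
    (hsub ⟨by linarith, by linarith⟩) (by linarith)
  rw [add_sub_cancel_left] at h1
  rw [sub_sub_cancel] at h2
  rw [abs_le] at hs
  exact intermediate_value_Icc (by linarith)
    (fun x hx => (h.hasDerivAt_height (hsub hx)).continuousAt.continuousWithinAt)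
    ⟨by linarith, by linarith⟩

theorem norm_place_sub_le (h : P.IsThin κ K L₀ Λ ε) {a b : ℝ} {y z : E m}
    (ha : a ∈ Ioo (-P.L) P.L) (hb : b ∈ Ioo (-P.L) P.L) :
    dist (P.place b z) (P.place a y) ≤ K * |b - a| + dist z y := by
  have h1 : P.place b z - P.place a y = (P.curve b - P.curve a) + P.lift (z - y) := by
    rw [place_eq, place_eq, map_sub]; abel
  rw [dist_eq_norm, h1, dist_eq_norm]
  refine (norm_add_le _ _).trans ?_
  rw [P.lift.norm_map]
  linarith [h.norm_curve_sub_le ha hb]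

/-- The coordinates `(a, y)` near a point of a piece or of its lateral boundary. -/
theorem exists_coordinates (h : P.IsThin κ K L₀ Λ ε) (hκ : 0 < κ) (hK : 0 < K) {a₀ : ℝ}
    (ha₀ : a₀ ∈ Ioo (-P.L) P.L) {η : ℝ} (hη : 0 < η) : ∃ r > 0, ∀ y₀ z, dist z (P.place a₀ y₀) < r →
      ∃ a ∈ Ioo (-P.L) P.L, ∃ y, z = P.place a y ∧ |a - a₀| < η ∧
        κ * |a - a₀| ≤ |inner ℝ (z - P.place a₀ y₀) (P.frame 0)| ∧
        dist y y₀ ≤ (1 + K / κ) * dist z (P.place a₀ y₀) := by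
  obtain ⟨ρ, hρ, hball⟩ := Metric.isOpen_iff.1 isOpen_Ioo a₀ ha₀
  set ρ' := min (ρ / 2) (η / 2) with hρ'
  have hρ'pos : 0 < ρ' := lt_min (by positivity) (by positivity)
  have hsub : Icc (a₀ - ρ') (a₀ + ρ') ⊆ Ioo (-P.L) P.L := by
    intro x hx
    refine hball ?_
    have : ρ' ≤ ρ / 2 := min_le_left _ _
    rw [Metric.mem_ball, Real.dist_eq, abs_lt]
    constructor <;> linarith [hx.1, hx.2]
  refine ⟨κ * ρ', by positivity, fun y₀ z hz => ?_⟩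
  have h1 : |inner ℝ (z - P.place a₀ y₀) (P.frame 0)| ≤ dist z (P.place a₀ y₀) := by
    have := abs_real_inner_le_norm (z - P.place a₀ y₀) (P.frame 0)
    rwa [P.norm_frame, mul_one, ← dist_eq_norm] at this
  have h2 : inner ℝ (z - P.place a₀ y₀) (P.frame 0) = inner ℝ z (P.frame 0) - P.height a₀ := by
    rw [inner_sub_left, inner_place_frame_zero]
  rw [h2] at h1
  obtain ⟨a, ha, hz0⟩ := h.exists_height_eq hρ'pos.le hsub (h1.trans hz.le)
  have hzp := P.eq_place_of_height hz0.symm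
  have h3 : κ * |a - a₀| ≤ |inner ℝ z (P.frame 0) - P.height a₀| := by
    rw [← hz0]; exact h.le_abs_height_sub ha₀ (hsub ha)
  refine ⟨a, hsub ha, _, hzp, ?_, by rw [h2]; exact h3, ?_⟩
  · have : ρ' ≤ η / 2 := min_le_right _ _
    rw [abs_lt]; constructor <;> linarith [ha.1, ha.2]
  · set y := P.trans (z - P.curve a)
    have h4 : P.lift (y - y₀) = (z - P.place a₀ y₀) - (P.curve a - P.curve a₀) := by
      have h5 : P.lift y = z - P.curve a := eq_sub_of_add_eq' hzp.symm
      rw [map_sub, h5, place_eq]; abel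
    have h5 : dist y y₀ = ‖P.lift (y - y₀)‖ := by rw [P.lift.norm_map, dist_eq_norm]
    rw [h5, h4]
    refine (norm_sub_le _ _).trans ?_
    have h6 := h.norm_curve_sub_le ha₀ (hsub ha)
    have h7 : |a - a₀| ≤ dist z (P.place a₀ y₀) / κ := by
      rw [le_div_iff₀ hκ]; linarith
    calc _ ≤ dist z (P.place a₀ y₀) + K * (dist z (P.place a₀ y₀) / κ) := by
          rw [← dist_eq_norm]; gcongr; exact h6.trans (by gcongr)
      _ = _ := by ring

theorem isOpen_swept (h : P.IsThin κ K L₀ Λ ε) (hκ : 0 < κ) (hK : 0 < K) {I : Set ℝ}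
    (hI : IsOpen I) (hIsub : I ⊆ Ioo (-P.L) P.L) {A : Set (E m)} (hA : IsOpen A) :
    IsOpen {x | ∃ a ∈ I, ∃ y ∈ A, x = P.place a y} := by
  rw [Metric.isOpen_iff]
  rintro _ ⟨a₀, ha₀, y₀, hy₀, rfl⟩
  obtain ⟨η, hη, hIball⟩ := Metric.isOpen_iff.1 hI a₀ ha₀
  obtain ⟨ρ, hρ, hball⟩ := Metric.isOpen_iff.1 hA y₀ hy₀
  obtain ⟨r, hr, hloc⟩ := h.exists_coordinates hκ hK (hIsub ha₀) hη
  have hc : 0 < 1 + K / κ := by positivity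
  refine ⟨min r (ρ / (1 + K / κ)), lt_min hr (by positivity), fun z hz => ?_⟩
  rw [Metric.mem_ball, lt_min_iff] at hz
  obtain ⟨a, _, y, hzp, haη, _, hyd⟩ := hloc y₀ z hz.1
  refine ⟨a, hIball (by rwa [Metric.mem_ball, Real.dist_eq]), y, hball ?_, hzp⟩
  rw [Metric.mem_ball]
  have := hz.2
  rw [lt_div_iff₀ hc] at this
  linarith

theorem isOpen_carrier (h : P.IsThin κ K L₀ Λ ε) (hκ : 0 < κ) (hK : 0 < K)
    (hS : IsOpen P.cross) : IsOpen P.carrier :=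
  h.isOpen_swept hκ hK isOpen_Ioo subset_rfl hS

theorem place_mem_carrier_iff (h : P.IsThin κ K L₀ Λ ε) (hκ : 0 < κ) {a : ℝ} {y : E m}
    (ha : a ∈ Ioo (-P.L) P.L) : P.place a y ∈ P.carrier ↔ y ∈ P.cross := by
  constructor
  · rintro ⟨b, hb, z, hz, heq⟩
    rwa [(h.place_inj hκ ha hb heq).2]
  · exact fun hy => ⟨a, ha, y, hy, rfl⟩

theorem place_mem_closure (P : Piece m) {a : ℝ} {y : E m}
    (ha : a ∈ Ioo (-P.L) P.L) (hy : y ∈ closure P.cross) : P.place a y ∈ closure P.carrier := by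
  have hc : Continuous (P.place a) := by
    have : P.place a = fun y => P.curve a + P.lift y := funext fun y => P.place_eq a y
    rw [this]; have := P.lift.continuous; fun_prop
  exact map_mem_closure hc hy fun z hz => ⟨a, ha, z, hz, rfl⟩

theorem mem_frontier_cross_of_place (h : P.IsThin κ K L₀ Λ ε) (hκ : 0 < κ) (hK : 0 < K)
    (hS : IsOpen P.cross) {a : ℝ} {y : E m} (ha : a ∈ Ioo (-P.L) P.L)
    (hfr : P.place a y ∈ frontier P.carrier) : y ∈ frontier P.cross := by
  rw [(h.isOpen_carrier hκ hK hS).frontier_eq] at hfr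
  rw [hS.frontier_eq]
  refine ⟨?_, fun hy => hfr.2 ⟨a, ha, y, hy, rfl⟩⟩
  by_contra hy
  have ho := h.isOpen_swept hκ hK isOpen_Ioo subset_rfl (isClosed_closure (s := P.cross)).isOpen_compl
  obtain ⟨z, ⟨a', ha', y', hy', h1⟩, b, hb, w, hw, h2⟩ :=
    mem_closure_iff.1 hfr.1 _ ho ⟨a, ha, y, hy, rfl⟩
  have := (h.place_inj hκ ha' hb (h1.symm.trans h2)).2
  exact hy' (this ▸ subset_closure hw)

/-- The outward normal of a piece at a point of its lateral boundary, from the outward normal of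
the cross-section. -/
theorem isOutwardNormal (h : P.IsThin κ K L₀ Λ ε) (hκ : 0 < κ) (hK : 0 < K) {a₀ : ℝ} {y₀ ν : E m}
    (ha₀ : a₀ ∈ Ioo (-P.L) P.L) (hν : IsOutwardNormal P.cross y₀ ν) {w : E (m + 1)}
    (hw : w = P.lift ν - (inner ℝ (deriv P.curve a₀) (P.lift ν) /
      inner ℝ (deriv P.curve a₀) (P.frame 0)) • P.frame 0) :
    1 ≤ ‖w‖ ∧ IsOutwardNormal P.carrier (P.place a₀ y₀) (‖w‖⁻¹ • w) := by
  set g := deriv P.curve a₀ with hg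
  set β := inner ℝ g (P.lift ν) / inner ℝ g (P.frame 0) with hβ
  have hgpos : 0 < inner ℝ g (P.frame 0) := hκ.trans_le (h.curve_transversal a₀ ha₀)
  have hpn : ‖P.lift ν‖ = 1 := by rw [P.lift.norm_map, hν.1]
  have hw1 : 1 ≤ ‖w‖ := by
    have h1 : inner ℝ (P.lift ν) w = 1 := by
      rw [hw, inner_sub_right, inner_smul_right, inner_lift_frame_zero,
        real_inner_self_eq_norm_sq, hpn]
      norm_num
    have := real_inner_le_norm (P.lift ν) w
    rwa [h1, hpn, one_mul] at this
  have hwpos : 0 < ‖w‖ := by linarith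
  -- The correction along `P.frame 0` makes w orthogonal to the tangent of the curve. Displacement
  -- along the curve then enters only through its first order remainder.
  have hgw : inner ℝ g w = 0 := by
    rw [hw, inner_sub_right, inner_smul_right, hβ, div_mul_cancel₀ _ hgpos.ne', sub_self]
  refine ⟨hw1, by rw [norm_smul, norm_inv, norm_norm, inv_mul_cancel₀ hwpos.ne'], ?_⟩
  intro η hη
  set B := 1 + K / κ with hB
  have hBpos : 0 < B := by positivity
  obtain ⟨r₁, hr₁, hcross⟩ := hν.2 (η / (2 * B)) (by positivity)
  have hd := (hasDerivAt_iff_isLittleO.1 (h.hasDerivAt ha₀)).def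
    (c := η * κ / (2 * ‖w‖)) (by positivity)
  obtain ⟨ρ, hρ, hcurve⟩ := Metric.eventually_nhds_iff.1 hd
  obtain ⟨r₂, hr₂, hloc⟩ := h.exists_coordinates hκ hK ha₀ hρ
  refine ⟨min r₂ (r₁ / B), lt_min hr₂ (by positivity), fun z hz => ?_⟩
  rw [Metric.mem_ball, lt_min_iff, lt_div_iff₀ hBpos] at hz
  obtain ⟨a, ha, y, rfl, haρ, haκ, hyd⟩ := hloc y₀ z hz.1
  set x := P.place a₀ y₀ with hx
  set n := dist (P.place a y) x with hn
  have hn' : ‖P.place a y - x‖ = n := by rw [hn, dist_eq_norm]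
  have hn0 : 0 ≤ n := dist_nonneg
  have haκ' : κ * |a - a₀| ≤ n := by
    have := abs_real_inner_le_norm (P.place a y - x) (P.frame 0)
    rw [P.norm_frame, mul_one, hn'] at this
    linarith
  have hrem := hcurve (y := a) (by rwa [Real.dist_eq])
  -- the defect between the two half spaces is of lower order
  have hid : inner ℝ (P.place a y - x) w = inner ℝ (y - y₀) ν +
      inner ℝ (P.curve a - P.curve a₀ - (a - a₀) • g) w := by
    have h1 : P.place a y - x = P.lift (y - y₀) + (P.curve a - P.curve a₀) := by
      rw [hx, place_eq, place_eq, map_sub]; abel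
    have h2 : inner ℝ (P.lift (y - y₀)) w = inner ℝ (y - y₀) ν := by
      rw [hw, inner_sub_right, inner_smul_right, inner_lift_frame_zero, mul_zero, sub_zero,
        P.lift.inner_map_map]
    rw [h1, inner_add_left, h2, inner_sub_left _ ((a - a₀) • g), inner_smul_left, hgw]
    simp
  have hrem2 : |inner ℝ (P.curve a - P.curve a₀ - (a - a₀) • g) w| ≤ η / 2 * n := by
    refine (abs_real_inner_le_norm _ _).trans ?_
    calc _ ≤ (η * κ / (2 * ‖w‖) * ‖a - a₀‖) * ‖w‖ := by gcongr
      _ = η / 2 * (κ * |a - a₀|) := by rw [Real.norm_eq_abs]; field_simp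
      _ ≤ _ := by gcongr
  rw [abs_le] at hrem2
  have hyb : y ∈ Metric.ball y₀ r₁ := by rw [Metric.mem_ball]; linarith
  have hyn : η / (2 * B) * ‖y - y₀‖ ≤ η / 2 * n := by
    rw [← dist_eq_norm]
    calc η / (2 * B) * dist y y₀ ≤ η / (2 * B) * (B * n) := by gcongr
      _ = _ := by field_simp
  have hηw : η * n ≤ η * n * ‖w‖ := le_mul_of_one_le_right (by positivity) hw1
  rw [h.place_mem_carrier_iff hκ ha, inner_smul_right, hid, hn']
  constructor
  · intro h1
    rw [inv_mul_lt_iff₀ hwpos] at h1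
    exact (hcross y hyb).1 (by linarith)
  · intro h1
    rw [lt_inv_mul_iff₀ hwpos] at h1
    exact (hcross y hyb).2 (by linarith)

end IsThin

end Piece

/-! ### Consequences of the a priori bounds -/

namespace C1HolderLE

variable {V : Type*} [NormedAddCommGroup V] [NormedSpace ℝ V] {α M M' : ℝ} {s : Set V}
  {u u' : V → ℂ} {Du Du' : V → V →L[ℝ] ℂ}

theorem sub (h : C1HolderLE α M s u Du) (h' : C1HolderLE α M' s u' Du') :
    C1HolderLE α (M + M') s (fun p => u p - u' p) (fun p => Du p - Du' p) where
  bound p hp := (norm_sub_le _ _).trans (add_le_add (h.bound p hp) (h'.bound p hp))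
  bound_deriv p hp :=
    (norm_sub_le _ _).trans (add_le_add (h.bound_deriv p hp) (h'.bound_deriv p hp))
  holder_deriv p hp q hq := by
    have h1 := h.holder_deriv p hp q hq
    have h2 := h'.holder_deriv p hp q hq
    rw [add_mul, sub_sub_sub_comm]
    exact (norm_sub_le _ _).trans (add_le_add h1 h2)
  taylor p hp q hq := by
    have h1 := h.taylor p hp q hq
    have h2 := h'.taylor p hp q hq
    have h3 : u q - u' q - (u p - u' p) - (Du p - Du' p) (q - p)
        = (u q - u p - Du p (q - p)) - (u' q - u' p - Du' p (q - p)) := by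
      rw [sub_apply]; ring
    rw [add_mul, h3]
    exact (norm_sub_le _ _).trans (add_le_add h1 h2)

theorem norm_sub_le_of_dist_le_one (h : C1HolderLE α M s u Du) (hα : 0 < α) (hM : 0 ≤ M) {p q : V}
    (hp : p ∈ s) (hq : q ∈ s) (hd : dist p q ≤ 1) : ‖u q - u p‖ ≤ 2 * M * dist p q := by
  have h1 := h.taylor p hp q hq
  have h2 : ‖Du p (q - p)‖ ≤ M * dist p q := by
    rw [dist_comm, dist_eq_norm]
    exact (ContinuousLinearMap.le_opNorm _ _).trans (by gcongr; exact h.bound_deriv p hp)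
  have h3 : dist p q ^ (1 + α) ≤ dist p q := by
    have := Real.rpow_le_rpow_of_exponent_ge' dist_nonneg hd zero_le_one (by linarith : 1 ≤ 1 + α)
    rwa [Real.rpow_one] at this
  have h4 : u q - u p = (u q - u p - Du p (q - p)) + Du p (q - p) := by ring
  rw [h4]
  refine (norm_add_le _ _).trans ?_
  have := mul_le_mul_of_nonneg_left h3 hM
  linarith

theorem continuousOn (h : C1HolderLE α M s u Du) (hα : 0 < α) (hM : 0 ≤ M) : ContinuousOn u s := by
  intro p hp
  rw [Metric.continuousWithinAt_iff]
  intro η hη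
  refine ⟨min 1 (η / (2 * M + 1)), lt_min one_pos (by positivity), fun q hq hd => ?_⟩
  rw [lt_min_iff, lt_div_iff₀ (by positivity)] at hd
  rw [dist_eq_norm]
  have h1 := h.norm_sub_le_of_dist_le_one hα hM hp hq (by rw [dist_comm]; exact hd.1.le)
  rw [dist_comm] at h1
  nlinarith [dist_nonneg (x := q) (y := p)]

theorem continuousOn_deriv (h : C1HolderLE α M s u Du) (hα : 0 < α) : ContinuousOn Du s := by
  intro p hp
  rw [ContinuousWithinAt, tendsto_iff_dist_tendsto_zero]
  have hlim : Filter.Tendsto (fun q => M * dist q p ^ α) (nhdsWithin p s) (nhds 0) := by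
    have h1 : Filter.Tendsto (fun q : V => dist q p) (nhdsWithin p s) (nhds 0) := by
      have : Filter.Tendsto (fun q : V => dist q p) (nhds p) (nhds (dist p p)) :=
        Continuous.tendsto (by fun_prop) p
      rw [dist_self] at this
      exact this.mono_left nhdsWithin_le_nhds
    have h2 := (h1.rpow_const (p := α) (Or.inr hα.le)).const_mul M
    rwa [Real.zero_rpow hα.ne', mul_zero] at h2
  refine squeeze_zero' (Filter.Eventually.of_forall fun _ => dist_nonneg) ?_ hlim
  filter_upwards [self_mem_nhdsWithin] with q hq
  rw [dist_eq_norm]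
  exact h.holder_deriv q hq p hp

theorem hasFDerivAt (h : C1HolderLE α M s u Du) (hα : 0 < α) {p : V}
    (hs : s ∈ nhds p) : HasFDerivAt u (Du p) p := by
  rw [hasFDerivAt_iff_tendsto]
  have hlim : Filter.Tendsto (fun q => M * dist q p ^ α) (nhds p) (nhds 0) := by
    have h1 : Filter.Tendsto (fun q : V => dist q p) (nhds p) (nhds 0) := by
      have : Filter.Tendsto (fun q : V => dist q p) (nhds p) (nhds (dist p p)) :=
        Continuous.tendsto (by fun_prop) p
      rwa [dist_self] at this
    have h2 := (h1.rpow_const (p := α) (Or.inr hα.le)).const_mul M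
    rwa [Real.zero_rpow hα.ne', mul_zero] at h2
  refine squeeze_zero' (Filter.Eventually.of_forall fun _ => by positivity) ?_ hlim
  filter_upwards [hs] with q hq
  have h1 := h.taylor p (mem_of_mem_nhds hs) q hq
  rcases eq_or_ne q p with rfl | hne
  · simp [Real.zero_rpow hα.ne']
  · have hpos : 0 < ‖q - p‖ := norm_pos_iff.2 (sub_ne_zero.2 hne)
    rw [dist_comm, dist_eq_norm, Real.rpow_add hpos, Real.rpow_one] at h1
    rw [dist_eq_norm, inv_mul_le_iff₀ hpos]
    linarith

/-- If `u` vanishes at both ends of a segment, its derivative along the segment is small. -/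
theorem norm_apply_le_of_eq_zero (h : C1HolderLE α M s u Du) {p q : V}
    (hp : p ∈ s) (hq : q ∈ s) (h0 : u p = 0) (h1 : u q = 0) :
    ‖Du p (q - p)‖ ≤ M * dist p q ^ (1 + α) := by
  have := h.taylor p hp q hq
  rwa [h0, h1, sub_zero, zero_sub, norm_neg] at this

end C1HolderLE

/-- The real-linear form `ν ↦ ν · F`. -/
def fluxForm {n : ℕ} (F : EuclideanSpace ℂ (Fin n)) : E n →L[ℝ] ℂ :=
  ∑ i, (EuclideanSpace.proj i : E n →L[ℝ] ℝ).smulRight (F i)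

theorem fluxForm_apply {n : ℕ} (F : EuclideanSpace ℂ (Fin n)) (ν : E n) :
    fluxForm F ν = ∑ i, (ν i : ℂ) * F i := by
  simp [fluxForm]

theorem norm_fluxForm_sub_apply_le {n : ℕ} {F F' : EuclideanSpace ℂ (Fin n)} {B : ℝ}
    (hB : ∀ i, ‖F i - F' i‖ ≤ B) (ν : E n) : ‖fluxForm F ν - fluxForm F' ν‖ ≤ n * B * ‖ν‖ := by
  rw [fluxForm_apply, fluxForm_apply, ← Finset.sum_sub_distrib]
  refine (norm_sum_le _ _).trans ?_
  calc ∑ i, ‖(ν i : ℂ) * F i - (ν i : ℂ) * F' i‖ ≤ ∑ _i : Fin n, ‖ν‖ * B := by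
        refine Finset.sum_le_sum fun i _ => ?_
        rw [← mul_sub, norm_mul, Complex.norm_real]
        gcongr
        · exact PiLp.norm_apply_le ν i
        · exact hB i
    _ = _ := by simp; ring

namespace Params

variable {n : ℕ}

theorem flux_apply (A : Params n) (p : E n × ℝ) (i : Fin n) : A.flux p i = A.u p * A.c p i := by
  simp [flux]

theorem normalDeriv_add_coupling (A : Params n) (μ : ℝ) (p : E n × ℝ) (ν : E n) :
    A.normalDeriv p ν + A.coupling μ p ν = A.Du p (ν, 0) - fluxForm (A.flux p) ν / μ := by
  rw [normalDeriv, coupling, fluxForm_apply, neg_div, sub_eq_add_neg]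

namespace Bounds

variable {A : Params n} {α₂ α₃ α₄ C₂ C₃ C₄ : ℝ} {N : Set (E n)} {T : ℝ}

theorem norm_c_le (h : A.Bounds α₂ α₃ α₄ C₂ C₃ C₄ N T) {x : E n} {t : ℝ} (hx : x ∈ closure N)
    (ht : t ∈ Icc 0 T) (i : Fin n) : ‖A.c (x, t) i‖ ≤ C₃ := by
  obtain ⟨a, b, _, hb, hab, h1, _⟩ := h.velocity_space i t ht
  exact (h1 x hx).trans (by linarith)

theorem norm_c_sub_le (h : A.Bounds α₂ α₃ α₄ C₂ C₃ C₄ N T) {x x' : E n} {t : ℝ}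
    (hx : x ∈ closure N) (hx' : x' ∈ closure N) (ht : t ∈ Icc 0 T) (i : Fin n) :
    ‖A.c (x, t) i - A.c (x', t) i‖ ≤ C₃ * dist x x' ^ α₃ := by
  obtain ⟨a, b, ha, _, hab, _, h2⟩ := h.velocity_space i t ht
  refine (h2 x hx x' hx').trans ?_
  gcongr
  linarith

theorem norm_c_time_sub_le (h : A.Bounds α₂ α₃ α₄ C₂ C₃ C₄ N T) {x : E n} {t t' : ℝ}
    (hx : x ∈ closure N) (ht : t ∈ Icc 0 T) (ht' : t' ∈ Icc 0 T) (i : Fin n) :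
    ‖A.c (x, t) i - A.c (x, t') i‖ ≤ C₃ * dist t t' ^ (α₃ / 2) := by
  obtain ⟨a, b, ha, _, hab, _, h2⟩ := h.velocity_time i x hx
  refine (h2 t ht t' ht').trans ?_
  gcongr
  linarith

theorem continuousOn_c (h : A.Bounds α₂ α₃ α₄ C₂ C₃ C₄ N T) (hα₃ : 0 < α₃) (i : Fin n) :
    ContinuousOn (fun p => A.c p i) (closure N ×ˢ Icc 0 T) := by
  rintro ⟨x, t⟩ ⟨hx, ht⟩
  rw [ContinuousWithinAt, tendsto_iff_dist_tendsto_zero]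
  have hlim : Filter.Tendsto (fun q : E n × ℝ =>
      C₃ * dist q.1 x ^ α₃ + C₃ * dist q.2 t ^ (α₃ / 2))
      (nhdsWithin (x, t) (closure N ×ˢ Icc 0 T)) (nhds 0) := by
    refine Filter.Tendsto.mono_left ?_ nhdsWithin_le_nhds
    have hc : Continuous fun q : E n × ℝ =>
        C₃ * dist q.1 x ^ α₃ + C₃ * dist q.2 t ^ (α₃ / 2) := by
      have h1 : Continuous fun q : E n × ℝ => dist q.1 x ^ α₃ :=
        Continuous.rpow_const (by fun_prop) fun _ => Or.inr hα₃.le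
      have h2 : Continuous fun q : E n × ℝ => dist q.2 t ^ (α₃ / 2) :=
        Continuous.rpow_const (by fun_prop) fun _ => Or.inr (by positivity)
      fun_prop
    have := hc.tendsto (x, t)
    simpa [Real.zero_rpow hα₃.ne', Real.zero_rpow (by positivity : α₃ / 2 ≠ 0)] using this
  refine squeeze_zero' (Filter.Eventually.of_forall fun _ => dist_nonneg) ?_ hlim
  filter_upwards [self_mem_nhdsWithin] with q hq
  refine (dist_triangle _ (A.c (x, q.2) i) _).trans ?_
  rw [dist_eq_norm, dist_eq_norm]
  exact add_le_add (h.norm_c_sub_le hq.1 hx hq.2 i) (h.norm_c_time_sub_le hx hq.2 ht i)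

theorem continuousOn_flux (h : A.Bounds α₂ α₃ α₄ C₂ C₃ C₄ N T) (hα₃ : 0 < α₃) (hα₄ : 0 < α₄)
    (hC₄ : 0 ≤ C₄) (i : Fin n) : ContinuousOn (fun p => A.flux p i) (closure N ×ˢ Icc 0 T) := by
  simp only [flux_apply]
  exact (h.state.continuousOn hα₄ hC₄).mul (h.continuousOn_c hα₃ i)

theorem norm_flux_le (h : A.Bounds α₂ α₃ α₄ C₂ C₃ C₄ N T) (hC₄ : 0 ≤ C₄) {x : E n} {t : ℝ}
    (hx : x ∈ closure N) (ht : t ∈ Icc 0 T) (i : Fin n) : ‖A.flux (x, t) i‖ ≤ C₃ * C₄ := by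
  rw [flux_apply, norm_mul, mul_comm C₃]
  exact mul_le_mul (h.state.bound _ ⟨hx, ht⟩) (h.norm_c_le hx ht i) (norm_nonneg _) hC₄

theorem norm_flux_sub_le (h : A.Bounds α₂ α₃ α₄ C₂ C₃ C₄ N T) (hα₃ : 0 < α₃) (hα₃' : α₃ ≤ 1)
    (hα₄ : 0 < α₄) (hC₄ : 0 ≤ C₄) {x x' : E n} {t : ℝ} (hx : x ∈ closure N)
    (hx' : x' ∈ closure N) (ht : t ∈ Icc 0 T) (hd : dist x x' ≤ 1) (i : Fin n) :
    ‖A.flux (x, t) i - A.flux (x', t) i‖ ≤ 3 * (C₃ * C₄) * dist x x' ^ α₃ := by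
  have hdist : dist (x', t) (x, t) = dist x x' := by
    rw [Prod.dist_eq]; simp [dist_comm]
  have h1 := h.state.norm_sub_le_of_dist_le_one hα₄ hC₄ (p := (x', t)) (q := (x, t))
    ⟨hx', ht⟩ ⟨hx, ht⟩ (by rwa [hdist])
  rw [hdist] at h1
  have h2 : dist x x' ≤ dist x x' ^ α₃ := by
    have := Real.rpow_le_rpow_of_exponent_ge' dist_nonneg hd hα₃.le hα₃'
    rwa [Real.rpow_one] at this
  have h3 : A.flux (x, t) i - A.flux (x', t) i
      = (A.u (x, t) - A.u (x', t)) * A.c (x, t) i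
        + A.u (x', t) * (A.c (x, t) i - A.c (x', t) i) := by
    rw [flux_apply, flux_apply]; ring
  rw [h3]
  refine (norm_add_le _ _).trans ?_
  rw [norm_mul, norm_mul]
  calc _ ≤ (2 * C₄ * dist x x' ^ α₃) * C₃ + C₄ * (C₃ * dist x x' ^ α₃) := by
        gcongr
        · exact h1.trans (by gcongr)
        · exact h.norm_c_le hx ht i
        · exact h.state.bound _ ⟨hx', ht⟩
        · exact h.norm_c_sub_le hx hx' ht i
    _ = _ := by ring

theorem continuousOn_fluxForm (h : A.Bounds α₂ α₃ α₄ C₂ C₃ C₄ N T) (hα₃ : 0 < α₃) (hα₄ : 0 < α₄)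
    (hC₄ : 0 ≤ C₄) : ContinuousOn (fun p => fluxForm (A.flux p)) (closure N ×ˢ Icc 0 T) := by
  unfold fluxForm
  refine continuousOn_finsetSum _ fun i _ => ?_
  have h1 : Continuous fun z : ℂ => (EuclideanSpace.proj i : E n →L[ℝ] ℝ).smulRight z :=
    (ContinuousLinearMap.smulRightL ℝ (E n) ℂ (EuclideanSpace.proj i)).continuous
  exact h1.comp_continuousOn (h.continuousOn_flux hα₃ hα₄ hC₄ i)

end Bounds

end Params

/-- The measurements are compared only in the open time interval. Continuity carries the estimates
to its end points. -/
theorem norm_le_on_Icc_of_Ioo {F : Type*} [NormedAddCommGroup F] {f : ℝ → F} {a b B : ℝ}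
    (hab : a < b) (hf : ContinuousOn f (Icc a b)) (h : ∀ t ∈ Ioo a b, ‖f t‖ ≤ B) :
    ∀ t ∈ Icc a b, ‖f t‖ ≤ B := by
  intro t ht
  have h1 : ContinuousWithinAt f (Ioo a b) t := (hf t ht).mono Ioo_subset_Icc_self
  have h2 := h1.mem_closure_image (by rwa [closure_Ioo hab.ne])
  have h3 : closure (f '' Ioo a b) ⊆ Metric.closedBall 0 B := by
    refine closure_minimal ?_ Metric.isClosed_closedBall
    rintro _ ⟨s, hs, rfl⟩
    simpa using h s hs
  simpa using h3 h2

/-! ### The flux estimate -/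

/-- Two parameter sets on a piece, with the same measurement on its lateral boundary. -/
structure IsMatchedPair {m : ℕ} (A₁ A₂ : Params (m + 1)) (P : Piece m)
    (μ α₂ α₃ α₄ C₂ C₃ C₄ κ K L₀ Λ ε T T₁ T₂ : ℝ) : Prop where
  planar : m = 1 ∨ m = 2
  thin : P.IsThin κ K L₀ Λ ε
  bounds₁ : A₁.Bounds α₂ α₃ α₄ C₂ C₃ C₄ P.carrier T
  bounds₂ : A₂.Bounds α₂ α₃ α₄ C₂ C₃ C₄ P.carrier T
  same : SameMeasurement A₁ A₂ μ P.carrier P.lateral T₁ T₂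
  zero_le_T₁ : 0 ≤ T₁
  T₁_lt_T₂ : T₁ < T₂
  T₂_le_T : T₂ ≤ T
  μ_pos : 0 < μ
  α₂_mem : α₂ ∈ Ioo (0 : ℝ) 1
  α₃_mem : α₃ ∈ Ioo (0 : ℝ) 1
  α₄_mem : α₄ ∈ Ioo (0 : ℝ) 1
  C₂_pos : 0 < C₂
  C₃_pos : 0 < C₃
  C₄_pos : 0 < C₄
  κ_pos : 0 < κ
  K_pos : 0 < K
  ε_pos : 0 < ε

/-- The difference of the convective fluxes, as a linear form. -/
def fluxGap {n : ℕ} (A₁ A₂ : Params n) (p : E n × ℝ) : E n →L[ℝ] ℂ :=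
  fluxForm (A₁.flux p) - fluxForm (A₂.flux p)

/-- The difference of the states. -/
def stateGap {n : ℕ} (A₁ A₂ : Params n) (p : E n × ℝ) : ℂ := A₁.u p - A₂.u p

/-- The difference of the space-time derivatives of the states. -/
def derivGap {n : ℕ} (A₁ A₂ : Params n) (p : E n × ℝ) : E n × ℝ →L[ℝ] ℂ := A₁.Du p - A₂.Du p

theorem rotated_flux_sub {m : ℕ} (P : Piece m) (k : Fin m) (A₁ A₂ : Params (m + 1))
    (p : E (m + 1) × ℝ) :
    rotated P k (A₁.c p) * A₁.u p - rotated P k (A₂.c p) * A₂.u p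
      = fluxGap A₁ A₂ p (P.frame k.succ) := by
  rw [fluxGap, sub_apply, fluxForm_apply, fluxForm_apply, rotated,
    rotated, Finset.sum_mul, Finset.sum_mul]
  simp only [Params.flux_apply]
  congr 1 <;> exact Finset.sum_congr rfl fun i _ => by ring

namespace IsMatchedPair

variable {m : ℕ} {A₁ A₂ : Params (m + 1)} {P : Piece m}
  {μ α₂ α₃ α₄ C₂ C₃ C₄ κ K L₀ Λ ε T T₁ T₂ : ℝ}

theorem state (h : IsMatchedPair A₁ A₂ P μ α₂ α₃ α₄ C₂ C₃ C₄ κ K L₀ Λ ε T T₁ T₂) :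
    C1HolderLE α₄ (2 * C₄) (closure P.carrier ×ˢ Icc 0 T) (stateGap A₁ A₂) (derivGap A₁ A₂) := by
  rw [two_mul]; exact h.bounds₁.state.sub h.bounds₂.state

theorem mem_Icc (h : IsMatchedPair A₁ A₂ P μ α₂ α₃ α₄ C₂ C₃ C₄ κ K L₀ Λ ε T T₁ T₂) {t : ℝ}
    (ht : t ∈ Icc T₁ T₂) : t ∈ Icc 0 T :=
  ⟨h.zero_le_T₁.trans ht.1, ht.2.trans h.T₂_le_T⟩

theorem stateGap_eq_zero (h : IsMatchedPair A₁ A₂ P μ α₂ α₃ α₄ C₂ C₃ C₄ κ K L₀ Λ ε T T₁ T₂)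
    {a t : ℝ} {y : E m} (ha : a ∈ Ioo (-P.L) P.L) (hy : y ∈ frontier P.cross)
    (ht : t ∈ Ioo T₁ T₂) : stateGap A₁ A₂ (P.place a y, t) = 0 := by
  rw [stateGap, (h.same _ ⟨a, ha, y, hy, rfl⟩ t ht).1, sub_self]

theorem mem_slab (h : IsMatchedPair A₁ A₂ P μ α₂ α₃ α₄ C₂ C₃ C₄ κ K L₀ Λ ε T T₁ T₂)
    {a t : ℝ} {y : E m} (ha : a ∈ Ioo (-P.L) P.L) (hy : y ∈ closure P.cross)
    (ht : t ∈ Ioo T₁ T₂) : (P.place a y, t) ∈ closure P.carrier ×ˢ Icc 0 T :=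
  ⟨Piece.IsThin.place_mem_closure P ha hy, h.mem_Icc (Ioo_subset_Icc_self ht)⟩

/-- The agreement of the second measured components, multiplied by μ. It enters the proof only
through this identity. -/
theorem normal_identity (h : IsMatchedPair A₁ A₂ P μ α₂ α₃ α₄ C₂ C₃ C₄ κ K L₀ Λ ε T T₁ T₂)
    {x ν : E (m + 1)} {t : ℝ} (hx : x ∈ P.lateral) (ht : t ∈ Ioo T₁ T₂)
    (hν : IsOutwardNormal P.carrier x ν) :
    fluxGap A₁ A₂ (x, t) ν = μ * derivGap A₁ A₂ (x, t) (ν, 0) := by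
  have h1 := (h.same x hx t ht).2 ν hν
  rw [Params.normalDeriv_add_coupling, Params.normalDeriv_add_coupling] at h1
  have hμ : (μ : ℂ) ≠ 0 := by exact_mod_cast h.μ_pos.ne'
  rw [fluxGap, derivGap, sub_apply, sub_apply]
  field_simp at h1
  linear_combination -h1

/-- Where the tangent of the curve is normal to the cross-section, the flux balance holds in every
direction in which the cross-section is locally extreme. -/
theorem extreme_identity (h : IsMatchedPair A₁ A₂ P μ α₂ α₃ α₄ C₂ C₃ C₄ κ K L₀ Λ ε T T₁ T₂)
    (hS : IsOpen P.cross) (hL : IsLipschitzDomain P.cross) {b r t ρ : ℝ} {y d : E m}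
    (hb : b ∈ Ioo (-P.L) P.L) (hbr : deriv P.curve b = r • P.frame 0)
    (hy : y ∈ frontier P.cross) (ht : t ∈ Ioo T₁ T₂) (hρ : 0 < ρ)
    (hd : ∀ z ∈ closure P.cross, dist z y < ρ → inner ℝ d z ≤ inner ℝ d y) :
    fluxGap A₁ A₂ (P.place b y, t) (P.lift d)
      = μ * derivGap A₁ A₂ (P.place b y, t) (P.lift d, 0) := by
  set D : E m → E (m + 1) × ℝ := fun z => (P.place b z, t) with hD
  have hDc : Continuous D := by
    have : P.place b = fun y => P.curve b + P.lift y := funext fun y => P.place_eq b y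
    have h2 := P.lift.continuous
    simp only [hD, this]; fun_prop
  have hDm : MapsTo D (frontier P.cross) (closure P.carrier ×ˢ Icc 0 T) := fun z hz =>
    h.mem_slab hb (frontier_subset_closure hz) ht
  -- The defect in the balance between `fluxGap` and μ times the spatial part of `derivGap`,
  -- restricted to lifted transverse directions.
  set G : E m → E m →L[ℝ] ℂ := fun z =>
    (fluxGap A₁ A₂ (D z) - μ • (derivGap A₁ A₂ (D z)).comp (ContinuousLinearMap.inl ℝ _ ℝ)).comp
      P.lift.toContinuousLinearMap with hG
  have hGapply : ∀ z v, G z v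
      = fluxGap A₁ A₂ (D z) (P.lift v) - μ * derivGap A₁ A₂ (D z) (P.lift v, 0) := by
    intro z v; simp [hG]
  have hGc : ContinuousWithinAt G (frontier P.cross) y := by
    have h1 : ContinuousOn (fun z => fluxGap A₁ A₂ (D z)) (frontier P.cross) :=
      ((h.bounds₁.continuousOn_fluxForm h.α₃_mem.1 h.α₄_mem.1 h.C₄_pos.le).sub
        (h.bounds₂.continuousOn_fluxForm h.α₃_mem.1 h.α₄_mem.1 h.C₄_pos.le)).comp
          hDc.continuousOn hDm
    have h2 : ContinuousOn (fun z => derivGap A₁ A₂ (D z)) (frontier P.cross) :=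
      (h.state.continuousOn_deriv h.α₄_mem.1).comp hDc.continuousOn hDm
    have h3 : ContinuousOn G (frontier P.cross) := by
      refine ContinuousOn.clm_comp ?_ continuousOn_const
      exact h1.sub ((h2.clm_comp continuousOn_const).const_smul μ)
    exact h3 y hy
  have := hL.apply_eq_zero_of_extreme h.planar hS hy hGc (fun z hz ν hν => ?_) hρ hd
  · rw [hGapply] at this
    exact sub_eq_zero.1 this
  · obtain ⟨_, hn⟩ := h.thin.isOutwardNormal h.κ_pos h.K_pos hb hν rfl
    -- Here the tangent is a multiple of `P.frame 0`, so the correction to the lifted normal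
    -- vanishes.
    have hw : P.lift ν - (inner ℝ (deriv P.curve b) (P.lift ν) /
        inner ℝ (deriv P.curve b) (P.frame 0)) • P.frame 0 = P.lift ν := by
      rw [hbr, inner_smul_left, real_inner_comm, P.inner_lift_frame_zero]; simp
    rw [hw, P.lift.norm_map, hν.1, inv_one, one_smul] at hn
    rw [hGapply, sub_eq_zero]
    exact h.normal_identity ⟨b, hb, z, hz, rfl⟩ ht hn

/-- The derivative of the state gap along a short chord of the cross-section is small. -/
theorem norm_derivGap_chord_le
    (h : IsMatchedPair A₁ A₂ P μ α₂ α₃ α₄ C₂ C₃ C₄ κ K L₀ Λ ε T T₁ T₂)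
    {b t c : ℝ} {y d : E m} (hb : b ∈ Ioo (-P.L) P.L) (ht : t ∈ Ioo T₁ T₂)
    (hy : y ∈ frontier P.cross) (hd : ‖d‖ = 1) (hc : c ≠ 0) (hcε : |c| ≤ ε)
    (hyc : y + c • d ∈ frontier P.cross) :
    ‖derivGap A₁ A₂ (P.place b y, t) (P.lift d, 0)‖ ≤ 2 * C₄ * ε ^ α₄ := by
  have hcpos : 0 < |c| := abs_pos.2 hc
  have h1 := h.state.norm_apply_le_of_eq_zero
    (h.mem_slab hb (frontier_subset_closure hy) ht)
    (h.mem_slab hb (frontier_subset_closure hyc) ht)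
    (h.stateGap_eq_zero hb hy ht) (h.stateGap_eq_zero hb hyc ht)
  have h2 : (P.place b (y + c • d), t) - (P.place b y, t) = c • (P.lift d, (0 : ℝ)) := by
    rw [Prod.mk_sub_mk, P.place_eq, P.place_eq, map_add, map_smul]; simp
  have h3 : dist (P.place b y, t) (P.place b (y + c • d), t) = |c| := by
    rw [dist_comm, dist_eq_norm, h2, norm_smul, Prod.norm_def, P.lift.norm_map, hd]; simp
  rw [h2, h3, map_smul, norm_smul, Real.norm_eq_abs, Real.rpow_add hcpos, Real.rpow_one] at h1
  have h4 : ‖derivGap A₁ A₂ (P.place b y, t) (P.lift d, 0)‖ ≤ 2 * C₄ * |c| ^ α₄ := by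
    by_contra! hlt
    nlinarith
  refine h4.trans ?_
  have := h.C₄_pos
  have := h.α₄_mem.1
  gcongr

theorem norm_fluxGap_apply_le
    (h : IsMatchedPair A₁ A₂ P μ α₂ α₃ α₄ C₂ C₃ C₄ κ K L₀ Λ ε T T₁ T₂)
    {x ν : E (m + 1)} {t : ℝ} (hx : x ∈ closure P.carrier) (ht : t ∈ Icc 0 T) :
    ‖fluxGap A₁ A₂ (x, t) ν‖ ≤ (m + 1) * (2 * (C₃ * C₄)) * ‖ν‖ := by
  rw [fluxGap, sub_apply]
  have := norm_fluxForm_sub_apply_le (F := A₁.flux (x, t)) (F' := A₂.flux (x, t))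
    (B := 2 * (C₃ * C₄)) (fun i => (norm_sub_le _ _).trans (by
      linarith [h.bounds₁.norm_flux_le h.C₄_pos.le hx ht i,
        h.bounds₂.norm_flux_le h.C₄_pos.le hx ht i])) ν
  simpa using this

theorem norm_fluxGap_sub_apply_le
    (h : IsMatchedPair A₁ A₂ P μ α₂ α₃ α₄ C₂ C₃ C₄ κ K L₀ Λ ε T T₁ T₂)
    {x x' ν : E (m + 1)} {t : ℝ} (hx : x ∈ closure P.carrier) (hx' : x' ∈ closure P.carrier)
    (ht : t ∈ Icc 0 T) (hd : dist x x' ≤ 1) :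
    ‖fluxGap A₁ A₂ (x, t) ν - fluxGap A₁ A₂ (x', t) ν‖
      ≤ (m + 1) * (6 * (C₃ * C₄) * dist x x' ^ α₃) * ‖ν‖ := by
  have h1 := norm_fluxForm_sub_apply_le (F := A₁.flux (x, t)) (F' := A₁.flux (x', t))
    (h.bounds₁.norm_flux_sub_le h.α₃_mem.1 h.α₃_mem.2.le h.α₄_mem.1 h.C₄_pos.le hx hx' ht hd) ν
  have h2 := norm_fluxForm_sub_apply_le (F := A₂.flux (x, t)) (F' := A₂.flux (x', t))
    (h.bounds₂.norm_flux_sub_le h.α₃_mem.1 h.α₃_mem.2.le h.α₄_mem.1 h.C₄_pos.le hx hx' ht hd) ν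
  rw [fluxGap, fluxGap, sub_apply, sub_apply, sub_sub_sub_comm]
  refine (norm_sub_le _ _).trans ((add_le_add h1 h2).trans (le_of_eq ?_))
  push_cast; ring

/-- A boundary point close to `y` at which the resolved flux is small. -/
theorem exists_small_flux (h : IsMatchedPair A₁ A₂ P μ α₂ α₃ α₄ C₂ C₃ C₄ κ K L₀ Λ ε T T₁ T₂)
    {w : ℝ} (hw : 0 < w) (hwΛ : 2 * w < Λ) {k : Fin m} (hk : k ∈ P.resolved) {y : E m}
    (hy : y ∈ P.cross) :
    ∃ z ∈ frontier P.cross, dist y z ≤ w + ε ∧ ∀ b ∈ Ioo (-P.L) P.L,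
      (∃ r : ℝ, deriv P.curve b = r • P.frame 0) → ∀ t ∈ Ioo T₁ T₂,
      ‖fluxGap A₁ A₂ (P.place b z, t) (P.frame k.succ)‖
        ≤ 4 * μ * C₄ * ε ^ α₄ + ε / w * ((m + 1) * (2 * (C₃ * C₄)) + 2 * μ * C₄) := by
  have hC₃ := h.C₃_pos
  have hC₄ := h.C₄_pos
  have hμ := h.μ_pos
  have hε := h.ε_pos
  have hμn : ‖(μ : ℂ)‖ = μ := by rw [Complex.norm_real, Real.norm_of_nonneg hμ.le]
  have hspec := h.thin.section_spec
  rw [Piece.resolved] at hk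
  split at hspec
  · -- nozzle: the extreme point in direction `k`
    have hne : (closure P.cross).Nonempty := ⟨y, subset_closure hy⟩
    obtain ⟨z, hz, hmax⟩ := hspec.bounded.isCompact_closure.exists_isMaxOn hne
      (f := fun x : E m => x k) (by fun_prop)
    have hdir : ∀ x : E m, inner ℝ (EuclideanSpace.single k (1 : ℝ)) x = x k := fun x => by
      simp [EuclideanSpace.inner_single_left]
    have hsn : ‖EuclideanSpace.single k (1 : ℝ)‖ = 1 := by simp
    have hdc := closure_dist_le hspec.dist_le
    have hzfr : z ∈ frontier P.cross := by
      rw [hspec.isOpen.frontier_eq]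
      refine ⟨hz, fun hmem => ?_⟩
      obtain ⟨c, hc, hcf⟩ := exists_exit hspec.isOpen hspec.bounded hmem
        (d := EuclideanSpace.single k (1 : ℝ)) (by simp)
      have := hmax (frontier_subset_closure hcf)
      simp at this
      linarith
    refine ⟨z, hzfr, ?_, ?_⟩
    · linarith [hdc y (subset_closure hy) z hz]
    rintro b hb ⟨r, hbr⟩ t ht
    have hid := h.extreme_identity hspec.isOpen hspec.lipschitz hb hbr hzfr ht one_pos
      (d := EuclideanSpace.single k (1 : ℝ)) (fun x hx _ => by
        rw [hdir, hdir]; exact hmax hx)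
    -- The chord in direction k is drawn through the interior point y, because the line through the
    -- extreme point z in this direction need not meet the section. The Hölder bound for `derivGap`
    -- transfers the estimate from an end of the chord to z at the cost of a second term 2 C₄ ε^α₄.
    obtain ⟨c, hc, hcf⟩ := exists_exit hspec.isOpen hspec.bounded hy
      (d := EuclideanSpace.single k (1 : ℝ)) (by simp)
    obtain ⟨c', hc', hcf'⟩ := exists_exit hspec.isOpen hspec.bounded hy
      (d := -EuclideanSpace.single k (1 : ℝ)) (by simp)
    set p := y + c • EuclideanSpace.single k (1 : ℝ) with hp
    have hpq : y + c' • -EuclideanSpace.single k (1 : ℝ)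
        = p + (-(c + c')) • EuclideanSpace.single k (1 : ℝ) := by rw [hp]; module
    rw [hpq] at hcf'
    have hcc : |-(c + c')| ≤ ε := by
      have h1 := hdc _ (frontier_subset_closure hcf') _ (frontier_subset_closure hcf)
      rwa [dist_eq_norm, add_sub_cancel_left, norm_smul, hsn, mul_one, Real.norm_eq_abs] at h1
    have hchord := h.norm_derivGap_chord_le hb ht hcf hsn (neg_ne_zero.2 (by positivity)) hcc hcf'
    have hhol := h.state.holder_deriv _ (h.mem_slab hb hz ht) _
      (h.mem_slab hb (frontier_subset_closure hcf) ht)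
    have hdist : dist (P.place b z, t) (P.place b p, t) ≤ ε := by
      rw [Prod.dist_eq, dist_self, max_eq_left dist_nonneg, P.place_eq, P.place_eq, dist_add_left,
        P.lift.dist_map]
      exact hdc z hz p (frontier_subset_closure hcf)
    rw [P.lift_single] at hid hchord
    have hnd : ‖(P.frame k.succ, (0 : ℝ))‖ = 1 := by
      rw [Prod.norm_def, P.norm_frame]; simp
    have hbound : ‖derivGap A₁ A₂ (P.place b z, t) (P.frame k.succ, 0)‖ ≤ 4 * C₄ * ε ^ α₄ := by
      have h1 : ‖(derivGap A₁ A₂ (P.place b z, t) - derivGap A₁ A₂ (P.place b p, t))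
          (P.frame k.succ, 0)‖ ≤ 2 * C₄ * ε ^ α₄ := by
        refine (ContinuousLinearMap.le_opNorm _ _).trans ?_
        rw [hnd, mul_one]
        refine hhol.trans ?_
        have := h.α₄_mem.1
        gcongr
      rw [sub_apply] at h1
      have h2 := norm_add_le (derivGap A₁ A₂ (P.place b z, t) (P.frame k.succ, 0)
        - derivGap A₁ A₂ (P.place b p, t) (P.frame k.succ, 0))
        (derivGap A₁ A₂ (P.place b p, t) (P.frame k.succ, 0))
      rw [sub_add_cancel] at h2
      linarith
    rw [hid, norm_mul, hμn]
    have h3 : 0 ≤ ε / w * ((m + 1) * (2 * (C₃ * C₄)) + 2 * μ * C₄) := by positivity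
    have h4 := mul_le_mul_of_nonneg_left hbound hμ.le
    linarith
  · -- slab: an extreme point of small mean slope
    rename_i i j hkind
    rw [hkind] at hk
    obtain rfl : k = j := hk
    -- Two points of S differ by at least Λ > 2w in the long coordinate, so one of them is farther
    -- than w from y in it. Convexity then gives a point at exactly w.
    obtain ⟨q, hq, hqy⟩ : ∃ q ∈ P.cross, |q i - y i| = w := by
      obtain ⟨p₁, hp₁, p₂, hp₂, hΛ⟩ := hspec.le_length
      obtain ⟨p, hp, hpw⟩ : ∃ p ∈ P.cross, w < |p i - y i| := by
        by_contra! hcon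
        have h1 := hcon p₁ hp₁
        have h2 := hcon p₂ hp₂
        have h3 := abs_sub_le (p₁ i) (y i) (p₂ i)
        rw [abs_sub_comm (y i)] at h3
        linarith
      have hpos : 0 < |p i - y i| := hw.trans hpw
      set s := w / |p i - y i| with hs
      have hs0 : 0 ≤ s := by positivity
      have hs1 : s ≤ 1 := by rw [hs, div_le_one hpos]; exact hpw.le
      refine ⟨(1 - s) • y + s • p, hspec.convex hy hp (by linarith) hs0 (by ring), ?_⟩
      have h1 : ((1 - s) • y + s • p) i - y i = s * (p i - y i) := by simp; ring
      rw [h1, abs_mul, abs_of_nonneg hs0, hs, div_mul_cancel₀ _ hpos.ne']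
    obtain ⟨z, hzfr, hzi, ⟨σ, ρ, hσ, hρ, hext⟩, c, hc, hcε, hcfr⟩ := exists_extreme_between
      hspec.convex hspec.isOpen hspec.bounded hspec.long_ne_thin hspec.eq_or_eq hspec.width_le
      hy hq hw hqy
    refine ⟨z, hzfr, ?_, ?_⟩
    · have h1 := hspec.dist_le y (subset_closure hy) z (frontier_subset_closure hzfr)
      rw [abs_sub_comm] at h1
      linarith
    rintro b hb ⟨r, hbr⟩ t ht
    have hid := h.extreme_identity hspec.isOpen hspec.lipschitz hb hbr hzfr ht hρ hext
    have hchord := h.norm_derivGap_chord_le hb ht hzfr (by simp) hc hcε hcfr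
    rw [P.lift_single] at hchord
    have hmem := h.mem_slab hb (frontier_subset_closure hzfr) ht
    have hpair : (P.frame k.succ - σ • P.frame i.succ, (0 : ℝ))
        = (P.frame k.succ, 0) - σ • (P.frame i.succ, (0 : ℝ)) := by simp
    rw [map_sub, map_smul, P.lift_single, P.lift_single, map_sub, map_smul, hpair, map_sub,
      map_smul] at hid
    have hF := h.norm_fluxGap_apply_le (ν := P.frame i.succ) hmem.1 hmem.2
    have hD : ‖derivGap A₁ A₂ (P.place b z, t) (P.frame i.succ, 0)‖ ≤ 2 * C₄ := by
      refine (ContinuousLinearMap.le_opNorm _ _).trans ?_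
      rw [Prod.norm_def, P.norm_frame]
      simpa using h.state.bound_deriv _ hmem
    rw [P.norm_frame, mul_one] at hF
    set F := fluxGap A₁ A₂ (P.place b z, t)
    set D := derivGap A₁ A₂ (P.place b z, t)
    -- The balance holds in the tilted direction. Solving it for direction k leaves an error
    -- proportional to the slope σ, for which the crude bounds on flux and derivative suffice.
    have hexp : F (P.frame k.succ) = μ * D (P.frame k.succ, 0)
        + σ • (F (P.frame i.succ) - μ * D (P.frame i.succ, 0)) := by
      simp only [Complex.real_smul] at hid ⊢
      linear_combination hid
    rw [hexp]
    refine (norm_add_le _ _).trans ?_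
    rw [norm_smul, norm_mul, hμn, Real.norm_eq_abs]
    have hlast : ‖F (P.frame i.succ) - μ * D (P.frame i.succ, 0)‖
        ≤ (m + 1) * (2 * (C₃ * C₄)) + 2 * μ * C₄ := by
      refine (norm_sub_le _ _).trans ?_
      rw [norm_mul, hμn]
      have := mul_le_mul_of_nonneg_left hD hμ.le
      linarith
    have h5 : μ * ‖D (P.frame k.succ, 0)‖ ≤ 4 * μ * C₄ * ε ^ α₄ := by
      have h6 := mul_le_mul_of_nonneg_left hchord hμ.le
      have h7 : 0 ≤ μ * C₄ * ε ^ α₄ := by positivity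
      linarith
    gcongr

theorem continuousOn_fluxGap
    (h : IsMatchedPair A₁ A₂ P μ α₂ α₃ α₄ C₂ C₃ C₄ κ K L₀ Λ ε T T₁ T₂) {x : E (m + 1)}
    (hx : x ∈ closure P.carrier) :
    ContinuousOn (fun t => fluxGap A₁ A₂ (x, t)) (Icc T₁ T₂) :=
  ((h.bounds₁.continuousOn_fluxForm h.α₃_mem.1 h.α₄_mem.1 h.C₄_pos.le).sub
    (h.bounds₂.continuousOn_fluxForm h.α₃_mem.1 h.α₄_mem.1 h.C₄_pos.le)).comp
    (by fun_prop) fun t ht => ⟨hx, h.mem_Icc ht⟩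

/-- A point of the piece is compared with a boundary point on the section over a nearby recurrent
parameter b. The displacement is at most K ε^l along the curve and w + ε across the section, and the
Hölder continuity of the flux pays for it. -/
theorem norm_fluxGap_le (h : IsMatchedPair A₁ A₂ P μ α₂ α₃ α₄ C₂ C₃ C₄ κ K L₀ Λ ε T T₁ T₂)
    {w l : ℝ} (hw : 0 < w) (hwΛ : 2 * w < Λ) (hl : ε ^ l ≤ L₀) (hsmall : K * ε ^ l + (w + ε) ≤ 1)
    (hrec : P.TangentsRecur ε l) {k : Fin m} (hk : k ∈ P.resolved) {x : E (m + 1)}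
    (hx : x ∈ P.carrier) {t : ℝ} (ht : t ∈ Icc T₁ T₂) :
    ‖fluxGap A₁ A₂ (x, t) (P.frame k.succ)‖
      ≤ (m + 1) * (6 * (C₃ * C₄) * (K * ε ^ l + (w + ε)) ^ α₃) + (4 * μ * C₄ * ε ^ α₄
        + ε / w * ((m + 1) * (2 * (C₃ * C₄)) + 2 * μ * C₄)) := by
  refine norm_le_on_Icc_of_Ioo (f := fun t => fluxGap A₁ A₂ (x, t) (P.frame k.succ)) h.T₁_lt_T₂
    ((h.continuousOn_fluxGap (subset_closure hx)).clm_apply continuousOn_const) ?_ t ht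
  clear ht t
  intro t ht
  obtain ⟨a, ha, y, hy, rfl⟩ := hx
  have hεl : 0 < ε ^ l := Real.rpow_pos_of_pos h.ε_pos l
  obtain ⟨b, hb, hab, hbr⟩ : ∃ b ∈ Ioo (-P.L) P.L, |b - a| ≤ ε ^ l ∧
      ∃ r : ℝ, deriv P.curve b = r • P.frame 0 := by
    have hL := h.thin.le_L
    -- The parameter window is laid from a towards the middle of the curve, where ε^l ≤ L₀
    -- guarantees that it fits.
    rcases le_total a 0 with h0 | h0
    · have hsub : Ioo a (a + ε ^ l) ⊆ Ioo (-P.L) P.L :=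
        Ioo_subset_Ioo ha.1.le (by linarith)
      obtain ⟨b, hb, hr⟩ := hrec a hsub
      exact ⟨b, hsub hb, by rw [abs_le]; constructor <;> linarith [hb.1, hb.2], hr⟩
    · have hsub : Ioo (a - ε ^ l) (a - ε ^ l + ε ^ l) ⊆ Ioo (-P.L) P.L :=
        Ioo_subset_Ioo (by linarith) (by linarith [ha.2])
      obtain ⟨b, hb, hr⟩ := hrec _ hsub
      exact ⟨b, hsub hb, by rw [abs_le]; constructor <;> linarith [hb.1, hb.2], hr⟩
  obtain ⟨z, hz, hyz, hflux⟩ := h.exists_small_flux hw hwΛ hk hy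
  have h1 := hflux b hb hbr t ht
  have hK := h.K_pos
  have hd : dist (P.place a y) (P.place b z) ≤ K * ε ^ l + (w + ε) := by
    refine (h.thin.norm_place_sub_le hb ha).trans ?_
    rw [abs_sub_comm]
    gcongr
  have h2 := h.norm_fluxGap_sub_apply_le (ν := P.frame k.succ)
    (subset_closure ⟨a, ha, y, hy, rfl⟩)
    (Piece.IsThin.place_mem_closure P hb (frontier_subset_closure hz))
    (h.mem_Icc (Ioo_subset_Icc_self ht)) (hd.trans hsmall)
  rw [P.norm_frame, mul_one] at h2
  have h3 : (m + 1) * (6 * (C₃ * C₄) * dist (P.place a y) (P.place b z) ^ α₃)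
      ≤ (m + 1) * (6 * (C₃ * C₄) * (K * ε ^ l + (w + ε)) ^ α₃) := by
    have := h.C₃_pos
    have := h.C₄_pos
    have := h.α₃_mem.1
    gcongr
  have h4 := norm_add_le (fluxGap A₁ A₂ (P.place a y, t) (P.frame k.succ)
    - fluxGap A₁ A₂ (P.place b z, t) (P.frame k.succ))
    (fluxGap A₁ A₂ (P.place b z, t) (P.frame k.succ))
  rw [sub_add_cancel] at h4
  linarith

end IsMatchedPair

/-! ### Exponents -/

theorem tendsto_rpow_nhdsGT_zero {e : ℝ} (he : 0 < e) :
    Filter.Tendsto (fun ε : ℝ => ε ^ e) (nhdsWithin 0 (Ioi 0)) (nhds 0) := by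
  have h := (Real.continuousAt_rpow_const 0 e (Or.inr he.le)).tendsto
  rw [Real.zero_rpow he.ne'] at h
  exact h.mono_left nhdsWithin_le_nhds

theorem eventually_mul_rpow_lt {e : ℝ} (he : 0 < e) (c : ℝ) {b : ℝ} (hb : 0 < b) :
    ∀ᶠ ε : ℝ in nhdsWithin 0 (Ioi 0), c * ε ^ e < b := by
  have h := (tendsto_rpow_nhdsGT_zero he).const_mul c
  rw [mul_zero] at h
  exact h.eventually (gt_mem_nhds hb)

theorem eventually_mul_rpow_le_rpow {e τ : ℝ} (he : τ < e) (c : ℝ) :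
    ∀ᶠ ε : ℝ in nhdsWithin 0 (Ioi 0), c * ε ^ e ≤ ε ^ τ := by
  filter_upwards [eventually_mul_rpow_lt (sub_pos.2 he) c one_pos, self_mem_nhdsWithin]
    with ε h1 (h2 : 0 < ε)
  have h3 : ε ^ e = ε ^ (e - τ) * ε ^ τ := by rw [← Real.rpow_add h2]; simp
  rw [h3, ← mul_assoc]
  exact mul_le_of_le_one_left (Real.rpow_nonneg h2.le _) h1.le

theorem eventually_le_one : ∀ᶠ ε : ℝ in nhdsWithin 0 (Ioi 0), ε ≤ 1 := by
  filter_upwards [eventually_mul_rpow_lt one_pos 1 one_pos] with ε h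
  simpa using h.le

theorem exists_forall_of_eventually {p : ℝ → Prop} (h : ∀ᶠ ε : ℝ in nhdsWithin 0 (Ioi 0), p ε) :
    ∃ ε₀ : ℝ, 0 < ε₀ ∧ ∀ ε : ℝ, 0 < ε → ε < ε₀ → p ε := by
  obtain ⟨ε₀, h0, hsub⟩ := mem_nhdsGT_iff_exists_Ioo_subset.1 h
  exact ⟨ε₀, h0, fun ε h1 h2 => hsub ⟨h1, h2⟩⟩

theorem tau_le_mul {a l : ℝ} (ha : 0 < a) : tau a l ≤ a * l := by
  unfold tau
  split_ifs with h1 h2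
  · exact le_rfl
  · rw [not_le, div_lt_iff₀ (by linarith)] at h1
    linarith
  · push Not at h2
    nlinarith

/-- As a function of l, the exponent rises until l = 1/(1+a) and falls afterwards; the bound is its
value at that peak. Since a = α₃α₄ < α₃, it lies strictly below α₃/(1+α₃), the exponent produced by
the slab argument. -/
theorem tau_le_div {a l : ℝ} (ha : 0 < a) (ha1 : a < 1) : tau a l ≤ a / (1 + a) := by
  unfold tau
  split_ifs with h1 h2
  · rw [le_div_iff₀ (by linarith)] at h1
    rw [le_div_iff₀ (by linarith)]
    nlinarith
  · rw [not_le, div_lt_iff₀ (by linarith)] at h1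
    rw [le_div_iff₀ (by linarith)]
    nlinarith
  · push Not at h2
    rw [le_div_iff₀ (by linarith)]
    nlinarith

theorem Setting.IsAdmissible.isMatchedPair {m : ℕ} (hm : m = 1 ∨ m = 2) {X : Setting m}
    {μ α₂ α₃ α₄ C₂ C₃ C₄ κ K L₀ Λ ε : ℝ}
    (h : X.IsAdmissible μ α₂ α₃ α₄ C₂ C₃ C₄ κ K L₀ Λ ε) (hμ : 0 < μ) (hα₂ : α₂ ∈ Ioo (0 : ℝ) 1)
    (hα₃ : α₃ ∈ Ioo (0 : ℝ) 1) (hα₄ : α₄ ∈ Ioo (0 : ℝ) 1) (hC₂ : 0 < C₂) (hC₃ : 0 < C₃)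
    (hC₄ : 0 < C₄) (hκ : 0 < κ) (hK : 0 < K) (hε : 0 < ε) (j : Fin X.count) :
    IsMatchedPair X.A₁ X.A₂ (X.piece j) μ α₂ α₃ α₄ C₂ C₃ C₄ κ K L₀ Λ ε X.T X.T₁ X.T₂ where
  planar := hm
  thin := h.thin j
  bounds₁ := h.bounds₁ j
  bounds₂ := h.bounds₂ j
  same := h.measurement j
  zero_le_T₁ := h.zero_le_T₁
  T₁_lt_T₂ := h.T₁_lt_T₂
  T₂_le_T := h.T₂_le_T
  μ_pos := hμ
  α₂_mem := hα₂
  α₃_mem := hα₃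
  α₄_mem := hα₄
  C₂_pos := hC₂
  C₃_pos := hC₃
  C₄_pos := hC₄
  κ_pos := hκ
  K_pos := hK
  ε_pos := hε

/-- What remains is to choose the width w as a power of ε and to compare exponents. Of the resulting
terms only 4μC₄ε^α₄ is kept with its constant; the others decay strictly faster than ε^τ. -/
theorem flux_estimate (m : ℕ) (hm : m = 1 ∨ m = 2) (μ : ℝ) (hμ : 0 < μ)
    (α₂ α₃ α₄ : ℝ) (hα₂ : α₂ ∈ Ioo (0 : ℝ) 1) (hα₃ : α₃ ∈ Ioo (0 : ℝ) 1)
    (hα₄ : α₄ ∈ Ioo (0 : ℝ) 1) (C₂ C₄ : ℝ) (hC₂ : 0 < C₂) (hC₄ : 0 < C₄) (l : ℝ) (hl : 0 < l) :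
    ∃ C : ℝ, 0 < C ∧ ∀ C₃ κ K L₀ Λ : ℝ, 0 < C₃ → 0 < κ → 0 < K → 0 < L₀ → 0 < Λ →
      ∃ ε₀ : ℝ, 0 < ε₀ ∧ ∀ ε : ℝ, 0 < ε → ε < ε₀ → ∀ X : Setting m,
        X.IsAdmissible μ α₂ α₃ α₄ C₂ C₃ C₄ κ K L₀ Λ ε →
        (∀ j, (X.piece j).TangentsRecur ε l) →
        ∀ j, ∀ k ∈ (X.piece j).resolved, ∀ x ∈ (X.piece j).carrier,
          ∀ t ∈ Icc X.T₁ X.T₂,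
            ‖rotated (X.piece j) k (X.A₁.c (x, t)) * X.A₁.u (x, t)
              - rotated (X.piece j) k (X.A₂.c (x, t)) * X.A₂.u (x, t)‖
              ≤ C * ε ^ tau (α₃ * α₄) l := by
  -- The summand 2 pays for the Hölder displacement term and the slope term, each of which is at
  -- most ε^τ once ε is small.
  refine ⟨4 * μ * C₄ + 2, by positivity, fun C₃ κ K L₀ Λ hC₃ hκ hK hL₀ hΛ => ?_⟩
  set τ := tau (α₃ * α₄) l with hτ
  have h3 := hα₃.1
  have h4 := hα₄.1
  have ha0 : 0 < α₃ * α₄ := mul_pos h3 h4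
  have ha3 : α₃ * α₄ < α₃ := mul_lt_of_lt_one_right h3 hα₄.2
  have ha4 : α₃ * α₄ < α₄ := mul_lt_of_lt_one_left h4 hα₃.2
  have ha1 : α₃ * α₄ < 1 := ha3.trans hα₃.2
  have hτl : τ < α₃ * l := (tau_le_mul ha0).trans_lt (by gcongr)
  have hτs : τ < α₃ / (1 + α₃) := by
    refine (tau_le_div ha0 ha1).trans_lt ?_
    rw [div_lt_div_iff₀ (by linarith) (by linarith)]
    linarith
  have hτ4 : τ ≤ α₄ := by
    refine (tau_le_div ha0 ha1).trans ((div_le_self ha0.le (by linarith)).trans ha4.le)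
  -- The width w = ε^v balances the displacement error w^α₃ against the slope error ε/w. Both have
  -- the exponent α₃/(1+α₃).
  set v := 1 / (1 + α₃) with hv
  have hv0 : 0 < v := by positivity
  have hv1 : v ≤ 1 := by rw [hv, div_le_one (by linarith)]; linarith
  set e := min l v with he
  have he0 : 0 < e := lt_min hl hv0
  have hτe : τ < e * α₃ := by
    rw [he, min_mul_of_nonneg _ _ h3.le]
    refine lt_min (by linarith) ?_
    rw [hv, one_div_mul_eq_div]; exact hτs
  refine exists_forall_of_eventually ?_
  filter_upwards [eventually_mul_rpow_lt hv0 2 hΛ, eventually_mul_rpow_lt hl 1 hL₀,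
    eventually_mul_rpow_lt he0 (K + 2) one_pos, eventually_le_one,
    eventually_mul_rpow_le_rpow hτe ((m + 1) * (6 * (C₃ * C₄)) * (K + 2) ^ α₃),
    eventually_mul_rpow_le_rpow hτs ((m + 1) * (2 * (C₃ * C₄)) + 2 * μ * C₄),
    self_mem_nhdsWithin] with ε hwΛ hεL hsmall hε1 hA hB (hε : 0 < ε)
  intro X hX hrec j k hk x hx t ht
  have hM := hX.isMatchedPair hm hμ hα₂ hα₃ hα₄ hC₂ hC₃ hC₄ hκ hK hε j
  have hsum : K * ε ^ l + (ε ^ v + ε) ≤ (K + 2) * ε ^ e := by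
    have e1 : ε ^ l ≤ ε ^ e := Real.rpow_le_rpow_of_exponent_ge hε hε1 (min_le_left _ _)
    have e2 : ε ^ v ≤ ε ^ e := Real.rpow_le_rpow_of_exponent_ge hε hε1 (min_le_right _ _)
    have e3 : ε ≤ ε ^ e := by
      have := Real.rpow_le_rpow_of_exponent_ge hε hε1 ((min_le_right l v).trans hv1)
      rwa [Real.rpow_one] at this
    have := mul_le_mul_of_nonneg_left e1 hK.le
    linarith
  have hest := hM.norm_fluxGap_le (w := ε ^ v) (l := l) (Real.rpow_pos_of_pos hε v) hwΛ
    (by linarith) (hsum.trans hsmall.le) (hrec j) hk hx ht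
  rw [rotated_flux_sub]
  refine hest.trans ?_
  have t1 : (m + 1) * (6 * (C₃ * C₄) * (K * ε ^ l + (ε ^ v + ε)) ^ α₃) ≤ ε ^ τ := by
    refine le_trans ?_ hA
    have : (K * ε ^ l + (ε ^ v + ε)) ^ α₃ ≤ (K + 2) ^ α₃ * ε ^ (e * α₃) := by
      rw [Real.rpow_mul hε.le, ← Real.mul_rpow (by positivity) (by positivity)]
      gcongr
    calc _ ≤ (m + 1) * (6 * (C₃ * C₄) * ((K + 2) ^ α₃ * ε ^ (e * α₃))) := by gcongr
      _ = _ := by ring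
  have t2 : 4 * μ * C₄ * ε ^ α₄ ≤ 4 * μ * C₄ * ε ^ τ := by
    have := Real.rpow_le_rpow_of_exponent_ge hε hε1 hτ4
    gcongr
  have t3 : ε / ε ^ v * ((m + 1) * (2 * (C₃ * C₄)) + 2 * μ * C₄) ≤ ε ^ τ := by
    refine le_trans (le_of_eq ?_) hB
    have : ε / ε ^ v = ε ^ (α₃ / (1 + α₃)) := by
      have h5 : α₃ / (1 + α₃) = 1 - v := by rw [hv]; field_simp; ring
      rw [h5, Real.rpow_sub hε, Real.rpow_one]
    rw [this]; ring
  linarith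

/-! ### Vanishing of the state gap to first order -/

/-- Zeros of u that approach p along the direction v force the derivative along v to vanish, by the
Taylor formula at p. A deviation of the zeros from the ray costs at most ‖Du p‖ times η after
division by c, so no curve inside the zero set is needed. -/
theorem C1HolderLE.apply_eq_zero_of_approx {V : Type*} [NormedAddCommGroup V] [NormedSpace ℝ V]
    {α M : ℝ} {s : Set V} {u : V → ℂ} {Du : V → V →L[ℝ] ℂ} (h : C1HolderLE α M s u Du)
    (hα : 0 < α) (hM : 0 ≤ M) {p v : V} (hp : p ∈ s) (h0 : u p = 0)
    (happ : ∀ η : ℝ, 0 < η → ∃ q ∈ s, ∃ c : ℝ, 0 < c ∧ c < η ∧ u q = 0 ∧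
      ‖q - p - c • v‖ ≤ η * c) : Du p v = 0 := by
  rw [← norm_le_zero_iff]
  have hlim : Filter.Tendsto (fun η : ℝ => M * (‖v‖ + 1) ^ (1 + α) * η ^ α + ‖Du p‖ * η)
      (nhdsWithin 0 (Ioi 0)) (nhds 0) := by
    have h1 := (tendsto_rpow_nhdsGT_zero hα).const_mul (M * (‖v‖ + 1) ^ (1 + α))
    have h2 : Filter.Tendsto (fun η : ℝ => ‖Du p‖ * η) (nhdsWithin 0 (Ioi 0)) (nhds 0) := by
      have : Filter.Tendsto (fun η : ℝ => ‖Du p‖ * η) (nhds 0) (nhds (‖Du p‖ * 0)) :=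
        Continuous.tendsto (by fun_prop) 0
      rw [mul_zero] at this
      exact this.mono_left nhdsWithin_le_nhds
    simpa using h1.add h2
  refine ge_of_tendsto hlim ?_
  filter_upwards [eventually_le_one, self_mem_nhdsWithin] with η hη1 (hη : 0 < η)
  obtain ⟨q, hq, c, hc, hcη, hq0, happ⟩ := happ η hη
  have h1 := h.norm_apply_le_of_eq_zero hp hq h0 hq0
  have hd : dist p q ≤ c * (‖v‖ + 1) := by
    rw [dist_comm, dist_eq_norm]
    have h2 := norm_add_le (q - p - c • v) (c • v)
    rw [sub_add_cancel, norm_smul, Real.norm_of_nonneg hc.le] at h2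
    nlinarith
  have h3 : ‖c • Du p v‖ ≤ M * (c * (‖v‖ + 1)) ^ (1 + α) + ‖Du p‖ * (η * c) := by
    have h4 : c • Du p v = Du p (q - p) - Du p (q - p - c • v) := by
      rw [← map_sub, ← map_smul]; congr 1; abel
    rw [h4]
    refine (norm_sub_le _ _).trans (add_le_add (h1.trans ?_) ?_)
    · gcongr
    · exact (ContinuousLinearMap.le_opNorm _ _).trans (by gcongr)
  have h5 : (c * (‖v‖ + 1)) ^ (1 + α) ≤ c * ((‖v‖ + 1) ^ (1 + α) * η ^ α) := by
    rw [Real.mul_rpow hc.le (by positivity), Real.rpow_add hc, Real.rpow_one]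
    have : c ^ α ≤ η ^ α := by gcongr
    calc c * c ^ α * (‖v‖ + 1) ^ (1 + α) ≤ c * η ^ α * (‖v‖ + 1) ^ (1 + α) := by gcongr
      _ = _ := by ring
  rw [norm_smul, Real.norm_of_nonneg hc.le] at h3
  have h6 := mul_le_mul_of_nonneg_left h5 hM
  have h7 : c * ‖Du p v‖ ≤ c * (M * (‖v‖ + 1) ^ (1 + α) * η ^ α + ‖Du p‖ * η) := by
    linarith
  exact le_of_mul_le_mul_left h7 hc

namespace IsMatchedPair

variable {m : ℕ} {A₁ A₂ : Params (m + 1)} {P : Piece m}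
  {μ α₂ α₃ α₄ C₂ C₃ C₄ κ K L₀ Λ ε T T₁ T₂ : ℝ}

theorem fluxGap_eq_zero (h : IsMatchedPair A₁ A₂ P μ α₂ α₃ α₄ C₂ C₃ C₄ κ K L₀ Λ ε T T₁ T₂)
    (hF : ∀ x ∈ P.carrier, ∀ t ∈ Icc T₁ T₂, A₁.flux (x, t) = A₂.flux (x, t)) {x : E (m + 1)}
    {t : ℝ} (hx : x ∈ closure P.carrier) (ht : t ∈ Icc T₁ T₂) : fluxGap A₁ A₂ (x, t) = 0 := by
  have hc : ContinuousOn (fun x => fluxGap A₁ A₂ (x, t)) (closure P.carrier) :=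
    ((h.bounds₁.continuousOn_fluxForm h.α₃_mem.1 h.α₄_mem.1 h.C₄_pos.le).sub
      (h.bounds₂.continuousOn_fluxForm h.α₃_mem.1 h.α₄_mem.1 h.C₄_pos.le)).comp
      (by fun_prop) fun x hx => ⟨hx, h.mem_Icc ht⟩
  have h1 := ((hc x hx).mono subset_closure).mem_closure_image hx
  have h2 : (fun x => fluxGap A₁ A₂ (x, t)) '' P.carrier ⊆ {0} := by
    rintro _ ⟨z, hz, rfl⟩
    simp [fluxGap, hF z hz t ht]
  have h3 := closure_minimal h2 isClosed_singleton h1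
  simpa using h3

theorem derivGap_time_eq_zero
    (h : IsMatchedPair A₁ A₂ P μ α₂ α₃ α₄ C₂ C₃ C₄ κ K L₀ Λ ε T T₁ T₂)
    {a t : ℝ} {y : E m} (ha : a ∈ Ioo (-P.L) P.L) (hy : y ∈ frontier P.cross)
    (ht : t ∈ Ioo T₁ T₂) : derivGap A₁ A₂ (P.place a y, t) (0, 1) = 0 := by
  refine h.state.apply_eq_zero_of_approx h.α₄_mem.1 (by linarith [h.C₄_pos])
    (h.mem_slab ha (frontier_subset_closure hy) ht) (h.stateGap_eq_zero ha hy ht) fun η hη => ?_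
  set c := min (η / 2) ((T₂ - t) / 2) with hc
  have hcpos : 0 < c := lt_min (by positivity) (by linarith [ht.2])
  have h1 : c ≤ η / 2 := min_le_left _ _
  have h2 : c ≤ (T₂ - t) / 2 := min_le_right _ _
  have ht' : t + c ∈ Ioo T₁ T₂ := ⟨by linarith [ht.1], by linarith [ht.2]⟩
  refine ⟨(P.place a y, t + c), h.mem_slab ha (frontier_subset_closure hy) ht', c, hcpos,
    by linarith, h.stateGap_eq_zero ha hy ht', ?_⟩
  have : ((P.place a y, t + c) : E (m + 1) × ℝ) - (P.place a y, t) - c • ((0 : E (m + 1)), (1 : ℝ))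
      = 0 := by simp
  rw [this, norm_zero]; positivity

/-- Displace the boundary point by a short vector c·τ with τ tangential. By the cone form of the
normal, a further step of length cη inward lands in the piece, and one of the same length outward
lands outside. Hence a boundary point, where the state gap vanishes, lies within cη of the displaced
point. -/
theorem derivGap_tangent_eq_zero
    (h : IsMatchedPair A₁ A₂ P μ α₂ α₃ α₄ C₂ C₃ C₄ κ K L₀ Λ ε T T₁ T₂) (hS : IsOpen P.cross)
    {a t : ℝ} {y : E m} (ha : a ∈ Ioo (-P.L) P.L) (hy : y ∈ frontier P.cross)
    (ht : t ∈ Ioo T₁ T₂) {ν τ : E (m + 1)} (hν : IsOutwardNormal P.carrier (P.place a y) ν)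
    (hτ : inner ℝ τ ν = 0) : derivGap A₁ A₂ (P.place a y, t) (τ, 0) = 0 := by
  refine h.state.apply_eq_zero_of_approx h.α₄_mem.1 (by linarith [h.C₄_pos])
    (h.mem_slab ha (frontier_subset_closure hy) ht) (h.stateGap_eq_zero ha hy ht) fun η hη => ?_
  set x := P.place a y with hx
  set B := ‖τ‖ + η + 1 with hB
  have hBpos : 0 < B := by positivity
  have hνν : inner ℝ ν ν = 1 := by rw [real_inner_self_eq_norm_sq, hν.1]; norm_num
  obtain ⟨r₁, hr₁, hhalf⟩ := hν.2 (η / B) (by positivity)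
  obtain ⟨r₂, hr₂, hloc⟩ := h.thin.exists_coordinates h.κ_pos h.K_pos ha one_pos
  set c := min (η / 2) (min r₁ r₂ / (2 * B)) with hc
  have hcpos : 0 < c := lt_min (by positivity) (by have := lt_min hr₁ hr₂; positivity)
  have hc1 : c ≤ η / 2 := min_le_left _ _
  have hc2 : c * B < min r₁ r₂ := by
    have h1 : c ≤ min r₁ r₂ / (2 * B) := min_le_right _ _
    rw [le_div_iff₀ (by positivity)] at h1
    have := lt_min hr₁ hr₂
    linarith
  let z : ℝ → E (m + 1) := fun s => x + c • τ + s • ν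
  have hzn : ∀ s, |s| ≤ c * η → dist (z s) x < c * B := by
    intro s hs
    have h1 : z s - x = c • τ + s • ν := by simp only [z]; abel
    rw [dist_eq_norm, h1]
    refine (norm_add_le _ _).trans_lt ?_
    rw [norm_smul, norm_smul, hν.1, Real.norm_of_nonneg hcpos.le, Real.norm_eq_abs, hB]
    nlinarith
  have hzi : ∀ s, inner ℝ (z s - x) ν = s := by
    intro s
    have h1 : z s - x = c • τ + s • ν := by simp only [z]; abel
    rw [h1, inner_add_left, inner_smul_left, inner_smul_left, hτ, hνν]; simp
  have hle : ∀ s, |s| ≤ c * η → η / B * ‖z s - x‖ < c * η := by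
    intro s hs
    have := hzn s hs
    rw [dist_eq_norm] at this
    calc η / B * ‖z s - x‖ < η / B * (c * B) := by gcongr
      _ = c * η := by field_simp
  have hcη : 0 < c * η := by positivity
  have hlow : z (-(c * η)) ∈ P.carrier := by
    have habs : |-(c * η)| ≤ c * η := by rw [abs_neg, abs_of_pos hcη]
    refine (hhalf _ ?_).1 ?_
    · rw [Metric.mem_ball]; exact (hzn _ habs).trans (hc2.trans_le (min_le_left _ _))
    · rw [hzi]; linarith [hle _ habs]
  have hhigh : z (c * η) ∉ P.carrier := by
    have habs : |c * η| ≤ c * η := by rw [abs_of_pos hcη]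
    refine (hhalf _ ?_).2 ?_
    · rw [Metric.mem_ball]; exact (hzn _ habs).trans (hc2.trans_le (min_le_left _ _))
    · rw [hzi]; exact hle _ habs
  have hcon : IsPreconnected (z '' Icc (-(c * η)) (c * η)) :=
    isPreconnected_Icc.image _ (by fun_prop)
  obtain ⟨_, ⟨s, hs, rfl⟩, hfr⟩ := inter_frontier_nonempty_of_isPreconnected
    (h.thin.isOpen_carrier h.κ_pos h.K_pos hS) hcon
    ⟨_, ⟨_, ⟨le_rfl, by linarith⟩, rfl⟩, hlow⟩ ⟨_, ⟨_, ⟨by linarith, le_rfl⟩, rfl⟩, hhigh⟩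
  have hsabs : |s| ≤ c * η := abs_le.2 hs
  obtain ⟨a', ha', y', hzp, _, _, _⟩ :=
    hloc y (z s) ((hzn s hsabs).trans (hc2.trans_le (min_le_right _ _)))
  rw [hzp] at hfr
  have hy' := h.thin.mem_frontier_cross_of_place h.κ_pos h.K_pos hS ha' hfr
  refine ⟨(P.place a' y', t), h.mem_slab ha' (frontier_subset_closure hy') ht, c, hcpos,
    by linarith, h.stateGap_eq_zero ha' hy' ht, ?_⟩
  have : ((P.place a' y', t) : E (m + 1) × ℝ) - (x, t) - c • (τ, (0 : ℝ)) = (s • ν, 0) := by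
    rw [← hzp]; simp [z]; abel
  rw [this, Prod.norm_def, norm_smul, hν.1, norm_zero, max_eq_left (by positivity), mul_one,
    Real.norm_eq_abs]
  linarith

/-- If the fluxes agree, the state gap vanishes to first order on the lateral boundary. -/
theorem derivGap_eq_zero (h : IsMatchedPair A₁ A₂ P μ α₂ α₃ α₄ C₂ C₃ C₄ κ K L₀ Λ ε T T₁ T₂)
    (hF : ∀ x ∈ P.carrier, ∀ t ∈ Icc T₁ T₂, A₁.flux (x, t) = A₂.flux (x, t))
    (hS : IsOpen P.cross) (hL : IsLipschitzDomain P.cross) {a t : ℝ} {y : E m}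
    (ha : a ∈ Ioo (-P.L) P.L) (hy : y ∈ frontier P.cross) (ht : t ∈ Ioo T₁ T₂) :
    derivGap A₁ A₂ (P.place a y, t) = 0 := by
  have hnormal : ∀ z ∈ frontier P.cross, ∀ ν, IsOutwardNormal P.cross z ν →
      derivGap A₁ A₂ (P.place a z, t) = 0 := by
    intro z hz ν hν
    obtain ⟨ξ, hn⟩ : ∃ ξ, IsOutwardNormal P.carrier (P.place a z) ξ :=
      ⟨_, (h.thin.isOutwardNormal h.κ_pos h.K_pos ha hν rfl).2⟩
    have hx : P.place a z ∈ P.lateral := ⟨a, ha, z, hz, rfl⟩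
    have h1 := h.normal_identity hx ht hn
    rw [h.fluxGap_eq_zero hF (Piece.IsThin.place_mem_closure P ha (frontier_subset_closure hz))
      (Ioo_subset_Icc_self ht)] at h1
    have hμ : (μ : ℂ) ≠ 0 := by exact_mod_cast h.μ_pos.ne'
    have h2 : derivGap A₁ A₂ (P.place a z, t) (ξ, 0) = 0 := by
      rw [zero_apply] at h1
      exact (mul_eq_zero.1 h1.symm).resolve_left hμ
    have hξξ : inner ℝ ξ ξ = 1 := by rw [real_inner_self_eq_norm_sq, hn.1]; norm_num
    -- Every space-time direction splits into a tangential part, a multiple of the normal and a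
    -- multiple of time. The derivative vanishes along each of them.
    refine ContinuousLinearMap.ext fun ⟨v, s⟩ => ?_
    have hsplit : ((v, s) : E (m + 1) × ℝ) = (v - inner ℝ v ξ • ξ, 0) + inner ℝ v ξ • (ξ, 0)
        + s • (0, 1) := by simp
    rw [hsplit, map_add, map_add, map_smul, map_smul, h2, h.derivGap_time_eq_zero ha hz ht,
      h.derivGap_tangent_eq_zero hS ha hz ht hn (by
        rw [inner_sub_left, inner_smul_left, hξξ]; simp)]
    simp
  rw [← norm_le_zero_iff]
  have hC₄ := h.C₄_pos
  have hlim : Filter.Tendsto (fun η : ℝ => 2 * C₄ * η ^ α₄) (nhdsWithin 0 (Ioi 0)) (nhds 0) := by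
    simpa using (tendsto_rpow_nhdsGT_zero h.α₄_mem.1).const_mul (2 * C₄)
  refine ge_of_tendsto hlim ?_
  filter_upwards [self_mem_nhdsWithin] with η (hη : 0 < η)
  -- Boundary points that possess a normal are dense, and the Hölder bound for `derivGap` reaches
  -- the others.
  obtain ⟨z, hz, hzd, ν, hν⟩ := hL.exists_isOutwardNormal_near h.planar hS hy hη
  have h1 := h.state.holder_deriv _ (h.mem_slab ha (frontier_subset_closure hy) ht) _
    (h.mem_slab ha (frontier_subset_closure hz) ht)
  rw [hnormal z hz ν hν, sub_zero, Prod.dist_eq, dist_self, max_eq_left dist_nonneg, P.place_eq,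
    P.place_eq, dist_add_left, P.lift.dist_map] at h1
  refine h1.trans ?_
  have := h.α₄_mem.1
  rw [dist_comm] at hzd
  gcongr

/-- Taylor expansion at a lateral boundary point, where both the state gap and its derivative are
zero. -/
theorem gap_le_of_near_lateral
    (h : IsMatchedPair A₁ A₂ P μ α₂ α₃ α₄ C₂ C₃ C₄ κ K L₀ Λ ε T T₁ T₂)
    (hF : ∀ x ∈ P.carrier, ∀ t ∈ Icc T₁ T₂, A₁.flux (x, t) = A₂.flux (x, t))
    (hS : IsOpen P.cross) (hL : IsLipschitzDomain P.cross) {x : E (m + 1)} {a t d : ℝ} {y : E m}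
    (ha : a ∈ Ioo (-P.L) P.L) (hy : y ∈ frontier P.cross) (ht : t ∈ Ioo T₁ T₂)
    (hx : x ∈ closure P.carrier) (hd : dist x (P.place a y) ≤ d) :
    ‖stateGap A₁ A₂ (x, t)‖ ≤ 2 * C₄ * d ^ (1 + α₄) ∧
      ‖derivGap A₁ A₂ (x, t)‖ ≤ 2 * C₄ * d ^ α₄ := by
  have hC₄ := h.C₄_pos
  have hα₄ := h.α₄_mem.1
  have hp := h.mem_slab ha (frontier_subset_closure hy) ht
  have hq : (x, t) ∈ closure P.carrier ×ˢ Icc 0 T := ⟨hx, hp.2⟩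
  have hdist : dist (P.place a y, t) (x, t) ≤ d := by
    rw [Prod.dist_eq, dist_self, max_eq_left dist_nonneg, dist_comm]; exact hd
  have hD := h.derivGap_eq_zero hF hS hL ha hy ht
  have h1 := h.state.taylor _ hp _ hq
  have h2 := h.state.holder_deriv _ hq _ hp
  rw [h.stateGap_eq_zero ha hy ht, hD, zero_apply, sub_zero, sub_zero] at h1
  rw [hD, sub_zero, dist_comm] at h2
  exact ⟨h1.trans (by gcongr), h2.trans (by gcongr)⟩

theorem gap_le (h : IsMatchedPair A₁ A₂ P μ α₂ α₃ α₄ C₂ C₃ C₄ κ K L₀ Λ ε T T₁ T₂)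
    (hF : ∀ x ∈ P.carrier, ∀ t ∈ Icc T₁ T₂, A₁.flux (x, t) = A₂.flux (x, t)) {i : Fin m}
    (hS : IsThinSection ε i P.cross) {x : E (m + 1)} {t : ℝ} (hx : x ∈ P.carrier)
    (ht : t ∈ Ioo T₁ T₂) :
    ‖stateGap A₁ A₂ (x, t)‖ ≤ 2 * C₄ * ε ^ (1 + α₄) ∧
      ‖derivGap A₁ A₂ (x, t)‖ ≤ 2 * C₄ * ε ^ α₄ := by
  obtain ⟨a, ha, y, hy, rfl⟩ := hx
  obtain ⟨z, hz, hyz⟩ := hS.exists_frontier y hy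
  refine h.gap_le_of_near_lateral hF hS.isOpen hS.lipschitz ha hz ht
    (subset_closure ⟨a, ha, y, hy, rfl⟩) ?_
  rwa [P.place_eq, P.place_eq, dist_add_left, P.lift.dist_map]

end IsMatchedPair

/-! ### Cutting off the lateral boundary -/

/-- The lateral boundary has dimension m, so balls of radius δ in number δ^(-m) cover a bounded
stretch of it, and their total volume in dimension m + 1 is O(δ). This exactly compensates a cutoff
gradient of order 1/δ. The constant may depend on the piece, because δ tends to 0 with the piece
held fixed. -/
theorem Piece.IsThin.exists_finset_cover_lateral {m : ℕ} (hm : m = 1 ∨ m = 2) {P : Piece m}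
    {κ K L₀ Λ ε : ℝ} (h : P.IsThin κ K L₀ Λ ε) (hK : 0 < K) (hS : IsOpen P.cross)
    (hb : Bornology.IsBounded P.cross) (hL : IsLipschitzDomain P.cross) {W : Set ℝ}
    (hW : Bornology.IsBounded W) (hWsub : W ⊆ Ioo (-P.L) P.L) :
    ∃ C : ℝ, 0 ≤ C ∧ ∀ δ : ℝ, 0 < δ → δ ≤ 1 → ∃ Z : Finset (E (m + 1)),
      (∀ z ∈ Z, ∃ a ∈ W, ∃ y ∈ frontier P.cross, z = P.place a y) ∧
      (Z.card : ℝ) ≤ C * (1 / δ) ^ m ∧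
      ∀ a ∈ W, ∀ y ∈ frontier P.cross, ∃ z ∈ Z, dist (P.place a y) z < δ := by
  classical
  obtain ⟨C, hC, hcov⟩ := hL.exists_finset_cover hm hS hb
  obtain ⟨R, hR⟩ := hW.exists_norm_le
  set R' := max R 0 with hR'
  have hR'0 : 0 ≤ R' := le_max_right _ _
  refine ⟨(4 * R' * K + 3) * (C * 2 ^ (m - 1)), by positivity, fun δ hδ hδ1 => ?_⟩
  obtain ⟨Y, hY1, hY2, hY3⟩ := hcov (δ / 2) (by positivity) (by linarith)
  obtain ⟨A, hA1, hA2, hA3⟩ := exists_finset_cover_of_dist_le (A := W) (σ := id) (R := R')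
    (M := 1) (δ := δ / (2 * K)) hR'0 one_pos (by positivity)
    (fun x hx => (hR x hx).trans (le_max_left _ _)) (fun x _ y _ => by rw [Real.dist_eq]; simp)
  refine ⟨(A ×ˢ Y).image fun p => P.place p.1 p.2, ?_, ?_, ?_⟩
  · intro z hz
    obtain ⟨⟨a, y⟩, hay, rfl⟩ := Finset.mem_image.1 hz
    rw [Finset.mem_product] at hay
    exact ⟨a, hA1 hay.1, y, hY1 hay.2, rfl⟩
  · have h1 : (((A ×ˢ Y).image fun p => P.place p.1 p.2).card : ℝ) ≤ A.card * Y.card := by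
      have := Finset.card_image_le (s := A ×ˢ Y) (f := fun p => P.place p.1 p.2)
      rw [Finset.card_product] at this
      exact_mod_cast this
    have hone : 1 ≤ 1 / δ := by rwa [le_div_iff₀ hδ, one_mul]
    have h2 : (A.card : ℝ) ≤ (4 * R' * K + 3) * (1 / δ) := by
      refine hA2.trans ?_
      have : 2 * (R' * 1 / (δ / (2 * K))) = 4 * R' * K * (1 / δ) := by field_simp; ring
      rw [this, add_mul]; linarith
    have h3 : (Y.card : ℝ) ≤ C * 2 ^ (m - 1) * (1 / δ) ^ (m - 1) := by
      refine hY2.trans (le_of_eq ?_)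
      rw [mul_assoc, ← mul_pow]; congr 2; field_simp
    refine h1.trans ((mul_le_mul h2 h3 (by positivity) (by positivity)).trans (le_of_eq ?_))
    have h4 : (1 / δ) ^ m = (1 / δ) * (1 / δ) ^ (m - 1) := by
      rw [← pow_succ']; congr 1; omega
    rw [h4]; ring
  · intro a ha y hy
    obtain ⟨a', ha', hd⟩ := hA3 a ha
    obtain ⟨y', hy', hd'⟩ := hY3 y hy
    refine ⟨P.place a' y', Finset.mem_image.2 ⟨(a', y'), Finset.mem_product.2 ⟨ha', hy'⟩, rfl⟩, ?_⟩
    have h1 := h.norm_place_sub_le (y := y') (z := y) (hWsub (hA1 ha')) (hWsub ha)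
    rw [Real.dist_eq] at hd
    have h2 : K * |a - a'| < δ / 2 := by
      rw [lt_div_iff₀ (by positivity)] at hd; linarith
    linarith

/-- The number of the balls of radius `2 δ` about the points of `Z` that contain `x`. -/
def ballCount {n : ℕ} (Z : Finset (E n)) (δ : ℝ) (x : E n) : ℝ :=
  ∑ z ∈ Z, (Metric.closedBall z (2 * δ)).indicator (fun _ => (1 : ℝ)) x

theorem ballCount_nonneg {n : ℕ} (Z : Finset (E n)) (δ : ℝ) (x : E n) : 0 ≤ ballCount Z δ x :=
  Finset.sum_nonneg fun _ _ => indicator_nonneg (fun _ _ => zero_le_one) _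

theorem ballCount_eq_zero {n : ℕ} {Z : Finset (E n)} {δ : ℝ} {x : E n}
    (h : ∀ z ∈ Z, 2 * δ < dist x z) : ballCount Z δ x = 0 := by
  refine Finset.sum_eq_zero fun z hz => indicator_of_notMem ?_ _
  rw [Metric.mem_closedBall, not_le]; exact h z hz

theorem integrable_ballCount {n : ℕ} (Z : Finset (E n)) (δ : ℝ) : Integrable (ballCount Z δ) := by
  refine integrable_finsetSum _ fun z _ => ?_
  refine (integrable_indicator_iff Metric.isClosed_closedBall.measurableSet).2 ?_
  exact integrableOn_const (isCompact_closedBall z (2 * δ)).measure_lt_top.ne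

theorem integral_ballCount {n : ℕ} (Z : Finset (E n)) {δ : ℝ} (hδ : 0 < δ) :
    ∫ x, ballCount Z δ x =
      Z.card * ((2 * δ) ^ n * (volume (Metric.closedBall (0 : E n) 1)).toReal) := by
  unfold ballCount
  rw [integral_finsetSum]
  · rw [Finset.sum_congr rfl (g := fun _ =>
      (2 * δ) ^ n * (volume (Metric.closedBall (0 : E n) 1)).toReal)]
    · simp
    · intro z _
      rw [integral_indicator_const _ Metric.isClosed_closedBall.measurableSet, smul_eq_mul, mul_one,
        measureReal_def, Measure.addHaar_closedBall' _ _ (by positivity),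
        finrank_euclideanSpace_fin, ENNReal.toReal_mul, ENNReal.toReal_ofReal (by positivity)]
  · intro z _
    refine (integrable_indicator_iff Metric.isClosed_closedBall.measurableSet).2 ?_
    exact integrableOn_const (isCompact_closedBall z (2 * δ)).measure_lt_top.ne

/-- Smooth functions that vanish near `Z`, at scale `δ`. -/
theorem exists_cutoff (n : ℕ) : ∃ B : ℝ, 0 ≤ B ∧ ∀ (Z : Finset (E n)) (δ : ℝ), 0 < δ →
    ∃ χ : E n → ℝ, ContDiff ℝ ∞ χ ∧ (∀ x, 0 ≤ χ x ∧ χ x ≤ 1) ∧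
      (∀ x, (∃ z ∈ Z, dist x z < δ) → χ x = 0) ∧
      (∀ x, 1 - ballCount Z δ x ≤ χ x) ∧ ∀ x, ‖fderiv ℝ χ x‖ ≤ B / δ * ballCount Z δ x := by
  classical
  let f : ContDiffBump (0 : E n) := ⟨1, 2, one_pos, one_lt_two⟩
  have hfc : ContDiff ℝ ∞ f := f.contDiff
  obtain ⟨B, hB⟩ := (hfc.continuous_fderiv (by simp)).bounded_above_of_compact_support
    (f.hasCompactSupport.fderiv ℝ)
  have hB0 : 0 ≤ B := (norm_nonneg _).trans (hB 0)
  refine ⟨B, hB0, fun Z δ hδ => ?_⟩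
  let β : E n → E n → ℝ := fun z x => f (δ⁻¹ • (x - z))
  have hβc : ∀ z, ContDiff ℝ ∞ (β z) := fun z => hfc.comp (by fun_prop)
  have hnorm : ∀ x z : E n, ‖δ⁻¹ • (x - z)‖ = dist x z / δ := fun x z => by
    rw [norm_smul, norm_inv, Real.norm_of_nonneg hδ.le, dist_eq_norm]; field_simp
  have hβ01 : ∀ z x, 0 ≤ β z x ∧ β z x ≤ 1 := fun z x => ⟨f.nonneg, f.le_one⟩
  have hβone : ∀ z x, dist x z < δ → β z x = 1 := fun z x hx => by
    refine f.one_of_mem_closedBall ?_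
    rw [mem_closedBall_zero_iff, hnorm]
    show dist x z / δ ≤ 1
    rw [div_le_one hδ]; exact hx.le
  have hβzero : ∀ z x, 2 * δ < dist x z → β z x = 0 := fun z x hx => by
    refine f.zero_of_le_dist ?_
    rw [dist_zero_right, hnorm]
    show 2 ≤ dist x z / δ
    rw [le_div_iff₀ hδ]; exact hx.le
  have hβle : ∀ z x, β z x ≤ (Metric.closedBall z (2 * δ)).indicator (fun _ => (1 : ℝ)) x := by
    intro z x
    by_cases hx : x ∈ Metric.closedBall z (2 * δ)
    · rw [indicator_of_mem hx]; exact (hβ01 z x).2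
    · rw [indicator_of_notMem hx]
      rw [Metric.mem_closedBall, not_le] at hx
      exact (hβzero z x hx).le
  have hβd : ∀ z x, ‖fderiv ℝ (β z) x‖ ≤
      B / δ * (Metric.closedBall z (2 * δ)).indicator (fun _ => (1 : ℝ)) x := by
    intro z x
    by_cases hx : x ∈ Metric.closedBall z (2 * δ)
    · rw [indicator_of_mem hx, mul_one]
      have hg : HasFDerivAt (fun x : E n => δ⁻¹ • (x - z)) (δ⁻¹ • ContinuousLinearMap.id ℝ (E n)) x :=
        ((hasFDerivAt_id x).sub_const z).const_smul δ⁻¹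
      have hcomp : HasFDerivAt (β z) ((fderiv ℝ f (δ⁻¹ • (x - z))).comp
          (δ⁻¹ • ContinuousLinearMap.id ℝ (E n))) x :=
        ((hfc.differentiable (by simp)) _).hasFDerivAt.comp x hg
      rw [hcomp.fderiv, ContinuousLinearMap.comp_smul, norm_smul, ContinuousLinearMap.comp_id,
        norm_inv, Real.norm_of_nonneg hδ.le, div_eq_inv_mul]
      gcongr
      exact hB _
    · rw [indicator_of_notMem hx, mul_zero]
      rw [Metric.mem_closedBall, not_le] at hx
      have : β z =ᶠ[nhds x] fun _ => 0 := by
        filter_upwards [(isOpen_lt continuous_const (continuous_id.dist continuous_const)).mem_nhds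
          (show 2 * δ < dist x z from hx)] with x' hx'
        exact hβzero z x' hx'
      rw [this.fderiv_eq]; simp
  -- A product of factors 1 - β_z with values in [0, 1] falls short of 1 by at most the sum of the
  -- β_z. The norm of its gradient is at most the sum of the norms of theirs.
  refine ⟨fun x => ∏ z ∈ Z, (1 - β z x), ?_, ?_, ?_, ?_, ?_⟩
  · exact contDiff_prod fun z _ => contDiff_const.sub (hβc z)
  · exact fun x => ⟨Finset.prod_nonneg fun z _ => by linarith [(hβ01 z x).2],
      Finset.prod_le_one (fun z _ => by linarith [(hβ01 z x).2])
        fun z _ => by linarith [(hβ01 z x).1]⟩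
  · rintro x ⟨z, hz, hd⟩
    exact Finset.prod_eq_zero hz (by rw [hβone z x hd, sub_self])
  · intro x
    unfold ballCount
    induction Z using Finset.induction_on with
    | empty => simp
    | insert z Z hz ih =>
      beta_reduce at ih ⊢
      rw [Finset.prod_insert hz, Finset.sum_insert hz]
      have h1 := hβle z x
      have h2 := hβ01 z x
      have h3 : 0 ≤ ∏ z ∈ Z, (1 - β z x) :=
        Finset.prod_nonneg fun z _ => by linarith [(hβ01 z x).2]
      have h4 : ∏ z ∈ Z, (1 - β z x) ≤ 1 := Finset.prod_le_one
        (fun z _ => by linarith [(hβ01 z x).2]) fun z _ => by linarith [(hβ01 z x).1]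
      nlinarith
  · intro x
    unfold ballCount
    induction Z using Finset.induction_on with
    | empty => simp
    | insert z Z hz ih =>
      have hd1 : DifferentiableAt ℝ (fun x => 1 - β z x) x :=
        ((contDiff_const.sub (hβc z)).differentiable (by simp)) x
      have hd2 : DifferentiableAt ℝ (fun x => ∏ z ∈ Z, (1 - β z x)) x :=
        ((contDiff_prod fun z _ => contDiff_const.sub (hβc z)).differentiable
          (n := ∞) (by simp)) x
      simp only [Finset.prod_insert hz]
      rw [Finset.sum_insert hz, mul_add, fderiv_fun_mul hd1 hd2, fderiv_const_sub]
      have h2 := hβ01 z x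
      have h3 : 0 ≤ ∏ z ∈ Z, (1 - β z x) :=
        Finset.prod_nonneg fun z _ => by linarith [(hβ01 z x).2]
      have h4 : ∏ z ∈ Z, (1 - β z x) ≤ 1 := Finset.prod_le_one
        (fun z _ => by linarith [(hβ01 z x).2]) fun z _ => by linarith [(hβ01 z x).1]
      refine (norm_add_le _ _).trans ?_
      rw [norm_smul, norm_smul, norm_neg, Real.norm_of_nonneg h3,
        Real.norm_of_nonneg (by linarith), add_comm]
      refine add_le_add ?_ ?_
      · exact (mul_le_of_le_one_left (norm_nonneg _) h4).trans (hβd z x)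
      · exact (mul_le_of_le_one_left (norm_nonneg _) (by linarith)).trans ih

/-- Scaled bump functions on the line. -/
theorem exists_bump : ∃ B : ℝ, 0 ≤ B ∧ ∀ s r : ℝ, 0 < r → ∃ f : ℝ → ℝ, ContDiff ℝ ∞ f ∧
    (∀ x, 0 ≤ f x ∧ f x ≤ 1) ∧ (∀ x, |x - s| ≤ r / 2 → f x = 1) ∧
    tsupport f ⊆ {x | |x - s| < r} ∧ HasCompactSupport f ∧
    ∀ x, |deriv (deriv f) x| ≤ B / r ^ 2 := by
  -- The outer radius 3/4 stays below 1, so that even the closed support lies in the open interval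
  -- of radius r.
  let f : ContDiffBump (0 : ℝ) := ⟨1 / 2, 3 / 4, by norm_num, by norm_num⟩
  have hfc : ContDiff ℝ ∞ f := f.contDiff
  have hd1 : ContDiff ℝ ∞ (deriv f) := (contDiff_infty_iff_deriv.1 hfc).2
  have hd2 : ContDiff ℝ ∞ (deriv (deriv f)) := (contDiff_infty_iff_deriv.1 hd1).2
  obtain ⟨B, hB⟩ := hd2.continuous.bounded_above_of_compact_support
    (f.hasCompactSupport.deriv.deriv)
  refine ⟨B, (norm_nonneg _).trans (hB 0), fun s r hr => ?_⟩
  have habs : ∀ x, ‖r⁻¹ * (x - s)‖ = |x - s| / r := fun x => by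
    rw [norm_mul, norm_inv, Real.norm_of_nonneg hr.le, Real.norm_eq_abs]; field_simp
  have hzero : ∀ x, 3 / 4 * r ≤ |x - s| → f (r⁻¹ * (x - s)) = 0 := fun x hx => by
    refine f.zero_of_le_dist ?_
    rw [dist_zero_right, habs]
    show 3 / 4 ≤ |x - s| / r
    rw [le_div_iff₀ hr]; exact hx
  have hts : tsupport (fun x => f (r⁻¹ * (x - s))) ⊆ {x | |x - s| ≤ 3 / 4 * r} := by
    refine closure_minimal ?_ (isClosed_le (by fun_prop) continuous_const)
    intro x hx
    by_contra hcon
    rw [mem_ofPred_eq, not_le] at hcon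
    exact hx (hzero x hcon.le)
  refine ⟨fun x => f (r⁻¹ * (x - s)), hfc.comp (by fun_prop), fun x => ⟨f.nonneg, f.le_one⟩,
    fun x hx => ?_, ?_, ?_, fun x => ?_⟩
  · refine f.one_of_mem_closedBall ?_
    rw [mem_closedBall_zero_iff, habs]
    show |x - s| / r ≤ 1 / 2
    rw [div_le_iff₀ hr]; linarith
  · refine hts.trans fun x hx => ?_
    rw [mem_ofPred_eq] at hx ⊢
    linarith
  · refine HasCompactSupport.of_support_subset_isCompact (isCompact_closedBall s (3 / 4 * r)) ?_
    intro x hx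
    have := hts (subset_tsupport _ hx)
    rwa [Metric.mem_closedBall, Real.dist_eq]
  · have hlin : ∀ x, HasDerivAt (fun x => r⁻¹ * (x - s)) r⁻¹ x := fun x => by
      simpa using ((hasDerivAt_id x).sub_const s).const_mul r⁻¹
    have e1 : deriv (fun x => f (r⁻¹ * (x - s))) = fun x => deriv f (r⁻¹ * (x - s)) * r⁻¹ := by
      ext x
      exact (((hfc.differentiable (by simp)) _).hasDerivAt.comp x (hlin x)).deriv
    have e2 : deriv (fun x => deriv f (r⁻¹ * (x - s)) * r⁻¹) x
        = deriv (deriv f) (r⁻¹ * (x - s)) * r⁻¹ * r⁻¹ :=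
      ((((hd1.differentiable (by simp)) _).hasDerivAt.comp x (hlin x)).mul_const r⁻¹).deriv
    rw [e1, e2, abs_mul, abs_mul, abs_of_pos (inv_pos.2 hr)]
    have := hB (r⁻¹ * (x - s))
    rw [Real.norm_eq_abs] at this
    calc _ ≤ B * r⁻¹ * r⁻¹ := by gcongr
      _ = B / r ^ 2 := by field_simp

/-! ### Volumes -/

namespace Piece

variable {m : ℕ}

theorem measurePreserving_coordinates (P : Piece m) :
    MeasurePreserving (fun x : E (m + 1) => (inner ℝ x (P.frame 0), P.trans x)) := by
  have h1 := P.frame.measurePreserving_repr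
  have h2 := PiLp.volume_preserving_ofLp (Fin (m + 1))
  have h3 := volume_preserving_piFinSuccAbove (fun _ : Fin (m + 1) => ℝ) 0
  have h4 := (MeasurePreserving.id (volume : Measure ℝ)).prod (PiLp.volume_preserving_toLp (Fin m))
  have h5 := h4.comp (h3.comp (h2.comp h1))
  have hfun : (fun x : E (m + 1) => (inner ℝ x (P.frame 0), P.trans x)) =
      Prod.map id (WithLp.toLp 2) ∘ MeasurableEquiv.piFinSuccAbove (fun _ : Fin (m + 1) => ℝ) 0 ∘
        WithLp.ofLp ∘ P.frame.repr := by
    ext1 x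
    refine Prod.ext ?_ ?_
    · simp [MeasurableEquiv.piFinSuccAbove, P.frame.repr_apply_apply, real_inner_comm]
    · ext k
      simp [MeasurableEquiv.piFinSuccAbove, P.frame.repr_apply_apply, trans_apply,
        Fin.tail, real_inner_comm]
  rw [hfun]
  exact h5

/-- The part of a piece over a height interval and over a part of the cross-section. -/
def cell (P : Piece m) (s r : ℝ) (A : Set (E m)) : Set (E (m + 1)) :=
  {x | ∃ a ∈ {a | a ∈ Ioo (-P.L) P.L ∧ |P.height a - s| < r}, ∃ y ∈ A, x = P.place a y}

namespace IsThin

variable {P : Piece m} {κ K L₀ Λ ε : ℝ}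

theorem isOpen_cell (h : P.IsThin κ K L₀ Λ ε) (hκ : 0 < κ) (hK : 0 < K) (s r : ℝ) {A : Set (E m)}
    (hA : IsOpen A) : IsOpen (P.cell s r A) := by
  refine h.isOpen_swept hκ hK ?_ (fun a ha => ha.1) hA
  have hc : ContinuousOn (fun a => |P.height a - s|) (Ioo (-P.L) P.L) := fun a ha =>
    (((h.hasDerivAt_height ha).continuousAt.sub continuousAt_const).abs).continuousWithinAt
  exact hc.isOpen_inter_preimage isOpen_Ioo isOpen_Iio

/-- Cavalieri's principle. In orthonormal coordinates the slice at each height is a translate of A,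
since the curve meets each height exactly once; r ≤ κρ ensures that every height in question is
attained inside the window. -/
theorem volume_cell (h : P.IsThin κ K L₀ Λ ε) (hκ : 0 < κ) (hK : 0 < K) {a₁ ρ r : ℝ}
    (hsub : Icc (a₁ - ρ) (a₁ + ρ) ⊆ Ioo (-P.L) P.L) (hρ : 0 ≤ ρ) (hr : r ≤ κ * ρ) {A : Set (E m)}
    (hA : IsOpen A) : volume (P.cell (P.height a₁) r A) = ENNReal.ofReal (2 * r) * volume A := by
  set D := P.cell (P.height a₁) r A with hD
  have hDo : IsOpen D := h.isOpen_cell hκ hK _ _ hA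
  let recon : ℝ × E m → E (m + 1) := fun q => q.1 • P.frame 0 + P.lift q.2
  have hrc : Continuous recon := by have := P.lift.continuous; fun_prop
  have hD'o : IsOpen (recon ⁻¹' D) := hDo.preimage hrc
  have hpre : (fun x : E (m + 1) => (inner ℝ x (P.frame 0), P.trans x)) ⁻¹' (recon ⁻¹' D) = D := by
    ext x
    simp only [mem_preimage, recon]
    rw [← P.decomp x]
  rw [← hpre, P.measurePreserving_coordinates.measure_preimage hD'o.measurableSet.nullMeasurableSet,
    Measure.volume_eq_prod, Measure.prod_apply hD'o.measurableSet]
  have hslice : ∀ s, volume (Prod.mk s ⁻¹' (recon ⁻¹' D)) =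
      (Ioo (P.height a₁ - r) (P.height a₁ + r)).indicator (fun _ => volume A) s := by
    intro s
    have hmem : s ∈ Ioo (P.height a₁ - r) (P.height a₁ + r) ↔ |s - P.height a₁| < r := by
      rw [mem_Ioo, abs_lt]
      constructor <;> rintro ⟨h1, h2⟩ <;> constructor <;> linarith
    have hheight : ∀ z, inner ℝ (recon (s, z)) (P.frame 0) = s := by
      intro z
      simp only [recon]
      rw [inner_add_left, inner_smul_left, inner_lift_frame_zero, real_inner_self_eq_norm_sq,
        P.norm_frame]
      simp
    by_cases hs : |s - P.height a₁| < r
    · rw [indicator_of_mem (hmem.2 hs)]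
      obtain ⟨a, ha, has⟩ := h.exists_height_eq hρ hsub (hs.le.trans hr)
      have hcurve : P.curve a = s • P.frame 0 + P.lift (P.trans (P.curve a)) := by
        have := P.decomp (P.curve a)
        rwa [show inner ℝ (P.curve a) (P.frame 0) = s from has] at this
      have : Prod.mk s ⁻¹' (recon ⁻¹' D) = (fun z => -P.trans (P.curve a) + z) ⁻¹' A := by
        ext z
        simp only [mem_preimage]
        constructor
        · rintro ⟨b, hb, y, hy, heq⟩
          have hab : b = a := h.height_injOn hκ hb.1 (hsub ha) (by
            rw [has, ← P.inner_place_frame_zero b y, ← heq, hheight])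
          subst hab
          have h1 : P.lift z = P.lift (P.trans (P.curve b) + y) := by
            have h2 : s • P.frame 0 + P.lift z = P.curve b + P.lift y := heq
            rw [hcurve] at h2
            rw [map_add]
            rw [add_assoc] at h2
            exact add_left_cancel h2
          rw [P.lift.injective h1]
          simpa using hy
        · intro hz
          refine ⟨a, ⟨hsub ha, by rwa [has]⟩, _, hz, ?_⟩
          rw [place_eq, map_add, map_neg]
          nth_rewrite 1 [hcurve]
          simp only [recon]
          abel
      rw [this, measure_preimage_add]
    · rw [indicator_of_notMem (fun hc => hs (hmem.1 hc))]
      have : Prod.mk s ⁻¹' (recon ⁻¹' D) = ∅ := by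
        ext z
        simp only [mem_preimage, mem_empty_iff_false, iff_false]
        rintro ⟨b, hb, y, hy, heq⟩
        have h1 : P.height b = s := by
          rw [← P.inner_place_frame_zero b y, ← heq, hheight]
        exact hs (h1 ▸ hb.2)
      rw [this, measure_empty]
  simp_rw [hslice]
  rw [lintegral_indicator measurableSet_Ioo, setLIntegral_const, Real.volume_Ioo, mul_comm]
  congr 2
  ring

end IsThin

end Piece

/-! ### Test functions and the weak formulation -/

/-- The condition at outside points makes the truncated function vanish in a neighbourhood of each
of them. Truncation to N then creates no singularity on the boundary, and the support stays inside
N. -/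
theorem contDiff_indicator {n : ℕ} {N : Set (E n)} (hN : IsOpen N) {g : E n → ℝ}
    (hg : ContDiff ℝ ∞ g) (hz : ∀ x ∉ N, ∀ᶠ z in nhds x, z ∈ N → g z = 0) :
    ContDiff ℝ ∞ (N.indicator g) ∧ tsupport (N.indicator g) ⊆ N ∧
      ∀ x, fderiv ℝ (N.indicator g) x = N.indicator (fderiv ℝ g) x := by
  have hin : ∀ x ∈ N, N.indicator g =ᶠ[nhds x] g := fun x hx => by
    filter_upwards [hN.mem_nhds hx] with z hz using indicator_of_mem hz _
  have hout : ∀ x ∉ N, N.indicator g =ᶠ[nhds x] fun _ => 0 := fun x hx => by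
    filter_upwards [hz x hx] with z hz
    by_cases hzN : z ∈ N
    · rw [indicator_of_mem hzN, hz hzN]
    · exact indicator_of_notMem hzN _
  refine ⟨contDiff_iff_contDiffAt.2 fun x => ?_, fun x hx => ?_, fun x => ?_⟩
  · by_cases hx : x ∈ N
    · exact hg.contDiffAt.congr_of_eventuallyEq (hin x hx)
    · exact contDiffAt_const.congr_of_eventuallyEq (hout x hx)
  · by_contra hxN
    exact (notMem_tsupport_iff_eventuallyEq.2 (hout x hxN)) hx
  · by_cases hx : x ∈ N
    · rw [(hin x hx).fderiv_eq, indicator_of_mem hx]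
    · rw [(hout x hx).fderiv_eq, indicator_of_notMem hx]; simp

theorem integrable_mul_of_tsupport_subset {V : Type*} [NormedAddCommGroup V] [MeasurableSpace V]
    [OpensMeasurableSpace V] {ν : Measure V} [IsFiniteMeasureOnCompacts ν] {O : Set V}
    (hO : IsOpen O) {f ψ : V → ℂ} (hf : ContinuousOn f O) (hψ : Continuous ψ)
    (hc : HasCompactSupport ψ) (hsub : tsupport ψ ⊆ O) : Integrable (fun p => f p * ψ p) ν := by
  refine Continuous.integrable_of_hasCompactSupport ?_ hc.mul_left
  rw [continuous_iff_continuousAt]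
  intro p
  by_cases hp : p ∈ O
  · exact (hf.continuousAt (hO.mem_nhds hp)).mul hψ.continuousAt
  · have h1 : ψ =ᶠ[nhds p] 0 := notMem_tsupport_iff_eventuallyEq.1 fun h => hp (hsub h)
    have h2 : (fun p => f p * ψ p) =ᶠ[nhds p] fun _ => 0 := by
      filter_upwards [h1] with q hq
      simp [hq]
    exact continuousAt_const.congr h2.symm

/-- A smooth compactly supported function on `O`. -/
structure IsTest {V : Type*} [NormedAddCommGroup V] [NormedSpace ℝ V] (O : Set V) (φ : V → ℝ) :
    Prop where
  contDiff : ContDiff ℝ ∞ φ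
  compact : HasCompactSupport φ
  tsupport_subset : tsupport φ ⊆ O

namespace IsTest

variable {V : Type*} [NormedAddCommGroup V] [NormedSpace ℝ V] {O : Set V} {φ : V → ℝ}

theorem ofReal_tsupport_subset (h : IsTest O φ) : tsupport (fun p => (φ p : ℂ)) ⊆ O := by
  refine Subset.trans (closure_mono fun p hp => ?_) h.tsupport_subset
  exact fun h0 => hp (by simp [h0])

theorem ofReal_compact (h : IsTest O φ) : HasCompactSupport (fun p => (φ p : ℂ)) :=
  h.compact.comp_left (g := fun x : ℝ => (x : ℂ)) (by simp)

theorem fderiv_apply (h : IsTest O φ) (v : V) : IsTest O fun p => fderiv ℝ φ p v where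
  contDiff := (h.contDiff.fderiv_right (m := ∞) (by simp)).clm_apply contDiff_const
  compact := h.compact.fderiv_apply ℝ v
  tsupport_subset := (tsupport_fderiv_apply_subset ℝ v).trans h.tsupport_subset

theorem integrable_mul [MeasurableSpace V] [OpensMeasurableSpace V] {ν : Measure V}
    [IsFiniteMeasureOnCompacts ν] (h : IsTest O φ) (hO : IsOpen O) {f : V → ℂ}
    (hf : ContinuousOn f O) : Integrable (fun p => f p * (φ p : ℂ)) ν :=
  integrable_mul_of_tsupport_subset hO hf
    (Complex.continuous_ofReal.comp h.contDiff.continuous) h.ofReal_compact h.ofReal_tsupport_subset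

theorem fderiv_eq_zero (h : IsTest O φ) {p : V} (hp : p ∉ O) : fderiv ℝ φ p = 0 := by
  by_contra hne
  exact hp (h.tsupport_subset (support_fderiv_subset ℝ hne))

end IsTest

theorem norm_le_of_apply_le {n : ℕ} {x : EuclideanSpace ℂ (Fin n)} {b : ℝ} (hb : 0 ≤ b)
    (h : ∀ i, ‖x i‖ ≤ b) : ‖x‖ ≤ n * b := by
  refine le_of_sq_le_sq ?_ (by positivity)
  rw [EuclideanSpace.norm_sq_eq]
  calc ∑ i, ‖x i‖ ^ 2 ≤ ∑ _i : Fin n, b ^ 2 := by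
        refine Finset.sum_le_sum fun i _ => ?_
        have := h i
        gcongr
    _ = n * b ^ 2 := by simp
    _ ≤ n ^ 2 * b ^ 2 := by
        gcongr
        rcases Nat.eq_zero_or_pos n with rfl | hn
        · simp
        · have : (1 : ℝ) ≤ n := by exact_mod_cast hn
          nlinarith
    _ = _ := by ring

/-- The Hölder constant of the realized reaction. -/
def reactionConst (n : ℕ) (α₂ C₂ C₄ : ℝ) : ℝ := C₂ * ((2 * C₄) ^ α₂ + (n * C₄) ^ α₂)

/-- Changing the two arguments of R one at a time loses the exponent α₂ in each. The state and its
gradient vary by O(d^α₄) at distance d ≤ 1, so the exponents multiply. -/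
theorem Params.Bounds.norm_reaction_sub_le {n : ℕ} {A : Params n} {α₂ α₃ α₄ C₂ C₃ C₄ : ℝ}
    {N : Set (E n)} {T : ℝ} (h : A.Bounds α₂ α₃ α₄ C₂ C₃ C₄ N T) (hα₂ : 0 < α₂)
    (hα₄ : α₄ ∈ Ioo (0 : ℝ) 1) (hC₂ : 0 ≤ C₂) (hC₄ : 0 ≤ C₄) {p q : E n × ℝ}
    (hp : p ∈ closure N ×ˢ Icc 0 T) (hq : q ∈ closure N ×ˢ Icc 0 T) (hd : dist p q ≤ 1) :
    ‖A.reaction p - A.reaction q‖ ≤ reactionConst n α₂ C₂ C₄ * dist p q ^ (α₂ * α₄) := by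
  have hu := h.state.norm_sub_le_of_dist_le_one hα₄.1 hC₄ hq hp (by rwa [dist_comm])
  rw [dist_comm] at hu
  have hd4 : dist p q ≤ dist p q ^ α₄ := by
    have := Real.rpow_le_rpow_of_exponent_ge' dist_nonneg hd hα₄.1.le hα₄.2.le
    rwa [Real.rpow_one] at this
  have hgrad : ‖A.grad p - A.grad q‖ ≤ n * (C₄ * dist p q ^ α₄) := by
    refine norm_le_of_apply_le (by positivity) fun i => ?_
    have h1 : (A.grad p - A.grad q) i = (A.Du p - A.Du q) (EuclideanSpace.single i 1, 0) := by
      simp [Params.grad]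
    rw [h1]
    refine (ContinuousLinearMap.le_opNorm _ _).trans ?_
    have h2 : ‖((EuclideanSpace.single i 1 : E n), (0 : ℝ))‖ = 1 := by
      rw [Prod.norm_def]; simp
    rw [h2, mul_one]
    exact h.state.holder_deriv p hp q hq
  obtain ⟨a, b, ha, _, hab, _, hR1⟩ := h.reaction_state (A.grad p)
  obtain ⟨a', b', ha', _, hab', _, hR2⟩ := h.reaction_grad (A.u q)
  have h1 := hR1 (A.u p) trivial (A.u q) trivial
  have h2 := hR2 (A.grad p) trivial (A.grad q) trivial
  rw [dist_eq_norm] at h1 h2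
  have h3 : ‖A.reaction p - A.reaction q‖ ≤ C₂ * ‖A.u p - A.u q‖ ^ α₂
      + C₂ * ‖A.grad p - A.grad q‖ ^ α₂ := by
    have h4 : A.reaction p - A.reaction q = (A.R (A.u p) (A.grad p) - A.R (A.u q) (A.grad p))
        + (A.R (A.u q) (A.grad p) - A.R (A.u q) (A.grad q)) := by
      simp [Params.reaction]
    rw [h4]
    refine (norm_add_le _ _).trans (add_le_add (h1.trans ?_) (h2.trans ?_))
    · gcongr; linarith
    · gcongr; linarith
  refine h3.trans ?_
  have hpow : dist p q ^ (α₂ * α₄) = (dist p q ^ α₄) ^ α₂ := by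
    rw [← Real.rpow_mul dist_nonneg, mul_comm]
  have e1 : ‖A.u p - A.u q‖ ^ α₂ ≤ (2 * C₄) ^ α₂ * dist p q ^ (α₂ * α₄) := by
    rw [hpow, ← Real.mul_rpow (by positivity) (by positivity)]
    gcongr
    exact hu.trans (by gcongr)
  have e2 : ‖A.grad p - A.grad q‖ ^ α₂ ≤ (n * C₄) ^ α₂ * dist p q ^ (α₂ * α₄) := by
    rw [hpow, ← Real.mul_rpow (by positivity) (by positivity)]
    gcongr
    rw [mul_assoc]; exact hgrad
  rw [reactionConst]
  have e3 := mul_le_mul_of_nonneg_left e1 hC₂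
  have e4 := mul_le_mul_of_nonneg_left e2 hC₂
  linarith

theorem continuousOn_of_norm_sub_le {V F : Type*} [PseudoMetricSpace V] [SeminormedAddCommGroup F]
    {f : V → F} {s : Set V} {C β : ℝ} (hβ : 0 < β)
    (h : ∀ p ∈ s, ∀ q ∈ s, dist p q ≤ 1 → ‖f p - f q‖ ≤ C * dist p q ^ β) : ContinuousOn f s := by
  intro p hp
  rw [ContinuousWithinAt, tendsto_iff_dist_tendsto_zero]
  have hlim : Filter.Tendsto (fun q => C * dist q p ^ β) (nhdsWithin p s) (nhds 0) := by
    have h1 : Filter.Tendsto (fun q : V => dist q p) (nhdsWithin p s) (nhds 0) := by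
      have : Filter.Tendsto (fun q : V => dist q p) (nhds p) (nhds (dist p p)) :=
        Continuous.tendsto (by fun_prop) p
      rw [dist_self] at this
      exact this.mono_left nhdsWithin_le_nhds
    have h2 := (h1.rpow_const (p := β) (Or.inr hβ.le)).const_mul C
    rwa [Real.zero_rpow hβ.ne', mul_zero] at h2
  refine squeeze_zero' (Filter.Eventually.of_forall fun _ => dist_nonneg) ?_ hlim
  filter_upwards [self_mem_nhdsWithin, mem_nhdsWithin_of_mem_nhds (Metric.closedBall_mem_nhds p
    one_pos)] with q hq hq1
  rw [dist_eq_norm]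
  exact h q hq p hp hq1

theorem Params.Bounds.continuousOn_reaction {n : ℕ} {A : Params n} {α₂ α₃ α₄ C₂ C₃ C₄ : ℝ}
    {N : Set (E n)} {T : ℝ} (h : A.Bounds α₂ α₃ α₄ C₂ C₃ C₄ N T) (hα₂ : 0 < α₂)
    (hα₄ : α₄ ∈ Ioo (0 : ℝ) 1) (hC₂ : 0 ≤ C₂) (hC₄ : 0 ≤ C₄) :
    ContinuousOn A.reaction (closure N ×ˢ Icc 0 T) :=
  continuousOn_of_norm_sub_le (mul_pos hα₂ hα₄.1) fun _ hp _ hq hd =>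
    h.norm_reaction_sub_le hα₂ hα₄ hC₂ hC₄ hp hq hd

/-- The difference of the realized reactions. -/
def reactionGap {n : ℕ} (A₁ A₂ : Params n) (p : E n × ℝ) : ℂ := A₁.reaction p - A₂.reaction p

namespace IsMatchedPair

variable {m : ℕ} {A₁ A₂ : Params (m + 1)} {P : Piece m}
  {μ α₂ α₃ α₄ C₂ C₃ C₄ κ K L₀ Λ ε T T₁ T₂ : ℝ}

theorem subset_closure_prod
    (h : IsMatchedPair A₁ A₂ P μ α₂ α₃ α₄ C₂ C₃ C₄ κ K L₀ Λ ε T T₁ T₂) :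
    P.carrier ×ˢ Ioo T₁ T₂ ⊆ closure P.carrier ×ˢ Icc 0 T :=
  fun _ hp => ⟨subset_closure hp.1, h.mem_Icc (Ioo_subset_Icc_self hp.2)⟩

theorem norm_reactionGap_sub_le
    (h : IsMatchedPair A₁ A₂ P μ α₂ α₃ α₄ C₂ C₃ C₄ κ K L₀ Λ ε T T₁ T₂) {p q : E (m + 1) × ℝ}
    (hp : p ∈ closure P.carrier ×ˢ Icc 0 T) (hq : q ∈ closure P.carrier ×ˢ Icc 0 T)
    (hd : dist p q ≤ 1) : ‖reactionGap A₁ A₂ p - reactionGap A₁ A₂ q‖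
      ≤ 2 * reactionConst (m + 1) α₂ C₂ C₄ * dist p q ^ (α₂ * α₄) := by
  have h1 := h.bounds₁.norm_reaction_sub_le h.α₂_mem.1 h.α₄_mem h.C₂_pos.le h.C₄_pos.le hp hq hd
  have h2 := h.bounds₂.norm_reaction_sub_le h.α₂_mem.1 h.α₄_mem h.C₂_pos.le h.C₄_pos.le hp hq hd
  rw [reactionGap, reactionGap, sub_sub_sub_comm]
  refine (norm_sub_le _ _).trans ?_
  linarith

theorem continuousOn_reactionGap
    (h : IsMatchedPair A₁ A₂ P μ α₂ α₃ α₄ C₂ C₃ C₄ κ K L₀ Λ ε T T₁ T₂) :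
    ContinuousOn (reactionGap A₁ A₂) (closure P.carrier ×ˢ Icc 0 T) :=
  (h.bounds₁.continuousOn_reaction h.α₂_mem.1 h.α₄_mem h.C₂_pos.le h.C₄_pos.le).sub
    (h.bounds₂.continuousOn_reaction h.α₂_mem.1 h.α₄_mem h.C₂_pos.le h.C₄_pos.le)

theorem continuousOn_derivGap_apply
    (h : IsMatchedPair A₁ A₂ P μ α₂ α₃ α₄ C₂ C₃ C₄ κ K L₀ Λ ε T T₁ T₂) (v : E (m + 1) × ℝ) :
    ContinuousOn (fun p => derivGap A₁ A₂ p v) (P.carrier ×ˢ Ioo T₁ T₂) :=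
  ((h.state.continuousOn_deriv h.α₄_mem.1).mono h.subset_closure_prod).clm_apply continuousOn_const

theorem integral_derivGap_mul
    (h : IsMatchedPair A₁ A₂ P μ α₂ α₃ α₄ C₂ C₃ C₄ κ K L₀ Λ ε T T₁ T₂) (hN : IsOpen P.carrier)
    {ψ : E (m + 1) × ℝ → ℝ} (hψ : IsTest (P.carrier ×ˢ Ioo T₁ T₂) ψ) (v : E (m + 1) × ℝ) :
    ∫ p, derivGap A₁ A₂ p v * (ψ p : ℂ) = -∫ p, stateGap A₁ A₂ p * (fderiv ℝ ψ p v : ℂ) := by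
  have hO : IsOpen (P.carrier ×ˢ Ioo T₁ T₂) := hN.prod isOpen_Ioo
  have hU := (h.state.continuousOn h.α₄_mem.1 (by linarith [h.C₄_pos])).mono h.subset_closure_prod
  have hder : ∀ p, HasFDerivAt (fun p => (ψ p : ℂ)) (Complex.ofRealCLM.comp (fderiv ℝ ψ p)) p :=
    fun p => Complex.ofRealCLM.hasFDerivAt.comp p
      ((hψ.contDiff.differentiable (by simp)) p).hasFDerivAt
  have hHaar : (volume : Measure (E (m + 1) × ℝ)).IsAddHaarMeasure :=
    inferInstanceAs (((volume : Measure (E (m + 1))).prod (volume : Measure ℝ)).IsAddHaarMeasure)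
  have := integral_bilinear_hasFDerivAt_right_eq_neg_left_of_integrable
    (μ := (volume : Measure (E (m + 1) × ℝ))) (f := stateGap A₁ A₂) (f' := derivGap A₁ A₂)
    (g := fun p => (ψ p : ℂ)) (g' := fun p => Complex.ofRealCLM.comp (fderiv ℝ ψ p)) (v := v)
    (B := ContinuousLinearMap.mul ℝ ℂ)
    (hψ.integrable_mul hO (h.continuousOn_derivGap_apply v))
    ((hψ.fderiv_apply v).integrable_mul hO hU) (hψ.integrable_mul hO hU)
    (fun p hp => h.state.hasFDerivAt h.α₄_mem.1 (Filter.mem_of_superset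
      (hO.mem_nhds (hψ.ofReal_tsupport_subset hp)) h.subset_closure_prod))
    (fun p _ => hder p)
  simp only [ContinuousLinearMap.mul_apply', ContinuousLinearMap.comp_apply,
    Complex.ofRealCLM_apply] at this
  rw [this, neg_neg]

/-- The weak equation for the difference of two states with the same flux. -/
theorem weak_identity (h : IsMatchedPair A₁ A₂ P μ α₂ α₃ α₄ C₂ C₃ C₄ κ K L₀ Λ ε T T₁ T₂)
    (hF : ∀ x ∈ P.carrier, ∀ t ∈ Icc T₁ T₂, A₁.flux (x, t) = A₂.flux (x, t))
    (hN : IsOpen P.carrier) {Ω : Set (E (m + 1))} (hΩ : P.carrier ⊆ Ω)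
    (h₁ : A₁.IsSolution μ Ω T) (h₂ : A₂.IsSolution μ Ω T) {φ : E (m + 1) × ℝ → ℝ}
    (hφ : IsTest (P.carrier ×ˢ Ioo T₁ T₂) φ) :
    ∫ p, (reactionGap A₁ A₂ p - derivGap A₁ A₂ p (0, 1)) * (φ p : ℂ) =
      μ * ∫ p, ∑ i, derivGap A₁ A₂ p (EuclideanSpace.single i 1, 0) *
        (fderiv ℝ φ p (EuclideanSpace.single i 1, 0) : ℂ) := by
  have hO : IsOpen (P.carrier ×ˢ Ioo T₁ T₂) := hN.prod isOpen_Ioo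
  have hsub : tsupport φ ⊆ Ω ×ˢ Ioo 0 T := hφ.tsupport_subset.trans
    (prod_mono hΩ (Ioo_subset_Ioo h.zero_le_T₁ h.T₂_le_T))
  have hInt : ∀ A : Params (m + 1), A.Bounds α₂ α₃ α₄ C₂ C₃ C₄ P.carrier T →
      Integrable fun p => A.u p * (fderiv ℝ φ p (0, 1) : ℂ)
        + ∑ i, A.flux p i * (fderiv ℝ φ p (EuclideanSpace.single i 1, 0) : ℂ)
        - (μ : ℂ) * ∑ i, A.grad p i * (fderiv ℝ φ p (EuclideanSpace.single i 1, 0) : ℂ)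
        + A.reaction p * (φ p : ℂ) := by
    intro A hA
    have i1 := (hφ.fderiv_apply (0, 1)).integrable_mul (ν := volume) hO
      ((hA.state.continuousOn h.α₄_mem.1 h.C₄_pos.le).mono h.subset_closure_prod)
    have i2 : ∀ i : Fin (m + 1), Integrable fun p =>
        A.flux p i * (fderiv ℝ φ p (EuclideanSpace.single i 1, 0) : ℂ) := fun i =>
      (hφ.fderiv_apply _).integrable_mul hO
        ((hA.continuousOn_flux h.α₃_mem.1 h.α₄_mem.1 h.C₄_pos.le i).mono h.subset_closure_prod)
    have i3 : ∀ i : Fin (m + 1), Integrable fun p =>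
        A.grad p i * (fderiv ℝ φ p (EuclideanSpace.single i 1, 0) : ℂ) := fun i =>
      (hφ.fderiv_apply _).integrable_mul hO
        (((hA.state.continuousOn_deriv h.α₄_mem.1).mono h.subset_closure_prod).clm_apply
          continuousOn_const)
    have i4 := hφ.integrable_mul (ν := volume) hO
      ((hA.continuousOn_reaction h.α₂_mem.1 h.α₄_mem h.C₂_pos.le h.C₄_pos.le).mono
        h.subset_closure_prod)
    exact ((i1.add (integrable_finsetSum _ fun i _ => i2 i)).sub
      ((integrable_finsetSum _ fun i _ => i3 i).const_mul _)).add i4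
  have hdiff := integral_sub (hInt A₁ h.bounds₁) (hInt A₂ h.bounds₂)
  rw [h₁ φ hφ.contDiff hφ.compact hsub, h₂ φ hφ.contDiff hφ.compact hsub, sub_zero] at hdiff
  have hU := (h.state.continuousOn h.α₄_mem.1 (by linarith [h.C₄_pos])).mono h.subset_closure_prod
  have j1 := (hφ.fderiv_apply (0, 1)).integrable_mul (ν := volume) hO hU
  have j2 : Integrable fun p => ∑ i, derivGap A₁ A₂ p (EuclideanSpace.single i 1, 0) *
      (fderiv ℝ φ p (EuclideanSpace.single i 1, 0) : ℂ) :=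
    integrable_finsetSum _ fun i _ =>
      (hφ.fderiv_apply _).integrable_mul hO (h.continuousOn_derivGap_apply _)
  have j3 := hφ.integrable_mul (ν := volume) hO
    (h.continuousOn_reactionGap.mono h.subset_closure_prod)
  have j4 := hφ.integrable_mul (ν := volume) hO (h.continuousOn_derivGap_apply (0, 1))
  have hcongr : (fun p => (A₁.u p * (fderiv ℝ φ p (0, 1) : ℂ)
        + ∑ i, A₁.flux p i * (fderiv ℝ φ p (EuclideanSpace.single i 1, 0) : ℂ)
        - (μ : ℂ) * ∑ i, A₁.grad p i * (fderiv ℝ φ p (EuclideanSpace.single i 1, 0) : ℂ)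
        + A₁.reaction p * (φ p : ℂ)) - (A₂.u p * (fderiv ℝ φ p (0, 1) : ℂ)
        + ∑ i, A₂.flux p i * (fderiv ℝ φ p (EuclideanSpace.single i 1, 0) : ℂ)
        - (μ : ℂ) * ∑ i, A₂.grad p i * (fderiv ℝ φ p (EuclideanSpace.single i 1, 0) : ℂ)
        + A₂.reaction p * (φ p : ℂ))) = fun p =>
        (stateGap A₁ A₂ p * (fderiv ℝ φ p (0, 1) : ℂ) - μ * ∑ i,
          derivGap A₁ A₂ p (EuclideanSpace.single i 1, 0) *
          (fderiv ℝ φ p (EuclideanSpace.single i 1, 0) : ℂ))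
        + reactionGap A₁ A₂ p * (φ p : ℂ) := by
    ext ⟨x, t⟩
    -- The convective terms cancel: the fluxes agree on the open set that contains the support of φ,
    -- and outside it the derivatives of φ vanish.
    have hflux : ∀ i, A₁.flux (x, t) i * (fderiv ℝ φ (x, t) (EuclideanSpace.single i 1, 0) : ℂ)
        = A₂.flux (x, t) i * (fderiv ℝ φ (x, t) (EuclideanSpace.single i 1, 0) : ℂ) := by
      intro i
      by_cases hp : (x, t) ∈ P.carrier ×ˢ Ioo T₁ T₂
      · rw [hF x hp.1 t (Ioo_subset_Icc_self hp.2)]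
      · rw [hφ.fderiv_eq_zero hp]; simp
    have hgrad : ∑ i, derivGap A₁ A₂ (x, t) (EuclideanSpace.single i 1, 0) *
          (fderiv ℝ φ (x, t) (EuclideanSpace.single i 1, 0) : ℂ)
        = ∑ i, A₁.grad (x, t) i * (fderiv ℝ φ (x, t) (EuclideanSpace.single i 1, 0) : ℂ)
        - ∑ i, A₂.grad (x, t) i * (fderiv ℝ φ (x, t) (EuclideanSpace.single i 1, 0) : ℂ) := by
      rw [← Finset.sum_sub_distrib]
      refine Finset.sum_congr rfl fun i _ => ?_
      rw [derivGap, sub_apply, sub_mul]; rfl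
    rw [Finset.sum_congr rfl fun i _ => hflux i, hgrad, stateGap, reactionGap]
    ring
  have j5 : Integrable fun p => stateGap A₁ A₂ p * (fderiv ℝ φ p (0, 1) : ℂ) - μ * ∑ i,
      derivGap A₁ A₂ p (EuclideanSpace.single i 1, 0) *
        (fderiv ℝ φ p (EuclideanSpace.single i 1, 0) : ℂ) := j1.sub (j2.const_mul _)
  rw [hcongr, integral_add j5 j3, integral_sub j1 (j2.const_mul _),
    integral_const_mul] at hdiff
  -- The time derivative returns to the state gap, which is differentiable in time. No derivative
  -- then falls on the time profile of φ, so the test functions may be arbitrarily short in time.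
  have hibp := h.integral_derivGap_mul hN hφ (0, 1)
  have hsplit : ∫ p, (reactionGap A₁ A₂ p - derivGap A₁ A₂ p (0, 1)) * (φ p : ℂ)
      = (∫ p, reactionGap A₁ A₂ p * (φ p : ℂ)) - ∫ p, derivGap A₁ A₂ p (0, 1) * (φ p : ℂ) := by
    rw [← integral_sub j3 j4]
    exact integral_congr_ae (Filter.Eventually.of_forall fun p => by ring)
  rw [hsplit, hibp]
  linear_combination hdiff

end IsMatchedPair

theorem norm_integral_prod_le {n : ℕ} {F : E n × ℝ → ℂ} {g : E n → ℝ} {θ : ℝ → ℝ}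
    (hg : Integrable g) (hθ : Integrable θ) (h : ∀ x t, ‖F (x, t)‖ ≤ g x * θ t) :
    ‖∫ p, F p‖ ≤ (∫ x, g x) * ∫ t, θ t := by
  rw [← integral_prod_mul]
  refine norm_integral_le_of_norm_le (hg.mul_prod hθ) (Filter.Eventually.of_forall ?_)
  exact fun p => h p.1 p.2

/-! ### Localized test functions -/

/-- A product of two functions of one linear coordinate each. -/
def ridge {n : ℕ} (e e' : E n) (f g : ℝ → ℝ) (x : E n) : ℝ := f (inner ℝ x e) * g (inner ℝ x e')

/-- A ridge function, cut off by `χ`, extended by zero from `N`, and localized in time. -/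
def cutRidge {n : ℕ} (N : Set (E n)) (χ : E n → ℝ) (e e' : E n) (f g θ : ℝ → ℝ)
    (p : E n × ℝ) : ℝ :=
  N.indicator (fun x => χ x * ridge e e' f g x) p.1 * θ p.2

section Ridge

variable {n : ℕ} {N : Set (E n)} {χ : E n → ℝ} {e e' : E n} {f g θ : ℝ → ℝ}

theorem contDiff_ridge (hf : ContDiff ℝ ∞ f) (hg : ContDiff ℝ ∞ g) :
    ContDiff ℝ ∞ (ridge e e' f g) :=
  (hf.comp (contDiff_id.inner ℝ contDiff_const)).mul (hg.comp (contDiff_id.inner ℝ contDiff_const))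

theorem fderiv_ridge_apply (hf : ContDiff ℝ ∞ f) (hg : ContDiff ℝ ∞ g) (x v : E n) :
    fderiv ℝ (ridge e e' f g) x v =
      ridge e e' (deriv f) g x * inner ℝ v e + ridge e e' f (deriv g) x * inner ℝ v e' := by
  have hcomp : ∀ (k : ℝ → ℝ) (w : E n), ContDiff ℝ ∞ k →
      HasFDerivAt (fun x => k (inner ℝ x w)) (deriv k (inner ℝ x w) • innerSL ℝ w) x := by
    intro k w hk
    have h1 : HasFDerivAt (fun x : E n => inner ℝ x w) (innerSL ℝ w) x := by
      refine (innerSL ℝ w).hasFDerivAt.congr_of_eventuallyEq (Filter.Eventually.of_forall fun z => ?_)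
      exact real_inner_comm _ _
    exact ((hk.differentiable (by simp)) _).hasDerivAt.comp_hasFDerivAt x h1
  have h2 := (hcomp f e hf).mul (hcomp g e' hg)
  have h3 : HasFDerivAt (ridge e e' f g) _ x := h2
  rw [h3.fderiv]
  simp only [ridge, add_apply, smul_apply, innerSL_apply_apply, smul_eq_mul,
    real_inner_comm v]
  ring

theorem contDiff_cut_ridge (hχ : ContDiff ℝ ∞ χ) (hf : ContDiff ℝ ∞ f) (hg : ContDiff ℝ ∞ g) :
    ContDiff ℝ ∞ fun x => χ x * ridge e e' f g x := hχ.mul (contDiff_ridge hf hg)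

theorem isTest_cutRidge (hN : IsOpen N) (hNb : Bornology.IsBounded N) (hχ : ContDiff ℝ ∞ χ)
    (hf : ContDiff ℝ ∞ f) (hg : ContDiff ℝ ∞ g) (hθ : ContDiff ℝ ∞ θ) (hθc : HasCompactSupport θ)
    {I : Set ℝ} (hθI : tsupport θ ⊆ I)
    (hz : ∀ x ∉ N, ∀ᶠ z in nhds x, z ∈ N → χ z * ridge e e' f g z = 0) :
    IsTest (N ×ˢ I) (cutRidge N χ e e' f g θ) := by
  obtain ⟨h1, h2, -⟩ := contDiff_indicator hN (contDiff_cut_ridge hχ hf hg) hz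
  set G := N.indicator fun x => χ x * ridge e e' f g x with hG
  have hsub : tsupport (cutRidge N χ e e' f g θ) ⊆ tsupport G ×ˢ tsupport θ := by
    refine closure_minimal (fun p hp => ?_) ((isClosed_tsupport _).prod (isClosed_tsupport _))
    have hp' : G p.1 * θ p.2 ≠ 0 := hp
    exact ⟨subset_tsupport _ (left_ne_zero_of_mul hp'), subset_tsupport _ (right_ne_zero_of_mul hp')⟩
  refine ⟨(h1.comp contDiff_fst).mul (hθ.comp contDiff_snd), ?_, hsub.trans (prod_mono h2 hθI)⟩
  have hGc : IsCompact (tsupport G) :=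
    hNb.isCompact_closure.of_isClosed_subset (isClosed_tsupport _) (h2.trans subset_closure)
  exact (hGc.prod hθc).of_isClosed_subset (isClosed_tsupport _) hsub

theorem fderiv_cutRidge_apply (hN : IsOpen N) (hχ : ContDiff ℝ ∞ χ)
    (hf : ContDiff ℝ ∞ f) (hg : ContDiff ℝ ∞ g) (hθ : ContDiff ℝ ∞ θ)
    (hz : ∀ x ∉ N, ∀ᶠ z in nhds x, z ∈ N → χ z * ridge e e' f g z = 0) (x v : E n) (t : ℝ) :
    fderiv ℝ (cutRidge N χ e e' f g θ) (x, t) (v, 0) = N.indicator (fun x =>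
      χ x * (ridge e e' (deriv f) g x * inner ℝ v e + ridge e e' f (deriv g) x * inner ℝ v e')
        + ridge e e' f g x * fderiv ℝ χ x v) x * θ t := by
  obtain ⟨h1, -, h3⟩ := contDiff_indicator hN (contDiff_cut_ridge hχ hf hg) hz
  set G := N.indicator fun x => χ x * ridge e e' f g x with hG
  have hd1 : HasFDerivAt (fun p : E n × ℝ => G p.1)
      ((fderiv ℝ G x).comp (ContinuousLinearMap.fst ℝ (E n) ℝ)) (x, t) :=
    HasFDerivAt.comp (g := G) (f := Prod.fst) (x, t)
      ((h1.differentiable (by simp)) x).hasFDerivAt hasFDerivAt_fst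
  have hd2 : HasFDerivAt (fun p : E n × ℝ => θ p.2)
      ((fderiv ℝ θ t).comp (ContinuousLinearMap.snd ℝ (E n) ℝ)) (x, t) :=
    HasFDerivAt.comp (g := θ) (f := Prod.snd) (x, t)
      ((hθ.differentiable (by simp)) t).hasFDerivAt hasFDerivAt_snd
  have hd3 : HasFDerivAt (cutRidge N χ e e' f g θ) _ (x, t) := hd1.mul hd2
  rw [hd3.fderiv, h3]
  by_cases hx : x ∈ N
  · rw [indicator_of_mem hx, indicator_of_mem hx,
      fderiv_fun_mul ((hχ.differentiable (by simp)) x)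
        (((contDiff_ridge hf hg).differentiable (by simp)) x)]
    simp only [add_apply, smul_apply, ContinuousLinearMap.comp_apply,
      ContinuousLinearMap.coe_fst', ContinuousLinearMap.coe_snd', map_zero, smul_eq_mul,
      fderiv_ridge_apply hf hg]
    ring
  · rw [indicator_of_notMem hx, indicator_of_notMem hx]
    simp

end Ridge

theorem Piece.IsThin.isBounded_carrier {m : ℕ} {P : Piece m} {κ K L₀ Λ ε : ℝ}
    (h : P.IsThin κ K L₀ Λ ε) (hK : 0 < K) (hb : Bornology.IsBounded P.cross) :
    Bornology.IsBounded P.carrier := by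
  rcases P.carrier.eq_empty_or_nonempty with h0 | ⟨_, a₀, ha₀, y₀, hy₀, rfl⟩
  · rw [h0]; exact Bornology.isBounded_empty
  · refine (Metric.isBounded_closedBall (x := P.place a₀ y₀)
      (r := K * (2 * P.L) + Metric.diam P.cross)).subset ?_
    rintro _ ⟨a, ha, y, hy, rfl⟩
    refine (h.norm_place_sub_le ha₀ ha).trans (add_le_add ?_ (Metric.dist_le_diam_of_mem hb hy hy₀))
    have : |a - a₀| ≤ 2 * P.L := by
      rw [abs_le]; constructor <;> linarith [ha.1, ha.2, ha₀.1, ha₀.2]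
    gcongr

/-- A ridge function that is localized along the curve and cut off near the lateral boundary
vanishes near the whole boundary of the piece. -/
theorem Piece.IsThin.eventually_cut_ridge_eq_zero {m : ℕ} {P : Piece m} {κ K L₀ Λ ε : ℝ}
    (h : P.IsThin κ K L₀ Λ ε) (hκ : 0 < κ) (hK : 0 < K) (hS : IsOpen P.cross) {a₁ ρ : ℝ}
    (hρ : 0 ≤ ρ) (hsub : Icc (a₁ - ρ) (a₁ + ρ) ⊆ Ioo (-P.L) P.L) {Z : Finset (E (m + 1))} {δ : ℝ}
    (hZ : ∀ a ∈ Icc (a₁ - ρ) (a₁ + ρ), ∀ y ∈ frontier P.cross, ∃ z ∈ Z, dist (P.place a y) z < δ)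
    {χ : E (m + 1) → ℝ} (hχ : ∀ x, (∃ z ∈ Z, dist x z < δ) → χ x = 0) {f g : ℝ → ℝ}
    (hf : tsupport f ⊆ {s | |s - P.height a₁| < κ * ρ}) (e : E (m + 1)) {x : E (m + 1)}
    (hx : x ∉ P.carrier) :
    ∀ᶠ z in nhds x, z ∈ P.carrier → χ z * ridge (P.frame 0) e f g z = 0 := by
  by_cases hxf : inner ℝ x (P.frame 0) ∈ tsupport f
  · obtain ⟨a, ha, hax⟩ := h.exists_height_eq hρ hsub (hf hxf).le
    have hxp := P.eq_place_of_height hax.symm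
    set y := P.trans (x - P.curve a) with hy
    by_cases hcl : x ∈ closure P.carrier
    · have hfr : P.place a y ∈ frontier P.carrier := by
        rw [← hxp, (h.isOpen_carrier hκ hK hS).frontier_eq]
        exact ⟨hcl, hx⟩
      obtain ⟨z, hz, hd⟩ := hZ a ha y (h.mem_frontier_cross_of_place hκ hK hS (hsub ha) hfr)
      rw [← hxp] at hd
      filter_upwards [Metric.isOpen_ball.mem_nhds (Metric.mem_ball.2 hd)] with w hw _
      rw [hχ w ⟨z, hz, hw⟩, zero_mul]
    · filter_upwards [isClosed_closure.isOpen_compl.mem_nhds hcl] with w hw hwN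
      exact absurd (subset_closure hwN) hw
  · have hc : Filter.Tendsto (fun z : E (m + 1) => inner ℝ z (P.frame 0)) (nhds x)
        (nhds (inner ℝ x (P.frame 0))) := Continuous.tendsto (by fun_prop) x
    filter_upwards [hc.eventually (notMem_tsupport_iff_eventuallyEq.1 hxf)] with z hz _
    simp only [ridge]
    rw [hz]; simp

namespace IsMatchedPair

variable {m : ℕ} {A₁ A₂ : Params (m + 1)} {P : Piece m}
  {μ α₂ α₃ α₄ C₂ C₃ C₄ κ K L₀ Λ ε T T₁ T₂ : ℝ}

/-- The weight lives within 2δ of lateral boundary points, where both gaps are small. For 2δ ≤ 1 the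
bound for the derivative also covers the state, so a single constant serves both in the cutoff
terms. -/
theorem derivGap_mul_ballCount_le
    (h : IsMatchedPair A₁ A₂ P μ α₂ α₃ α₄ C₂ C₃ C₄ κ K L₀ Λ ε T T₁ T₂)
    (hF : ∀ x ∈ P.carrier, ∀ t ∈ Icc T₁ T₂, A₁.flux (x, t) = A₂.flux (x, t))
    (hS : IsOpen P.cross) (hL : IsLipschitzDomain P.cross) {Z : Finset (E (m + 1))} {δ : ℝ}
    (hδ : 0 < δ) (hδ1 : 2 * δ ≤ 1)
    (hZ : ∀ z ∈ Z, ∃ a ∈ Ioo (-P.L) P.L, ∃ y ∈ frontier P.cross, z = P.place a y)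
    {x : E (m + 1)} {t : ℝ} (hx : x ∈ P.carrier) (ht : t ∈ Ioo T₁ T₂) :
    ‖stateGap A₁ A₂ (x, t)‖ * ballCount Z δ x ≤ 2 * C₄ * (2 * δ) ^ α₄ * ballCount Z δ x ∧
      ‖derivGap A₁ A₂ (x, t)‖ * ballCount Z δ x ≤ 2 * C₄ * (2 * δ) ^ α₄ * ballCount Z δ x := by
  by_cases hnear : ∃ z ∈ Z, dist x z ≤ 2 * δ
  · obtain ⟨z, hz, hd⟩ := hnear
    obtain ⟨a, ha, y, hy, rfl⟩ := hZ z hz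
    obtain ⟨h1, h2⟩ := h.gap_le_of_near_lateral hF hS hL ha hy ht (subset_closure hx) hd
    have hb := ballCount_nonneg Z δ x
    have hC₄ := h.C₄_pos
    refine ⟨mul_le_mul_of_nonneg_right (h1.trans ?_) hb, mul_le_mul_of_nonneg_right h2 hb⟩
    gcongr 2 * C₄ * ?_
    exact Real.rpow_le_rpow_of_exponent_ge (by positivity) hδ1 (by linarith)
  · push Not at hnear
    rw [ballCount_eq_zero hnear]; simp

end IsMatchedPair

/-! ### The diffusion term -/

theorem tsupport_deriv_subset_tsupport (f : ℝ → ℝ) : tsupport (deriv f) ⊆ tsupport f :=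
  closure_minimal (support_deriv_subset (f := f)) (isClosed_tsupport f)

theorem sum_apply_single_mul_inner {n : ℕ} (D : E n × ℝ →L[ℝ] ℂ) (e : E n) :
    ∑ i, D (EuclideanSpace.single i 1, 0) * ((inner ℝ (EuclideanSpace.single i 1) e : ℝ) : ℂ)
      = D (e, 0) := by
  have h1 : (e, (0 : ℝ)) = ∑ i, (inner ℝ (EuclideanSpace.single i (1 : ℝ)) e : ℝ) •
      ((EuclideanSpace.single i (1 : ℝ) : E n), (0 : ℝ)) := by
    refine Prod.ext ?_ ?_
    · have := (EuclideanSpace.basisFun (Fin n) ℝ).sum_repr' e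
      simp only [EuclideanSpace.basisFun_apply] at this
      simp only [Prod.fst_sum, Prod.smul_fst]
      exact this.symm
    · simp [Prod.snd_sum]
  conv_rhs => rw [h1]
  rw [map_sum]
  refine Finset.sum_congr rfl fun i _ => ?_
  rw [map_smul, Complex.real_smul, mul_comm]

theorem norm_sum_apply_single_mul_le {n : ℕ} (D : E n × ℝ →L[ℝ] ℂ) (F : E n →L[ℝ] ℝ) :
    ‖∑ i, D (EuclideanSpace.single i 1, 0) * (F (EuclideanSpace.single i 1) : ℂ)‖
      ≤ n * (‖D‖ * ‖F‖) := by
  refine (norm_sum_le _ _).trans ?_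
  have h1 : ∀ i ∈ Finset.univ, ‖D ((EuclideanSpace.single i (1 : ℝ) : E n), (0 : ℝ)) *
      (F (EuclideanSpace.single i 1) : ℂ)‖ ≤ ‖D‖ * ‖F‖ := by
    intro i _
    rw [norm_mul, Complex.norm_real]
    have h2 := D.le_opNorm ((EuclideanSpace.single i (1 : ℝ) : E n), (0 : ℝ))
    have h3 := F.le_opNorm (EuclideanSpace.single i (1 : ℝ) : E n)
    rw [Prod.norm_def] at h2
    simp only [PiLp.norm_single, norm_one, norm_zero, zero_le_one, sup_of_le_left,
      mul_one] at h2 h3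
    gcongr
  exact (Finset.sum_le_sum h1).trans (le_of_eq (by simp))

/-- A smooth profile with values in `[0, 1]`. -/
structure IsProfile (M b : ℝ) (f : ℝ → ℝ) : Prop where
  contDiff : ContDiff ℝ ∞ f
  nonneg : ∀ s, 0 ≤ f s
  le_one : ∀ s, f s ≤ 1
  abs_deriv_le : ∀ s, |deriv f s| ≤ M
  abs_deriv_deriv_le : ∀ s, |deriv (deriv f) s| ≤ b

namespace IsProfile

variable {M b : ℝ} {f : ℝ → ℝ}

theorem contDiff_deriv (h : IsProfile M b f) : ContDiff ℝ ∞ (deriv f) :=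
  (contDiff_infty_iff_deriv.1 h.contDiff).2

theorem abs_le_one (h : IsProfile M b f) (s : ℝ) : |f s| ≤ 1 :=
  abs_le.2 ⟨by linarith [h.nonneg s], h.le_one s⟩

end IsProfile

theorem abs_ridge_le {n : ℕ} {e e' : E n} {f g : ℝ → ℝ} {M M' : ℝ} (hM : ∀ s, |f s| ≤ M)
    (hM' : ∀ s, |g s| ≤ M') (x : E n) : |ridge e e' f g x| ≤ M * M' := by
  rw [ridge, abs_mul]
  exact mul_le_mul (hM _) (hM' _) (abs_nonneg _) ((abs_nonneg _).trans (hM 0))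

theorem abs_mul_ridge_le_indicator {n : ℕ} {N D : Set (E n)} {e e' : E n} {f g k l : ℝ → ℝ}
    (hD : ∀ x ∈ N, inner ℝ x e ∈ tsupport f → inner ℝ x e' ∈ tsupport g → x ∈ D)
    (hk : tsupport k ⊆ tsupport f) (hl : tsupport l ⊆ tsupport g) {M M' : ℝ}
    (hM : ∀ s, |k s| ≤ M) (hM' : ∀ s, |l s| ≤ M') {c : ℝ} (hc : |c| ≤ 1) {x : E n} (hx : x ∈ N) :
    |c * ridge e e' k l x| ≤ M * M' * D.indicator (fun _ => 1) x := by
  by_cases h0 : ridge e e' k l x = 0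
  · rw [h0, mul_zero, abs_zero]
    have h1 : 0 ≤ M := (abs_nonneg _).trans (hM 0)
    have h2 : 0 ≤ M' := (abs_nonneg _).trans (hM' 0)
    have h3 : 0 ≤ D.indicator (fun _ => (1 : ℝ)) x := indicator_nonneg (fun _ _ => zero_le_one) _
    positivity
  · have hxD : x ∈ D := hD x hx (hk (subset_tsupport _ (left_ne_zero_of_mul h0)))
      (hl (subset_tsupport _ (right_ne_zero_of_mul h0)))
    rw [indicator_of_mem hxD, mul_one, abs_mul]
    exact (mul_le_of_le_one_left (abs_nonneg _) hc).trans (abs_ridge_le hM hM' x)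

namespace IsMatchedPair

variable {m : ℕ} {A₁ A₂ : Params (m + 1)} {P : Piece m}
  {μ α₂ α₃ α₄ C₂ C₃ C₄ κ K L₀ Λ ε T T₁ T₂ : ℝ}

/-- In ∇φ the derivative falls either on the ridge or on χ. The first kind of term is again a cut
ridge, and a second integration by parts turns it into second derivatives of the profiles against
the state gap, plus a term with ∇χ. All terms with ∇χ are collected in the summand with G. The bound
M on the first derivatives of the profiles occurs only there, so its size is irrelevant once G tends
to 0. -/
theorem norm_integral_grad_mul_le
    (h : IsMatchedPair A₁ A₂ P μ α₂ α₃ α₄ C₂ C₃ C₄ κ K L₀ Λ ε T T₁ T₂) (hN : IsOpen P.carrier)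
    (hNb : Bornology.IsBounded P.carrier) {e e' : E (m + 1)} (he : ‖e‖ = 1) (he' : ‖e'‖ = 1)
    (hee : inner ℝ e e' = 0) {χ b : E (m + 1) → ℝ} (hχ : ContDiff ℝ ∞ χ)
    (hχ1 : ∀ x, |χ x| ≤ 1) (hb : Integrable b) (hχb : ∀ x, ‖fderiv ℝ χ x‖ ≤ b x) {G c : ℝ}
    (hG : ∀ x ∈ P.carrier, ∀ t ∈ Ioo T₁ T₂, ‖stateGap A₁ A₂ (x, t)‖ * b x ≤ G * b x ∧
      ‖derivGap A₁ A₂ (x, t)‖ * b x ≤ G * b x) (hG0 : 0 ≤ G)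
    (hc : ∀ x ∈ P.carrier, ∀ t ∈ Ioo T₁ T₂, ‖stateGap A₁ A₂ (x, t)‖ ≤ c) (hc0 : 0 ≤ c)
    {M b₁ b₂ : ℝ} {f g θ : ℝ → ℝ} (hf : IsProfile M b₁ f) (hg : IsProfile M b₂ g)
    (hz : ∀ k l, tsupport k ⊆ tsupport f → ∀ x ∉ P.carrier, ∀ᶠ z in nhds x, z ∈ P.carrier →
      χ z * ridge e e' k l z = 0) {D : Set (E (m + 1))} (hDm : MeasurableSet D)
    (hDv : volume D ≠ ⊤)
    (hD : ∀ x ∈ P.carrier, inner ℝ x e ∈ tsupport f → inner ℝ x e' ∈ tsupport g → x ∈ D)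
    (hθ : ContDiff ℝ ∞ θ) (hθ0 : ∀ t, 0 ≤ θ t) (hθc : HasCompactSupport θ)
    (hθI : tsupport θ ⊆ Ioo T₁ T₂) :
    ‖∫ p, ∑ i, derivGap A₁ A₂ p (EuclideanSpace.single i 1, 0) *
        (fderiv ℝ (cutRidge P.carrier χ e e' f g θ) p (EuclideanSpace.single i 1, 0) : ℂ)‖
      ≤ (c * (b₁ + b₂) * volume.real D + (m + 1 + 2 * M) * G * ∫ x, b x) * ∫ t, θ t := by
  have hO : IsOpen (P.carrier ×ˢ Ioo T₁ T₂) := hN.prod isOpen_Ioo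
  have hU := (h.state.continuousOn h.α₄_mem.1 (by linarith [h.C₄_pos])).mono h.subset_closure_prod
  have hb0 : ∀ x, 0 ≤ b x := fun x => (norm_nonneg _).trans (hχb x)
  have hM0 : 0 ≤ M := (abs_nonneg _).trans (hf.abs_deriv_le 0)
  have hb₁ : 0 ≤ b₁ := (abs_nonneg _).trans (hf.abs_deriv_deriv_le 0)
  have hb₂ : 0 ≤ b₂ := (abs_nonneg _).trans (hg.abs_deriv_deriv_le 0)
  have htf := tsupport_deriv_subset_tsupport f
  have htf2 := (tsupport_deriv_subset_tsupport (deriv f)).trans htf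
  have htg := tsupport_deriv_subset_tsupport g
  have htg2 := (tsupport_deriv_subset_tsupport (deriv g)).trans htg
  have hee' : inner ℝ e' e = 0 := by rw [real_inner_comm]; exact hee
  have hself : inner ℝ e e = 1 := by rw [real_inner_self_eq_norm_sq, he]; norm_num
  have hself' : inner ℝ e' e' = 1 := by rw [real_inner_self_eq_norm_sq, he']; norm_num
  set N := P.carrier with hNdef
  have hz0 := hz f g subset_rfl
  have hz1 := hz (deriv f) g htf
  have hz2 := hz f (deriv g) subset_rfl
  have T1 := isTest_cutRidge hN hNb hχ hf.contDiff_deriv hg.contDiff hθ hθc hθI hz1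
  have T2 := isTest_cutRidge hN hNb hχ hf.contDiff hg.contDiff_deriv hθ hθc hθI hz2
  have T0 := isTest_cutRidge hN hNb hχ hf.contDiff hg.contDiff hθ hθc hθI hz0
  set ψ := cutRidge N χ e e' f g θ with hψ
  set ψ₁ := cutRidge N χ e e' (deriv f) g θ with hψ₁
  set ψ₂ := cutRidge N χ e e' f (deriv g) θ with hψ₂
  let S : E (m + 1) × ℝ → ℂ := fun p => ∑ i, derivGap A₁ A₂ p (EuclideanSpace.single i 1, 0) *
    (fderiv ℝ ψ p (EuclideanSpace.single i 1, 0) : ℂ)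
  -- The part of the integrand in which the derivative falls on χ; the two subtracted terms are
  -- those prepared for the second integration by parts.
  let Er : E (m + 1) × ℝ → ℂ := fun p =>
    S p - derivGap A₁ A₂ p (e, 0) * (ψ₁ p : ℂ) - derivGap A₁ A₂ p (e', 0) * (ψ₂ p : ℂ)
  have iS : Integrable S := integrable_finsetSum _ fun i _ =>
    (T0.fderiv_apply _).integrable_mul hO (h.continuousOn_derivGap_apply _)
  have i1 := T1.integrable_mul (ν := volume) hO (h.continuousOn_derivGap_apply (e, 0))
  have i2 := T2.integrable_mul (ν := volume) hO (h.continuousOn_derivGap_apply (e', 0))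
  have iE : Integrable Er := (iS.sub i1).sub i2
  have k1 := (T1.fderiv_apply (e, 0)).integrable_mul (ν := volume) hO hU
  have k2 := (T2.fderiv_apply (e', 0)).integrable_mul (ν := volume) hO hU
  have hInt : ∫ p, S p = ∫ p, (Er p - stateGap A₁ A₂ p * (fderiv ℝ ψ₁ p (e, 0) : ℂ)
      - stateGap A₁ A₂ p * (fderiv ℝ ψ₂ p (e', 0) : ℂ)) := by
    have ek : Integrable fun p => Er p - stateGap A₁ A₂ p * (fderiv ℝ ψ₁ p (e, 0) : ℂ) := iE.sub k1
    have es : Integrable fun p => S p - derivGap A₁ A₂ p (e, 0) * (ψ₁ p : ℂ) := iS.sub i1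
    rw [integral_sub ek k2, integral_sub iE k1, integral_sub es i2, integral_sub iS i1,
      h.integral_derivGap_mul hN T1, h.integral_derivGap_mul hN T2]
    ring
  have hEr : ∀ x t, Er (x, t) = N.indicator (fun x => ((ridge e e' f g x * θ t : ℝ) : ℂ) *
      ∑ i, derivGap A₁ A₂ (x, t) (EuclideanSpace.single i 1, 0) *
        (fderiv ℝ χ x (EuclideanSpace.single i 1) : ℂ)) x := by
    intro x t
    have hd := fun v => fderiv_cutRidge_apply (e := e) (e' := e') hN hχ hf.contDiff hg.contDiff hθ
      hz0 x v t
    simp only [Er, S, hψ, hψ₁, hψ₂, cutRidge, hd]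
    by_cases hx : x ∈ N
    · simp only [indicator_of_mem hx]
      rw [← sum_apply_single_mul_inner _ e, ← sum_apply_single_mul_inner _ e', Finset.sum_mul,
        Finset.sum_mul, Finset.mul_sum, ← Finset.sum_sub_distrib, ← Finset.sum_sub_distrib]
      refine Finset.sum_congr rfl fun i _ => ?_
      push_cast
      ring
    · simp [indicator_of_notMem hx]
  show ‖∫ p, S p‖ ≤ _
  rw [hInt]
  have hgint : Integrable fun x => c * (b₁ + b₂) * D.indicator (fun _ => (1 : ℝ)) x
      + (m + 1 + 2 * M) * G * b x := by
    refine Integrable.add (Integrable.const_mul ?_ _) (hb.const_mul _)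
    exact (integrable_indicator_iff hDm).2 (integrableOn_const hDv)
  have hval : ∫ x, (c * (b₁ + b₂) * D.indicator (fun _ => (1 : ℝ)) x
      + (m + 1 + 2 * M) * G * b x) =
      c * (b₁ + b₂) * volume.real D + (m + 1 + 2 * M) * G * ∫ x, b x := by
    have iD : Integrable (D.indicator fun _ => (1 : ℝ)) :=
      (integrable_indicator_iff hDm).2 (integrableOn_const hDv)
    rw [integral_add (iD.const_mul _) (hb.const_mul _), integral_const_mul, integral_const_mul,
      integral_indicator_const _ hDm, smul_eq_mul, mul_one]
  rw [← hval]
  refine norm_integral_prod_le hgint (hθ.continuous.integrable_of_hasCompactSupport hθc) ?_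
  intro x t
  have hind : 0 ≤ D.indicator (fun _ => (1 : ℝ)) x := indicator_nonneg (fun _ _ => zero_le_one) _
  have hrhs : 0 ≤ (c * (b₁ + b₂) * D.indicator (fun _ => (1 : ℝ)) x + (m + 1 + 2 * M) * G * b x) := by
    have := hb0 x
    positivity
  have hd1 := fderiv_cutRidge_apply (e := e) (e' := e') hN hχ hf.contDiff_deriv hg.contDiff hθ
    hz1 x e t
  have hd2 := fderiv_cutRidge_apply (e := e) (e' := e') hN hχ hf.contDiff hg.contDiff_deriv hθ
    hz2 x e' t
  rw [hEr, hd1, hd2]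
  by_cases hx : x ∈ N
  swap
  · simp only [indicator_of_notMem hx]
    simpa using mul_nonneg hrhs (hθ0 t)
  by_cases ht : t ∈ Ioo T₁ T₂
  swap
  · have h0 : θ t = 0 := image_eq_zero_of_notMem_tsupport fun hc => ht (hθI hc)
    rw [h0]
    simp
  simp only [indicator_of_mem hx]
  rw [hself, hself', hee, hee', mul_one, mul_zero, mul_one, add_zero, zero_add]
  obtain ⟨g1, g2⟩ := hG x hx t ht
  have gc := hc x hx t ht
  have hbx := hb0 x
  have hχx := hχb x
  set U := stateGap A₁ A₂ (x, t) with hUdef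
  set I := D.indicator (fun _ => (1 : ℝ)) x with hI
  have hap : ∀ v : E (m + 1), ‖v‖ = 1 → |fderiv ℝ χ x v| ≤ b x := fun v hv => by
    have := (fderiv ℝ χ x).le_opNorm v
    rw [hv, mul_one, Real.norm_eq_abs] at this
    exact this.trans hχx
  have hθt := hθ0 t
  have e0 : ‖((ridge e e' f g x * θ t : ℝ) : ℂ) *
      ∑ i, derivGap A₁ A₂ (x, t) (EuclideanSpace.single i 1, 0) *
        (fderiv ℝ χ x (EuclideanSpace.single i 1) : ℂ)‖ ≤ (m + 1) * (G * b x) * θ t := by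
    rw [norm_mul, Complex.norm_real, Real.norm_eq_abs, abs_mul, abs_of_nonneg hθt]
    have h1 := abs_ridge_le (e := e) (e' := e') hf.abs_le_one hg.abs_le_one x
    rw [mul_one] at h1
    have h2 := norm_sum_apply_single_mul_le (derivGap A₁ A₂ (x, t)) (fderiv ℝ χ x)
    push_cast at h2
    have h3 : ‖derivGap A₁ A₂ (x, t)‖ * ‖fderiv ℝ χ x‖ ≤ G * b x :=
      (mul_le_mul_of_nonneg_left hχx (norm_nonneg _)).trans g2
    have h4 := h2.trans (mul_le_mul_of_nonneg_left h3 (by positivity))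
    calc |ridge e e' f g x| * θ t * _ ≤ 1 * θ t * ((m + 1) * (G * b x)) := by gcongr
      _ = _ := by ring
  -- Common bound for the two twice integrated terms: r carries the second derivative of a profile,
  -- and q·d the product of a first derivative with a derivative of χ.
  have step : ∀ (r q d B : ℝ), |r| ≤ B * I → |q| ≤ M → |d| ≤ b x →
      ‖U * (((r + q * d) * θ t : ℝ) : ℂ)‖ ≤ (c * (B * I) + M * (G * b x)) * θ t := by
    intro r q d B hr hq hd
    rw [norm_mul, Complex.norm_real, Real.norm_eq_abs, abs_mul, abs_of_nonneg hθt, ← mul_assoc]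
    refine mul_le_mul_of_nonneg_right ?_ hθt
    have h1 : |r + q * d| ≤ B * I + M * b x := by
      refine (abs_add_le _ _).trans (add_le_add hr ?_)
      rw [abs_mul]; gcongr
    have hr0 : 0 ≤ B * I := (abs_nonneg _).trans hr
    calc ‖U‖ * |r + q * d| ≤ ‖U‖ * (B * I + M * b x) := by gcongr
      _ = ‖U‖ * (B * I) + M * (‖U‖ * b x) := by ring
      _ ≤ _ := by gcongr
  have e1 := step (χ x * ridge e e' (deriv (deriv f)) g x) (ridge e e' (deriv f) g x)
    (fderiv ℝ χ x e) b₁ (by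
      have := abs_mul_ridge_le_indicator hD htf2 subset_rfl hf.abs_deriv_deriv_le hg.abs_le_one
        (hχ1 x) hx
      rwa [mul_one] at this)
    (by
      have := abs_ridge_le (e := e) (e' := e') hf.abs_deriv_le hg.abs_le_one x
      rwa [mul_one] at this) (hap e he)
  have e2 := step (χ x * ridge e e' f (deriv (deriv g)) x) (ridge e e' f (deriv g) x)
    (fderiv ℝ χ x e') b₂ (by
      have := abs_mul_ridge_le_indicator hD subset_rfl htg2 hf.abs_le_one hg.abs_deriv_deriv_le
        (hχ1 x) hx
      rwa [one_mul] at this)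
    (by
      have := abs_ridge_le (e := e) (e' := e') hf.abs_le_one hg.abs_deriv_le x
      rwa [one_mul] at this) (hap e' he')
  refine (norm_sub_le _ _).trans ((add_le_add ((norm_sub_le _ _).trans
    (add_le_add e0 e1)) e2).trans (le_of_eq ?_))
  ring

end IsMatchedPair

/-! ### Localization of the reaction gap -/

theorem sub_mul_integral_le_norm_integral {V : Type*} [MeasurableSpace V] {ν : Measure V}
    {F : V → ℂ} {φ : V → ℝ} {r : ℂ} {q : ℝ} (hφ : Integrable φ ν) (hφ0 : ∀ p, 0 ≤ φ p)
    (hF : Integrable (fun p => F p * (φ p : ℂ)) ν) (h : ∀ p, φ p ≠ 0 → ‖F p - r‖ ≤ q) :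
    (‖r‖ - q) * ∫ p, φ p ∂ν ≤ ‖∫ p, F p * (φ p : ℂ) ∂ν‖ := by
  have h1 : ‖(∫ p, F p * (φ p : ℂ) ∂ν) - r * ((∫ p, φ p ∂ν : ℝ) : ℂ)‖ ≤ q * ∫ p, φ p ∂ν := by
    have hφr : Integrable (fun p => r * (φ p : ℂ)) ν := hφ.ofReal.const_mul r
    rw [← integral_complex_ofReal, ← integral_const_mul, ← integral_const_mul,
      ← integral_sub hF hφr]
    refine norm_integral_le_of_norm_le (hφ.const_mul q) (Filter.Eventually.of_forall fun p => ?_)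
    rw [← sub_mul, norm_mul, Complex.norm_real, Real.norm_of_nonneg (hφ0 p)]
    by_cases h0 : φ p = 0
    · simp [h0]
    · exact mul_le_mul_of_nonneg_right (h p h0) (hφ0 p)
  have h2 : ‖r * ((∫ p, φ p ∂ν : ℝ) : ℂ)‖ = ‖r‖ * ∫ p, φ p ∂ν := by
    rw [norm_mul, Complex.norm_real, Real.norm_of_nonneg (integral_nonneg hφ0)]
  have h3 := norm_sub_norm_le (r * ((∫ p, φ p ∂ν : ℝ) : ℂ)) (∫ p, F p * (φ p : ℂ) ∂ν)
  rw [h2, norm_sub_rev] at h3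
  linarith

/-- The ridge is 1 on D and χ is at least 1 - b, so the cutoff can cost the mass of the test
function no more than the integral of b. -/
theorem le_integral_cutRidge {n : ℕ} {N D : Set (E n)} {χ b : E n → ℝ} {e e' : E n}
    {f g θ : ℝ → ℝ} (hN : IsOpen N) (hNb : Bornology.IsBounded N) (hχ : ContDiff ℝ ∞ χ)
    (hf : ContDiff ℝ ∞ f) (hg : ContDiff ℝ ∞ g) (hf0 : ∀ s, 0 ≤ f s) (hg0 : ∀ s, 0 ≤ g s)
    (hθ0 : ∀ t, 0 ≤ θ t)
    (hz : ∀ x ∉ N, ∀ᶠ z in nhds x, z ∈ N → χ z * ridge e e' f g z = 0)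
    (hb : Integrable b) (hb0 : ∀ x, 0 ≤ b x) (hχ0 : ∀ x, 0 ≤ χ x) (hχb : ∀ x, 1 - b x ≤ χ x)
    (hDN : D ⊆ N) (hDm : MeasurableSet D) (hDv : volume D ≠ ⊤)
    (hD : ∀ x ∈ D, ridge e e' f g x = 1) :
    (volume.real D - ∫ x, b x) * ∫ t, θ t ≤ ∫ p, cutRidge N χ e e' f g θ p := by
  obtain ⟨h1, h2, -⟩ := contDiff_indicator hN (contDiff_cut_ridge hχ hf hg) hz
  set G := N.indicator fun x => χ x * ridge e e' f g x with hG
  have hGc : HasCompactSupport G :=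
    hNb.isCompact_closure.of_isClosed_subset (isClosed_tsupport _) (h2.trans subset_closure)
  have hGi : Integrable G := h1.continuous.integrable_of_hasCompactSupport hGc
  have hmul : ∫ p, cutRidge N χ e e' f g θ p = (∫ x, G x) * ∫ t, θ t := by
    rw [← integral_prod_mul]; rfl
  rw [hmul]
  refine mul_le_mul_of_nonneg_right ?_ (integral_nonneg hθ0)
  have iD : Integrable (D.indicator fun _ => (1 : ℝ)) :=
    (integrable_indicator_iff hDm).2 (integrableOn_const hDv)
  have hval : ∫ x, (D.indicator (fun _ => (1 : ℝ)) x - b x) = volume.real D - ∫ x, b x := by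
    rw [integral_sub iD hb, integral_indicator_const _ hDm, smul_eq_mul, mul_one]
  rw [← hval]
  refine integral_mono (iD.sub hb) hGi fun x => ?_
  have hr : 0 ≤ ridge e e' f g x := mul_nonneg (hf0 _) (hg0 _)
  have hbx := hb0 x
  by_cases hx : x ∈ D
  · rw [hG, indicator_of_mem hx, indicator_of_mem (hDN hx), hD x hx, mul_one]
    exact hχb x
  · rw [indicator_of_notMem hx]
    have : 0 ≤ G x := indicator_nonneg (fun x _ =>
      mul_nonneg (hχ0 x) (mul_nonneg (hf0 _) (hg0 _))) x
    linarith

/-- The constant in the bound for the second derivatives of scaled bump functions. -/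
def bumpConst : ℝ := exists_bump.choose

theorem bumpConst_nonneg : 0 ≤ bumpConst := exists_bump.choose_spec.1

/-- Only the bound on the second derivative has to scale explicitly with r. The bound M on the first
derivative is left unquantified, since it disappears in the limit of thin cutoffs. -/
theorem exists_isProfile (s : ℝ) {r : ℝ} (hr : 0 < r) : ∃ (f : ℝ → ℝ) (M : ℝ),
    IsProfile M (bumpConst / r ^ 2) f ∧ (∀ x, |x - s| ≤ r / 2 → f x = 1) ∧
      tsupport f ⊆ {x | |x - s| < r} ∧ HasCompactSupport f := by
  obtain ⟨f, h1, h2, h3, h4, h5, h6⟩ := exists_bump.choose_spec.2 s r hr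
  obtain ⟨M, hM⟩ := (contDiff_infty_iff_deriv.1 h1).2.continuous.bounded_above_of_compact_support
    h5.deriv
  exact ⟨f, M, ⟨h1, fun s => (h2 s).1, fun s => (h2 s).2, hM, h6⟩, h3, h4, h5⟩

theorem IsProfile.mono {M M' b : ℝ} {f : ℝ → ℝ} (h : IsProfile M b f) (hM : M ≤ M') :
    IsProfile M' b f :=
  ⟨h.contDiff, h.nonneg, h.le_one, fun s => (h.abs_deriv_le s).trans hM, h.abs_deriv_deriv_le⟩

/-! ### Windows in a piece: inclusions and volumes. -/

namespace Piece

variable {m : ℕ} {P : Piece m} {κ K L₀ Λ ε : ℝ}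

/-- The part of the section within distance `ℓ` of `c` in the coordinate `i`. -/
def strip (P : Piece m) (i : Fin m) (c ℓ : ℝ) : Set (E m) := P.cross ∩ {y | |y i - c| < ℓ}

theorem isOpen_strip (hS : IsOpen P.cross) (i : Fin m) (c ℓ : ℝ) : IsOpen (P.strip i c ℓ) :=
  hS.inter (isOpen_lt (by fun_prop) continuous_const)

theorem inner_place_frame_succ (P : Piece m) (a : ℝ) (y : E m) (i : Fin m) :
    inner ℝ (P.place a y) (P.frame i.succ) = inner ℝ (P.curve a) (P.frame i.succ) + y i := by
  rw [place_eq, inner_add_left, inner_lift_frame_succ]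

theorem cell_subset_carrier (s r : ℝ) {A : Set (E m)} (hA : A ⊆ P.cross) :
    P.cell s r A ⊆ P.carrier := by
  rintro _ ⟨a, ha, y, hy, rfl⟩
  exact ⟨a, ha.1, y, hA hy, rfl⟩

namespace IsThin

theorem abs_inner_curve_sub_le (h : P.IsThin κ K L₀ Λ ε) {a b : ℝ} (ha : a ∈ Ioo (-P.L) P.L)
    (hb : b ∈ Ioo (-P.L) P.L) (i : Fin (m + 1)) :
    |inner ℝ (P.curve b) (P.frame i) - inner ℝ (P.curve a) (P.frame i)| ≤ K * |b - a| := by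
  rw [← inner_sub_left]
  refine (abs_real_inner_le_norm _ _).trans ?_
  rw [P.norm_frame, mul_one]
  exact h.norm_curve_sub_le ha hb

theorem abs_sub_lt_of_height (h : P.IsThin κ K L₀ Λ ε) (hκ : 0 < κ) {a a₁ ρ : ℝ}
    (ha : a ∈ Ioo (-P.L) P.L) (ha₁ : a₁ ∈ Ioo (-P.L) P.L)
    (hs : |P.height a - P.height a₁| < κ * ρ) : |a - a₁| < ρ :=
  lt_of_mul_lt_mul_left ((h.le_abs_height_sub ha₁ ha).trans_lt hs) hκ.le

/-- The ridge is localized in the ambient coordinate along the frame, the cell in the section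
coordinate. They differ by the drift of the curve, which is at most 3Kρ ≤ ℓ/8, and ℓ + ℓ/8 stays
below 5ℓ/4. -/
theorem mem_cell_of_abs_lt (h : P.IsThin κ K L₀ Λ ε) (hκ : 0 < κ) (hK : 0 < K) {a₀ a₁ ρ ℓ : ℝ}
    (ha₀ : a₀ ∈ Ioo (-P.L) P.L) (ha₁ : a₁ ∈ Ioo (-P.L) P.L) (h01 : |a₁ - a₀| ≤ 2 * ρ)
    (hKρ : 24 * K * ρ ≤ ℓ) {y₀ : E m} {i : Fin m} {x : E (m + 1)} (hx : x ∈ P.carrier)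
    (hx0 : |inner ℝ x (P.frame 0) - P.height a₁| < κ * ρ)
    (hx1 : |inner ℝ x (P.frame i.succ) - inner ℝ (P.place a₀ y₀) (P.frame i.succ)| < ℓ) :
    x ∈ P.cell (P.height a₁) (κ * ρ) (P.strip i (y₀ i) (5 * ℓ / 4)) := by
  obtain ⟨a, ha, y, hy, rfl⟩ := hx
  rw [inner_place_frame_zero] at hx0
  refine ⟨a, ⟨ha, hx0⟩, y, ⟨hy, ?_⟩, rfl⟩
  have h1 := h.abs_sub_lt_of_height hκ ha ha₁ hx0
  have h2 := h.abs_inner_curve_sub_le ha₀ ha i.succ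
  rw [inner_place_frame_succ, inner_place_frame_succ] at hx1
  have h3 : |a - a₀| ≤ 3 * ρ := by
    have := abs_sub_le a a₁ a₀
    linarith
  have h4 : K * |a - a₀| ≤ ℓ / 8 := by nlinarith
  rw [mem_ofPred_eq, abs_lt]
  rw [abs_lt] at hx1
  have h5 := abs_le.1 (h2.trans h4)
  constructor <;> linarith [h5.1, h5.2, hx1.1, hx1.2]

/-- The same drift of at most ℓ/8, added to the half-width 5ℓ/16 of the small cell, stays below ℓ/2.
So the profiles are equal to 1 on the small cell. -/
theorem abs_le_of_mem_cell (h : P.IsThin κ K L₀ Λ ε) (hκ : 0 < κ) (hK : 0 < K) {a₀ a₁ ρ ℓ : ℝ}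
    (hρ : 0 ≤ ρ) (ha₀ : a₀ ∈ Ioo (-P.L) P.L) (ha₁ : a₁ ∈ Ioo (-P.L) P.L) (h01 : |a₁ - a₀| ≤ 2 * ρ)
    (hKρ : 24 * K * ρ ≤ ℓ) {y₀ : E m} {i : Fin m} {x : E (m + 1)}
    (hx : x ∈ P.cell (P.height a₁) (κ * ρ / 2) (P.strip i (y₀ i) (5 * ℓ / 4 / 4))) :
    |inner ℝ x (P.frame 0) - P.height a₁| ≤ κ * ρ / 2 ∧
      |inner ℝ x (P.frame i.succ) - inner ℝ (P.place a₀ y₀) (P.frame i.succ)| ≤ ℓ / 2 := by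
  obtain ⟨a, ⟨ha, has⟩, y, ⟨-, hyi⟩, rfl⟩ := hx
  rw [inner_place_frame_zero]
  refine ⟨has.le, ?_⟩
  have h1 := h.abs_sub_lt_of_height hκ ha ha₁ (ρ := ρ / 2) (by rw [← mul_div_assoc]; exact has)
  have h2 := h.abs_inner_curve_sub_le ha₀ ha i.succ
  rw [inner_place_frame_succ, inner_place_frame_succ]
  have h3 : |a - a₀| ≤ 3 * ρ := by
    have := abs_sub_le a a₁ a₀
    linarith
  have h4 : K * |a - a₀| ≤ ℓ / 8 := by nlinarith
  rw [mem_ofPred_eq, abs_lt] at hyi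
  have h5 := abs_le.1 (h2.trans h4)
  rw [abs_le]
  constructor <;> linarith [h5.1, h5.2, hyi.1, hyi.2]

theorem dist_le_of_mem_cell (h : P.IsThin κ K L₀ Λ ε) (hκ : 0 < κ) (hK : 0 < K) {a₀ a₁ ρ ℓ : ℝ}
    (ha₀ : a₀ ∈ Ioo (-P.L) P.L) (ha₁ : a₁ ∈ Ioo (-P.L) P.L) (h01 : |a₁ - a₀| ≤ 2 * ρ)
    (hKρ : 24 * K * ρ ≤ ℓ) {y₀ : E m} {i : Fin m} (hS : IsThinSection ε i P.cross)
    (hy₀ : y₀ ∈ P.cross) {x : E (m + 1)}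
    (hx : x ∈ P.cell (P.height a₁) (κ * ρ) (P.strip i (y₀ i) (5 * ℓ / 4))) :
    dist x (P.place a₀ y₀) ≤ 3 * ℓ / 2 + ε := by
  obtain ⟨a, ⟨ha, has⟩, y, ⟨hy, hyi⟩, rfl⟩ := hx
  have h1 := h.abs_sub_lt_of_height hκ ha ha₁ has
  have h3 : |a - a₀| ≤ 3 * ρ := by
    have := abs_sub_le a a₁ a₀
    linarith
  have h4 : K * |a - a₀| ≤ ℓ / 8 := by nlinarith
  have h5 := hS.dist_le y hy y₀ hy₀
  rw [mem_ofPred_eq] at hyi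
  have h6 := h.norm_place_sub_le (y := y₀) (z := y) ha₀ ha
  have h7 := (abs_nonneg _).trans_lt hyi
  linarith

/-- Halving the height range costs a factor 2, and quartering the strip costs 4^m by the doubling
property of the section. The ratio of the two cells is therefore bounded independently of the piece.
-/
theorem volume_cell_le (h : P.IsThin κ K L₀ Λ ε) (hκ : 0 < κ) (hK : 0 < K) {a₁ ρ ℓ : ℝ}
    (hsub : Icc (a₁ - ρ) (a₁ + ρ) ⊆ Ioo (-P.L) P.L) (hρ : 0 < ρ) {i : Fin m}
    (hS : IsThinSection ε i P.cross) {y₀ : E m} (hy₀ : y₀ ∈ P.cross) (hℓ : 0 < ℓ)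
    (hεℓ : 4 * ε < ℓ) :
    volume (P.cell (P.height a₁) (κ * ρ) (P.strip i (y₀ i) ℓ)) ≠ ⊤ ∧
      0 < volume.real (P.cell (P.height a₁) (κ * ρ / 2) (P.strip i (y₀ i) (ℓ / 4))) ∧
      volume (P.cell (P.height a₁) (κ * ρ / 2) (P.strip i (y₀ i) (ℓ / 4))) ≠ ⊤ ∧
      volume.real (P.cell (P.height a₁) (κ * ρ) (P.strip i (y₀ i) ℓ)) ≤
        2 * 4 ^ m * volume.real (P.cell (P.height a₁) (κ * ρ / 2) (P.strip i (y₀ i) (ℓ / 4))) := by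
  have hκρ : 0 < κ * ρ := by positivity
  have v1 := h.volume_cell hκ hK hsub hρ.le le_rfl (isOpen_strip hS.isOpen i (y₀ i) ℓ)
  have v2 := h.volume_cell hκ hK hsub hρ.le (show κ * ρ / 2 ≤ κ * ρ by linarith)
    (isOpen_strip hS.isOpen i (y₀ i) (ℓ / 4))
  have hfin : ∀ r, volume (P.strip i (y₀ i) r) ≠ ⊤ := fun r =>
    ((hS.bounded.subset inter_subset_left).measure_lt_top).ne
  have hpos : 0 < volume (P.strip i (y₀ i) (ℓ / 4)) :=
    (isOpen_strip hS.isOpen i (y₀ i) (ℓ / 4)).measure_pos _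
      ⟨y₀, hy₀, by rw [mem_ofPred_eq, sub_self, abs_zero]; positivity⟩
  have hd : volume (P.strip i (y₀ i) ℓ) ≤ 4 ^ m * volume (P.strip i (y₀ i) (ℓ / 4)) :=
    hS.doubling y₀ hy₀ ℓ hεℓ
  have hd' : volume.real (P.strip i (y₀ i) ℓ) ≤ 4 ^ m * volume.real (P.strip i (y₀ i) (ℓ / 4)) := by
    have := ENNReal.toReal_mono (ENNReal.mul_ne_top (by simp) (hfin (ℓ / 4))) hd
    rw [ENNReal.toReal_mul] at this
    simpa [measureReal_def] using this
  refine ⟨by rw [v1]; exact ENNReal.mul_ne_top ENNReal.ofReal_ne_top (hfin ℓ), ?_,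
    by rw [v2]; exact ENNReal.mul_ne_top ENNReal.ofReal_ne_top (hfin _), ?_⟩
  · rw [measureReal_def, v2, ENNReal.toReal_mul, ENNReal.toReal_ofReal (by positivity)]
    exact mul_pos (by positivity) (ENNReal.toReal_pos hpos.ne' (hfin _))
  · rw [measureReal_def, measureReal_def, v1, v2, ENNReal.toReal_mul, ENNReal.toReal_mul,
      ENNReal.toReal_ofReal (by positivity), ENNReal.toReal_ofReal (by positivity),
      ← measureReal_def, ← measureReal_def]
    calc 2 * (κ * ρ) * volume.real (P.strip i (y₀ i) ℓ)
        ≤ 2 * (κ * ρ) * (4 ^ m * volume.real (P.strip i (y₀ i) (ℓ / 4))) := by gcongr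
      _ = _ := by ring

end IsThin

end Piece

/-! ### The reaction gap at a point -/

namespace IsMatchedPair

variable {m : ℕ} {A₁ A₂ : Params (m + 1)} {P : Piece m}
  {μ α₂ α₃ α₄ C₂ C₃ C₄ κ K L₀ Λ ε T T₁ T₂ : ℝ}

set_option maxHeartbeats 1000000 in
/-- Testing the weak equation in a window of width `κ ρ` along the curve and `ℓ` along the section
bounds the reaction gap at the center by its oscillation and by the size of the state gap. -/
theorem norm_reactionGap_le_of_window
    (h : IsMatchedPair A₁ A₂ P μ α₂ α₃ α₄ C₂ C₃ C₄ κ K L₀ Λ ε T T₁ T₂)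
    (hF : ∀ x ∈ P.carrier, ∀ t ∈ Icc T₁ T₂, A₁.flux (x, t) = A₂.flux (x, t))
    {Ω : Set (E (m + 1))} (hΩ : P.carrier ⊆ Ω) (h₁ : A₁.IsSolution μ Ω T)
    (h₂ : A₂.IsSolution μ Ω T) {i : Fin m} (hS : IsThinSection ε i P.cross) {a₀ a₁ ρ ℓ t₀ q : ℝ}
    {y₀ : E m} (ha₀ : a₀ ∈ Ioo (-P.L) P.L) (hy₀ : y₀ ∈ P.cross) (ht₀ : t₀ ∈ Ioo T₁ T₂)
    (hρ : 0 < ρ) (hsub : Icc (a₁ - ρ) (a₁ + ρ) ⊆ Ioo (-P.L) P.L) (h01 : |a₁ - a₀| ≤ 2 * ρ)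
    (hKρ : 24 * K * ρ ≤ ℓ) (hεℓ : 4 * ε < ℓ)
    (hosc : ∀ x ∈ P.cell (P.height a₁) (κ * ρ) (P.strip i (y₀ i) (5 * ℓ / 4)), ∀ t ∈ Ioo T₁ T₂,
      |t - t₀| < ε → ‖reactionGap A₁ A₂ (x, t) - reactionGap A₁ A₂ (P.place a₀ y₀, t₀)‖ ≤ q) :
    ‖reactionGap A₁ A₂ (P.place a₀ y₀, t₀)‖ ≤ q + 2 * C₄ * ε ^ α₄ +
      μ * (2 * C₄ * ε ^ (1 + α₄) * (bumpConst / (κ * ρ) ^ 2 + bumpConst / ℓ ^ 2)) * (2 * 4 ^ m) := by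
  have hκ := h.κ_pos
  have hK := h.K_pos
  have hε := h.ε_pos
  have hC₄ := h.C₄_pos
  have hμ := h.μ_pos
  have hα₄ := h.α₄_mem.1
  have hℓ : 0 < ℓ := by linarith
  have hκρ : 0 < κ * ρ := by positivity
  have hBc := bumpConst_nonneg
  have ha₁ : a₁ ∈ Ioo (-P.L) P.L := hsub ⟨by linarith, by linarith⟩
  have hN := h.thin.isOpen_carrier hκ hK hS.isOpen
  have hNb := h.thin.isBounded_carrier hK hS.bounded
  have hO : IsOpen (P.carrier ×ˢ Ioo T₁ T₂) := hN.prod isOpen_Ioo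
  set e := P.frame 0 with he
  set e' := P.frame i.succ with he'
  have hen : ‖e‖ = 1 := P.norm_frame 0
  have hen' : ‖e'‖ = 1 := P.norm_frame i.succ
  have hee : inner ℝ e e' = 0 := P.frame.orthonormal.inner_eq_zero (Fin.succ_ne_zero i).symm
  set D₁ := P.cell (P.height a₁) (κ * ρ) (P.strip i (y₀ i) (5 * ℓ / 4)) with hD₁
  set D₂ := P.cell (P.height a₁) (κ * ρ / 2) (P.strip i (y₀ i) (5 * ℓ / 4 / 4)) with hD₂
  obtain ⟨hv1, hv2, hv2', hv12⟩ := h.thin.volume_cell_le hκ hK hsub hρ hS hy₀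
    (ℓ := 5 * ℓ / 4) (by positivity) (by linarith)
  have hD₁m : MeasurableSet D₁ :=
    (h.thin.isOpen_cell hκ hK _ _ (P.isOpen_strip hS.isOpen _ _ _)).measurableSet
  have hD₂m : MeasurableSet D₂ :=
    (h.thin.isOpen_cell hκ hK _ _ (P.isOpen_strip hS.isOpen _ _ _)).measurableSet
  obtain ⟨f, M, hf, hf1, hfs, -⟩ := exists_isProfile (P.height a₁) hκρ
  obtain ⟨g, M', hg, hg1, hgs, -⟩ := exists_isProfile (inner ℝ (P.place a₀ y₀) e') hℓ
  replace hf := hf.mono (le_max_left M M')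
  replace hg := hg.mono (le_max_right M M')
  set M₀ := max M M' with hM₀
  have hM₀0 : 0 ≤ M₀ := (abs_nonneg _).trans (hf.abs_deriv_le 0)
  -- The time radius keeps the support inside the observation interval. It may be arbitrarily small,
  -- because the integral of θ cancels from the final inequality.
  set r := min ε (min (t₀ - T₁) (T₂ - t₀)) with hr
  have hr0 : 0 < r := lt_min hε (lt_min (by linarith [ht₀.1]) (by linarith [ht₀.2]))
  obtain ⟨θ, _, hθ, hθ1, hθs, hθc⟩ := exists_isProfile t₀ hr0
  have hθI : tsupport θ ⊆ Ioo T₁ T₂ := by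
    intro t ht
    have h1 := hθs ht
    rw [mem_ofPred_eq, hr, lt_min_iff, lt_min_iff, abs_lt, abs_lt] at h1
    exact ⟨by linarith [h1.2.1.1], by linarith [(abs_lt.1 h1.2.2).2]⟩
  have hΘ : 0 < ∫ t, θ t := by
    refine hθ.contDiff.continuous.integral_pos_of_hasCompactSupport_nonneg_nonzero hθc hθ.nonneg
      (x := t₀) ?_
    rw [hθ1 t₀ (by rw [sub_self, abs_zero]; positivity)]
    exact one_ne_zero
  have hD : ∀ x ∈ P.carrier, inner ℝ x e ∈ tsupport f → inner ℝ x e' ∈ tsupport g → x ∈ D₁ :=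
    fun x hx h1 h2 => h.thin.mem_cell_of_abs_lt hκ hK ha₀ ha₁ h01 hKρ hx (hfs h1) (hgs h2)
  have hone : ∀ x ∈ D₂, ridge e e' f g x = 1 := fun x hx => by
    obtain ⟨h1, h2⟩ := h.thin.abs_le_of_mem_cell hκ hK hρ.le ha₀ ha₁ h01 hKρ hx
    rw [ridge, hf1 _ h1, hg1 _ h2, mul_one]
  obtain ⟨CZ, hCZ, hcov⟩ := h.thin.exists_finset_cover_lateral h.planar hK hS.isOpen hS.bounded
    hS.lipschitz (Metric.isBounded_Icc _ _) hsub
  obtain ⟨Bχ, hBχ, hcut⟩ := exists_cutoff (m + 1)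
  set w := (volume (Metric.closedBall (0 : E (m + 1)) 1)).toReal with hw
  have hw0 : 0 ≤ w := ENNReal.toReal_nonneg
  set c := 2 * C₄ * ε ^ (1 + α₄) with hc
  have hc0 : 0 ≤ c := by positivity
  set b₁ := bumpConst / (κ * ρ) ^ 2 with hb₁
  set b₂ := bumpConst / ℓ ^ 2 with hb₂
  set r₀ := reactionGap A₁ A₂ (P.place a₀ y₀, t₀) with hr₀
  -- The integrand of the tested equation differs from r₀ by at most the oscillation q plus the
  -- bound on the time derivative of the state gap. Its mean over the window therefore has norm at
  -- least Q.
  set Q := ‖r₀‖ - (q + 2 * C₄ * ε ^ α₄) with hQ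
  set Cw := CZ * 2 ^ (m + 1) * w with hCw
  have hCw0 : 0 ≤ Cw := by positivity
  have hb12 : 0 ≤ b₁ + b₂ := by positivity
  rcases le_total Q 0 with hQ0 | hQ0
  · have : 0 ≤ μ * (c * (b₁ + b₂)) * (2 * 4 ^ m) := by positivity
    linarith
  -- The tested equation at cutoff scale δ. The balls occupy volume at most Cw·δ; this reduces the
  -- mass on the left, and on the right it meets the factor Bχ/δ and leaves the bounded quantity
  -- Bχ·Cw.
  have main : ∀ δ : ℝ, 0 < δ → 2 * δ ≤ 1 → Q * (volume.real D₂ - Cw * δ) ≤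
      μ * (c * (b₁ + b₂) * volume.real D₁
        + (m + 1 + 2 * M₀) * (2 * C₄ * (2 * δ) ^ α₄) * (Bχ * Cw)) := by
    intro δ hδ hδ1
    obtain ⟨Z, hZ1, hZ2, hZ3⟩ := hcov δ hδ (by linarith)
    obtain ⟨χ, hχ, hχ01, hχZ, hχb, hχd⟩ := hcut Z δ hδ
    have hbc : ∫ x, ballCount Z δ x ≤ Cw * δ := by
      rw [integral_ballCount Z hδ]
      calc (Z.card : ℝ) * ((2 * δ) ^ (m + 1) * w)
          ≤ CZ * (1 / δ) ^ m * ((2 * δ) ^ (m + 1) * w) := by gcongr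
        _ = Cw * δ := by
          rw [hCw, mul_pow, pow_succ δ, one_div, inv_pow]; field_simp
    have hz : ∀ k l, tsupport k ⊆ tsupport f → ∀ x ∉ P.carrier, ∀ᶠ z in nhds x,
        z ∈ P.carrier → χ z * ridge e e' k l z = 0 := fun k l hk x hx =>
      h.thin.eventually_cut_ridge_eq_zero hκ hK hS.isOpen hρ.le hsub hZ3 hχZ (hk.trans hfs) e' hx
    have hZ1' : ∀ z ∈ Z, ∃ a ∈ Ioo (-P.L) P.L, ∃ y ∈ frontier P.cross, z = P.place a y := by
      intro z hz
      obtain ⟨a, ha, y, hy, hzy⟩ := hZ1 z hz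
      exact ⟨a, hsub ha, y, hy, hzy⟩
    have hχabs : ∀ x, |χ x| ≤ 1 := fun x => abs_le.2 ⟨by linarith [(hχ01 x).1], (hχ01 x).2⟩
    have hup := h.norm_integral_grad_mul_le hN hNb hen hen' hee hχ hχabs
      ((integrable_ballCount Z δ).const_mul (Bχ / δ)) hχd (G := 2 * C₄ * (2 * δ) ^ α₄) (c := c)
      (fun x hx t ht => by
        obtain ⟨g1, g2⟩ :=
          h.derivGap_mul_ballCount_le hF hS.isOpen hS.lipschitz hδ hδ1 hZ1' hx ht
        have hBδ : 0 ≤ Bχ / δ := by positivity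
        constructor
        · rw [mul_left_comm, mul_left_comm (2 * C₄ * (2 * δ) ^ α₄)]
          exact mul_le_mul_of_nonneg_left g1 hBδ
        · rw [mul_left_comm, mul_left_comm (2 * C₄ * (2 * δ) ^ α₄)]
          exact mul_le_mul_of_nonneg_left g2 hBδ)
      (by positivity) (fun x hx t ht => (h.gap_le hF hS hx ht).1) hc0 hf hg hz hD₁m hv1 hD
      hθ.contDiff hθ.nonneg hθc hθI
    have hT := isTest_cutRidge (e := e) (e' := e') hN hNb hχ hf.contDiff hg.contDiff hθ.contDiff
      hθc hθI (hz f g subset_rfl)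
    have hlow := le_integral_cutRidge (e := e) (e' := e') hN hNb hχ hf.contDiff hg.contDiff
      hf.nonneg hg.nonneg hθ.nonneg (hz f g subset_rfl) (integrable_ballCount Z δ)
      (ballCount_nonneg Z δ) (fun x => (hχ01 x).1) hχb
      (P.cell_subset_carrier _ _ inter_subset_left) hD₂m hv2' hone
    set φ := cutRidge P.carrier χ e e' f g θ with hφ
    have hφ0 : ∀ p, 0 ≤ φ p := fun p => mul_nonneg (indicator_nonneg (fun x _ =>
      mul_nonneg (hχ01 x).1 (mul_nonneg (hf.nonneg _) (hg.nonneg _))) _) (hθ.nonneg _)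
    have hφi : Integrable φ := hT.contDiff.continuous.integrable_of_hasCompactSupport hT.compact
    have hcont : ContinuousOn (fun p => reactionGap A₁ A₂ p - derivGap A₁ A₂ p (0, 1))
        (P.carrier ×ˢ Ioo T₁ T₂) :=
      (h.continuousOn_reactionGap.mono h.subset_closure_prod).sub
        (h.continuousOn_derivGap_apply (0, 1))
    have hmid := sub_mul_integral_le_norm_integral (r := r₀) (q := q + 2 * C₄ * ε ^ α₄) hφi hφ0
      (hT.integrable_mul hO hcont) (by
        rintro ⟨x, t⟩ hp
        have hp1 := left_ne_zero_of_mul hp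
        have hp2 : θ t ≠ 0 := right_ne_zero_of_mul hp
        have hx : x ∈ P.carrier := by
          by_contra hx
          exact hp1 (indicator_of_notMem hx _)
        rw [indicator_of_mem (show (x, t).1 ∈ P.carrier from hx)] at hp1
        have hp3 := right_ne_zero_of_mul hp1
        have htt := subset_tsupport _ hp2
        have hxD := hD x hx (subset_tsupport _ (left_ne_zero_of_mul hp3))
          (subset_tsupport _ (right_ne_zero_of_mul hp3))
        have htε : |t - t₀| < ε := lt_of_lt_of_le (hθs htt) (min_le_left _ _)
        have q1 := hosc x hxD t (hθI htt) htε
        have q2 := (h.gap_le hF hS hx (hθI htt)).2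
        have q3 := (derivGap A₁ A₂ (x, t)).le_opNorm (0, 1)
        have q4 : ‖((0 : E (m + 1)), (1 : ℝ))‖ = 1 := by rw [Prod.norm_def]; simp
        rw [q4, mul_one] at q3
        rw [sub_right_comm]
        exact (norm_sub_le _ _).trans (add_le_add q1 (q3.trans q2)))
    rw [h.weak_identity hF hN hΩ h₁ h₂ hT, norm_mul, Complex.norm_real,
      Real.norm_of_nonneg hμ.le] at hmid
    have hbi : ∫ x, Bχ / δ * ballCount Z δ x ≤ Bχ * Cw := by
      rw [integral_const_mul]
      calc Bχ / δ * ∫ x, ballCount Z δ x ≤ Bχ / δ * (Cw * δ) :=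
            mul_le_mul_of_nonneg_left hbc (by positivity)
        _ = Bχ * Cw := by field_simp
    have hfin : Q * (volume.real D₂ - Cw * δ) * ∫ t, θ t ≤
        μ * (c * (b₁ + b₂) * volume.real D₁
          + (m + 1 + 2 * M₀) * (2 * C₄ * (2 * δ) ^ α₄) * (Bχ * Cw)) * ∫ t, θ t := by
      calc Q * (volume.real D₂ - Cw * δ) * ∫ t, θ t
          = Q * ((volume.real D₂ - Cw * δ) * ∫ t, θ t) := by ring
        _ ≤ Q * ((volume.real D₂ - ∫ x, ballCount Z δ x) * ∫ t, θ t) :=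
          mul_le_mul_of_nonneg_left
            (mul_le_mul_of_nonneg_right (sub_le_sub_left hbc _) hΘ.le) hQ0
        _ ≤ Q * ∫ p, φ p := mul_le_mul_of_nonneg_left hlow hQ0
        _ ≤ _ := hmid
        _ ≤ μ * ((c * (b₁ + b₂) * volume.real D₁ + (m + 1 + 2 * M₀) * (2 * C₄ * (2 * δ) ^ α₄) *
            ∫ x, Bχ / δ * ballCount Z δ x) * ∫ t, θ t) := by gcongr
        _ ≤ μ * ((c * (b₁ + b₂) * volume.real D₁ + (m + 1 + 2 * M₀) * (2 * C₄ * (2 * δ) ^ α₄) *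
            (Bχ * Cw)) * ∫ t, θ t) := by gcongr
        _ = _ := by ring
    exact le_of_mul_le_mul_right hfin hΘ
  -- As δ → 0 the constants tied to the particular piece and profiles (CZ, Bχ, M₀) drop out, and
  -- only the ratio of the two window volumes survives.
  have hl0 : Filter.Tendsto (fun δ : ℝ => δ) (nhdsWithin 0 (Ioi 0)) (nhds 0) :=
    tendsto_nhdsWithin_of_tendsto_nhds Filter.tendsto_id
  have hlimL : Filter.Tendsto (fun δ : ℝ => Q * (volume.real D₂ - Cw * δ))
      (nhdsWithin 0 (Ioi 0)) (nhds (Q * volume.real D₂)) := by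
    have := ((hl0.const_mul Cw).const_sub (volume.real D₂)).const_mul Q
    simpa using this
  have hlimR : Filter.Tendsto (fun δ : ℝ => μ * (c * (b₁ + b₂) * volume.real D₁
      + (m + 1 + 2 * M₀) * (2 * C₄ * (2 * δ) ^ α₄) * (Bχ * Cw)))
      (nhdsWithin 0 (Ioi 0)) (nhds (μ * (c * (b₁ + b₂) * volume.real D₁))) := by
    have hp : Filter.Tendsto (fun δ : ℝ => (2 * δ) ^ α₄) (nhdsWithin 0 (Ioi 0)) (nhds 0) := by
      have := (hl0.const_mul 2).rpow_const (p := α₄) (Or.inr hα₄.le)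
      rwa [mul_zero, Real.zero_rpow hα₄.ne'] at this
    have := ((((hp.const_mul (2 * C₄)).const_mul ((m : ℝ) + 1 + 2 * M₀)).mul_const
      (Bχ * Cw)).const_add (c * (b₁ + b₂) * volume.real D₁)).const_mul μ
    simpa using this
  have hlim := le_of_tendsto_of_tendsto hlimL hlimR (by
    filter_upwards [self_mem_nhdsWithin, mem_nhdsWithin_of_mem_nhds (Iio_mem_nhds
      (show (0 : ℝ) < 1 / 2 by norm_num))] with δ (hδ : 0 < δ) (hδ1 : δ < 1 / 2)
    exact main δ hδ (by linarith))
  have hfin : Q * volume.real D₂ ≤ μ * (c * (b₁ + b₂)) * (2 * 4 ^ m) * volume.real D₂ := by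
    refine hlim.trans ?_
    calc μ * (c * (b₁ + b₂) * volume.real D₁)
        ≤ μ * (c * (b₁ + b₂) * (2 * 4 ^ m * volume.real D₂)) := by gcongr
      _ = _ := by ring
  have := le_of_mul_le_mul_right hfin hv2
  linarith

end IsMatchedPair

/-! ### The reaction estimate -/

/-- Near an end of the curve no window is centred at the point itself. It is moved by 2ρ towards the
middle, which the preceding window estimates allow for. -/
theorem exists_Icc_subset_Ioo_near {L a₀ ρ : ℝ} (ha₀ : a₀ ∈ Ioo (-L) L) (hρ : 0 < ρ)
    (hL : 4 * ρ ≤ L) : ∃ a₁, |a₁ - a₀| ≤ 2 * ρ ∧ Icc (a₁ - ρ) (a₁ + ρ) ⊆ Ioo (-L) L := by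
  rcases le_total a₀ 0 with h | h
  · refine ⟨a₀ + 2 * ρ, by rw [add_sub_cancel_left, abs_of_pos (by linarith)], fun a ha => ?_⟩
    exact ⟨by linarith [ha.1, ha₀.1], by linarith [ha.2]⟩
  · refine ⟨a₀ - 2 * ρ, ?_, fun a ha => ?_⟩
    · rw [sub_sub_cancel_left, abs_neg, abs_of_pos (by linarith)]
    · exact ⟨by linarith [ha.1], by linarith [ha.2, ha₀.2]⟩

/-- With a window of size ℓ = ε^s the competing errors are the oscillation ℓ^(α₂α₄), the time
derivative ε^α₄ and the diffusion term ε^(1+α₄)/ℓ². The choice of s turns the first into exactly the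
claimed power, and the other two are no larger for small ε. -/
theorem reaction_estimate (m : ℕ) (hm : m = 1 ∨ m = 2) (μ : ℝ) (hμ : 0 < μ)
    (α₂ α₃ α₄ : ℝ) (hα₂ : α₂ ∈ Ioo (0 : ℝ) 1) (hα₃ : α₃ ∈ Ioo (0 : ℝ) 1)
    (hα₄ : α₄ ∈ Ioo (0 : ℝ) 1) (C₂ C₄ : ℝ) (hC₂ : 0 < C₂) (hC₄ : 0 < C₄) :
    ∃ C : ℝ, 0 < C ∧ ∀ C₃ κ K L₀ Λ : ℝ, 0 < C₃ → 0 < κ → 0 < K → 0 < L₀ → 0 < Λ →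
      ∃ ε₀ : ℝ, 0 < ε₀ ∧ ∀ ε : ℝ, 0 < ε → ε < ε₀ → ∀ X : Setting m,
        X.IsAdmissible μ α₂ α₃ α₄ C₂ C₃ C₄ κ K L₀ Λ ε →
        (∀ x ∈ ⋃ j, (X.piece j).carrier, ∀ t ∈ Icc X.T₁ X.T₂,
          X.A₁.flux (x, t) = X.A₂.flux (x, t)) →
        ∀ x ∈ ⋃ j, (X.piece j).carrier, ∀ t ∈ Icc X.T₁ X.T₂,
          ‖X.A₁.reaction (x, t) - X.A₂.reaction (x, t)‖ ≤ C * ε ^ tau₁ α₂ α₄ := by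
  have h2 := hα₂.1
  have h4 := hα₄.1
  set β := α₂ * α₄ with hβ
  have hβ0 : 0 < β := mul_pos h2 h4
  set H := 2 * reactionConst (m + 1) α₂ C₂ C₄ * 2 ^ β with hH
  have hrc : 0 ≤ reactionConst (m + 1) α₂ C₂ C₄ := by
    rw [reactionConst]; positivity
  have hH0 : 0 ≤ H := by positivity
  -- H comes from the oscillation over the window, 2 C₄ from the time derivative, and 1 from the
  -- diffusion term after absorption into ε₀.
  refine ⟨H + 2 * C₄ + 1, by positivity, fun C₃ κ K L₀ Λ hC₃ hκ hK hL₀ hΛ => ?_⟩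
  -- This s solves sβ = α₄ - s, which balances ℓ^β against ε^α₄/ℓ, the size that a single
  -- integration by parts would give. Since s < 1, the second integration by parts gains the further
  -- factor ε^(1-s).
  set s := α₄ / (1 + β) with hs
  have hs0 : 0 < s := by positivity
  have hsα : s < α₄ := div_lt_self h4 (by linarith)
  have hs1 : s < 1 := hsα.trans hα₄.2
  have hτ : tau₁ α₂ α₄ = s * β := by
    rw [tau₁, hs, hβ]; ring
  have hsβ : s * β = α₄ - s := by
    rw [hs]; field_simp; ring
  have hB := bumpConst_nonneg
  -- The constant of the diffusion term, with ρ = ℓ/(24K) inserted. It involves K/κ and is harmless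
  -- because 1 + α₄ - 2s exceeds sβ strictly.
  set c := μ * (2 * C₄ * (bumpConst * (24 * K / κ) ^ 2 + bumpConst)) * (2 * 4 ^ m) with hc
  refine exists_forall_of_eventually ?_
  filter_upwards [eventually_mul_rpow_lt hs0 2 one_pos, eventually_mul_rpow_le_rpow hs1 5,
    eventually_mul_rpow_lt hs0 (4 / (24 * K)) hL₀, eventually_le_one,
    eventually_mul_rpow_le_rpow (show s * β < 1 + α₄ - 2 * s by linarith) c,
    self_mem_nhdsWithin] with ε hsmall hεs hρL hε1 hlast (hε : 0 < ε)
  intro X hX hflux x hx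
  obtain ⟨j, hxj⟩ := mem_iUnion.1 hx
  have hM := hX.isMatchedPair hm hμ hα₂ hα₃ hα₄ hC₂ hC₃ hC₄ hκ hK hε j
  have hF : ∀ x ∈ (X.piece j).carrier, ∀ t ∈ Icc X.T₁ X.T₂,
      X.A₁.flux (x, t) = X.A₂.flux (x, t) := fun x hx => hflux x (mem_iUnion.2 ⟨j, hx⟩)
  have hcont : ContinuousOn (fun t => reactionGap X.A₁ X.A₂ (x, t)) (Icc X.T₁ X.T₂) :=
    hM.continuousOn_reactionGap.comp (by fun_prop) fun t ht =>
      ⟨subset_closure hxj, hM.mem_Icc ht⟩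
  refine norm_le_on_Icc_of_Ioo hM.T₁_lt_T₂ hcont fun t₀ ht₀ => ?_
  obtain ⟨a₀, ha₀, y₀, hy₀, rfl⟩ := id hxj
  obtain ⟨i, hS⟩ := hM.thin.exists_isThinSection hm
  rw [Real.rpow_one] at hεs
  set ℓ := ε ^ s with hℓ
  have hℓ0 : 0 < ℓ := Real.rpow_pos_of_pos hε s
  set ρ := ℓ / (24 * K) with hρ
  have hρ0 : 0 < ρ := by positivity
  have hKρ : 24 * K * ρ = ℓ := by rw [hρ]; field_simp
  have hρL' : 4 * ρ ≤ (X.piece j).L := by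
    have h5 : 4 / (24 * K) * ℓ = 4 * ρ := by rw [hρ]; ring
    rw [h5] at hρL
    exact hρL.le.trans hM.thin.le_L
  obtain ⟨a₁, h01, hsub⟩ := exists_Icc_subset_Ioo_near ha₀ hρ0 hρL'
  have ha₁ : a₁ ∈ Ioo (-(X.piece j).L) (X.piece j).L := hsub ⟨by linarith, by linarith⟩
  have key := hM.norm_reactionGap_le_of_window hF
    (subset_iUnion (fun j => (X.piece j).carrier) j) hX.solution₁ hX.solution₂ hS (q := H * ε ^ (s * β)) ha₀ hy₀ ht₀ hρ0 hsub h01 hKρ.le (by linarith) (by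
      intro x hx t ht htt
      have hxN : x ∈ (X.piece j).carrier := Piece.cell_subset_carrier _ _ inter_subset_left hx
      have hd1 := hM.thin.dist_le_of_mem_cell hκ hK ha₀ ha₁ h01 hKρ.le hS hy₀ hx
      have hd : dist (x, t) ((X.piece j).place a₀ y₀, t₀) ≤ 2 * ℓ := by
        rw [Prod.dist_eq, Real.dist_eq]
        exact max_le (by linarith) (by linarith)
      refine (hM.norm_reactionGap_sub_le ⟨subset_closure hxN, hM.mem_Icc (Ioo_subset_Icc_self ht)⟩
        ⟨subset_closure hxj, hM.mem_Icc (Ioo_subset_Icc_self ht₀)⟩ (hd.trans hsmall.le)).trans ?_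
      calc 2 * reactionConst (m + 1) α₂ C₂ C₄ *
            dist (x, t) ((X.piece j).place a₀ y₀, t₀) ^ (α₂ * α₄)
          ≤ 2 * reactionConst (m + 1) α₂ C₂ C₄ * (2 * ℓ) ^ β := by gcongr
        _ = H * ε ^ (s * β) := by
          rw [Real.mul_rpow (by norm_num) hℓ0.le, hℓ, ← Real.rpow_mul hε.le, hH]; ring)
  rw [hτ]
  refine key.trans ?_
  have e1 : ε ^ α₄ ≤ ε ^ (s * β) :=
    Real.rpow_le_rpow_of_exponent_ge hε hε1 (by linarith)
  have e2 : μ * (2 * C₄ * ε ^ (1 + α₄) * (bumpConst / (κ * ρ) ^ 2 + bumpConst / ℓ ^ 2))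
      * (2 * 4 ^ m) = c * ε ^ (1 + α₄ - 2 * s) := by
    have h5 : ε ^ (1 + α₄ - 2 * s) = ε ^ (1 + α₄) / ℓ ^ 2 := by
      rw [Real.rpow_sub hε, hℓ, ← Real.rpow_natCast, ← Real.rpow_mul hε.le]
      norm_num [mul_comm]
    rw [h5, hc, hρ]
    field_simp
  rw [e2]
  have e3 := mul_le_mul_of_nonneg_left e1 (show 0 ≤ 2 * C₄ by positivity)
  linarith

end ThinRDC

end

theorem theorem5p1 (m : ℕ) (hm : m = 1 ∨ m = 2) (μ : ℝ) (hμ : 0 < μ)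
    (α₂ α₃ α₄ : ℝ) (hα₂ : α₂ ∈ Set.Ioo (0 : ℝ) 1) (hα₃ : α₃ ∈ Set.Ioo (0 : ℝ) 1)
    (hα₄ : α₄ ∈ Set.Ioo (0 : ℝ) 1) (C₂ C₄ : ℝ) (hC₂ : 0 < C₂) (hC₄ : 0 < C₄) :
    (∀ l : ℝ, 0 < l → l < 1 + α₃ * α₄ →
      ∃ C : ℝ, 0 < C ∧ ∀ C₃ κ K L₀ Λ : ℝ, 0 < C₃ → 0 < κ → 0 < K → 0 < L₀ → 0 < Λ →
        ∃ ε₀ : ℝ, 0 < ε₀ ∧ ∀ ε : ℝ, 0 < ε → ε < ε₀ → ∀ X : ThinRDC.Setting m,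
          X.IsAdmissible μ α₂ α₃ α₄ C₂ C₃ C₄ κ K L₀ Λ ε →
          (∀ j, (X.piece j).TangentsRecur ε l) →
          ∀ j, ∀ k ∈ (X.piece j).resolved, ∀ x ∈ (X.piece j).carrier,
            ∀ t ∈ Set.Icc X.T₁ X.T₂,
              ‖ThinRDC.rotated (X.piece j) k (X.A₁.c (x, t)) * X.A₁.u (x, t)
                - ThinRDC.rotated (X.piece j) k (X.A₂.c (x, t)) * X.A₂.u (x, t)‖
                ≤ C * ε ^ ThinRDC.tau (α₃ * α₄) l) ∧
    (∃ C' : ℝ, 0 < C' ∧ ∀ C₃ κ K L₀ Λ : ℝ, 0 < C₃ → 0 < κ → 0 < K → 0 < L₀ → 0 < Λ →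
      ∃ ε₀ : ℝ, 0 < ε₀ ∧ ∀ ε : ℝ, 0 < ε → ε < ε₀ → ∀ X : ThinRDC.Setting m,
        X.IsAdmissible μ α₂ α₃ α₄ C₂ C₃ C₄ κ K L₀ Λ ε →
        (∀ x ∈ ⋃ j, (X.piece j).carrier, ∀ t ∈ Set.Icc X.T₁ X.T₂,
          X.A₁.flux (x, t) = X.A₂.flux (x, t)) →
        ∀ x ∈ ⋃ j, (X.piece j).carrier, ∀ t ∈ Set.Icc X.T₁ X.T₂,
          ‖X.A₁.reaction (x, t) - X.A₂.reaction (x, t)‖ ≤ C' * ε ^ ThinRDC.tau₁ α₂ α₄) := by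
  exact ⟨fun l hl _ =>
      ThinRDC.flux_estimate m hm μ hμ α₂ α₃ α₄ hα₂ hα₃ hα₄ C₂ C₄ hC₂ hC₄ l hl,
    ThinRDC.reaction_estimate m hm μ hμ α₂ α₃ α₄ hα₂ hα₃ hα₄ C₂ C₄ hC₂ hC₄⟩
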